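/- Let $d\in\{1,2,3\}$, $0<\alpha\le\beta<\infty$ and $0<c_1\le c_2$. Then there is a constant $C>0$, depending only on $d,\alpha,\beta,c_1,c_2$, such that the following holds. Setting. Let $D\subset\mathbb R^d$ be an axis-parallel open box with a uniform Cartesian mesh $\mathcal T_H$ of cubes with edge length $H<1/4$. Let $\mathcal T_\varepsilon$ and $\mathcal T_h$ be uniform refinements of $\mathcal T_H$ and of $\mathcal T_\varepsilon$, respectively, with edge lengths $h<\varepsilon<H$ ($H/\varepsilon$ and $\varepsilon/h$ are integers $\ge2$). Let $\ell\in\mathbb N$ with $c_1|\log H|\le \ell\le c_2|\log H|$. For $\bullet\in\{H,h\}$ let $V_\bullet$ be the space of continuous functions that are polynomials of coordinate degree at most one on every element of $\mathcal T_\bullet$ and vanish on $\partial D$, and let $\{\Lambda_i\}$ be the nodal basis of $V_H$. Let $\mathcal I_H=E_H\circ\Pi_H$, where $\Pi_H$ is the elementwise $L^2$-projection onto polynomials of coordinate degree at most one, and $E_H$ produces the element of $V_H$ whose value at each inner node is the mean of the values given there by the adjacent elements. Set $\mathtt N(S)=\bigcup\{\overline K: K\in\mathcal T_H,\ \overline S\cap\overline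 K\neq\emptyset\}$, $\mathtt N^\ell=\mathtt N\circ\dots\circ\mathtt N$ ($\ell$ times), and $\mathcal W(S)=\{w\in V_h:\mathcal I_Hw=0,\ \operatorname{supp}w\subseteq S\}$. Let $\mathfrak A_\varepsilon$ be the set of all $A\in L^\infty(D)$ with $\alpha\le A\le\beta$ a.e. that are constant on every element of $\mathcal T_\varepsilon$. Write $a(u,v)=\int_D A\nabla u\cdot\nabla v\,dx$. Let $K\in\mathcal T_H$ be an element that is at least $\ell+1$ layers of elements away from $\partial D$, and let $\omega=\mathtt N^\ell(K)$. Then $\omega$ contains $m_\ell=((2\ell+1)H/\varepsilon)^d$ elements of $\mathcal T_\varepsilon$ and $N_\ell=(2\ell+2)^d$ nodes of $\mathcal T_H$ (including those on $\partial\omega$). Let $\mathbf A_{\varepsilon,\omega}\in\mathbb R^{m_\ell}$ be the vector of the values of $A$ on these elements, in an enumeration that does not depend on the position of $K$. For $v\in V_H$ the element corrector $\mathcal Q_K^\ell(v|_K)\in\mathcal W(\omega)$ is defined by $a(\mathcal Q_K^\ell(v|_K),w)=\int_K A\nabla v\cdot\nabla w\,dx$ for all $w\in\mathcal W(\omega)$.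 The local PG-LOD matrix is $\mathbf S^{\mathrm{pg}}_\omega\in\mathbb R^{N_\ell\times2^d}$, $$\mathbf S^{\mathrm{pg}}_\omega[i,j]=a\big(\Lambda_i,(\mathrm{id}-\mathcal Q_K^\ell)(\Lambda_j|_K)\big)=\int_K A\nabla\Lambda_i\cdot\nabla\Lambda_j\,dx-a\big(\Lambda_i,\mathcal Q_K^\ell(\Lambda_j|_K)\big),$$ where $i$ runs through the nodes of $\omega$ and $j$ through the vertices of $K$. A neural network $\Psi$ of depth $L(\Psi)\ge1$ is a sequence of $L(\Psi)$ weight matrices and bias vectors of matching dimensions. $\mathcal R(\Psi)$ is the function that it realizes with the activation function $\rho(x)=\max\{0,x\}$ after every layer but the last, $M(\Psi)$ is its number of non-zero weights and biases, and $\mathrm{mat}$ reads a vector of length $N_\ell2^d$ columnwise as an $N_\ell\times 2^d$ matrix. Claim. For every integer $k\ge1$ there is a neural network $\Psi=\Psi^{\mathrm{pg}}_{H^k}$ with input dimension $m_\ell$ and output dimension $N_\ell2^d$ such that, for every such $K$ with $\omega=\mathtt N^\ell(K)$ and every $A\in\mathfrak A_\varepsilon$, $$\big\|\mathbf S^{\mathrm{pg}}_\omega-\mathrm{mat}\big(\mathcal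 R(\Psi)(\mathbf A_{\varepsilon,\omega})\big)\big\|_2\le C\,H^k$$ in the spectral norm, and $$\text{(i)}\quad L(\Psi)\le C\,k\,\big(|\log h|^2+|\log k|^2\big),$$ $$\text{(ii)}\quad M(\Psi)\le C\,h^{-2}\big(k|\log H|+|\log h|\big)\big(|\log h|^3+|\log k|^3\big)\big(|\log H|\,H/h\big)^{3d}.$$ In particular, $L(\Psi)\lesssim|\log h|^2+|\log k|^2$ with a hidden constant that does not depend on $H,\varepsilon,h$ but may depend on $k$. -/

import Mathlib

open MeasureTheory

noncomputable section

/-! ### ReLU neural networks -/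

/-- A neural network with input dimension `n` and output dimension `m`: a nonempty sequence of
layers (weight matrix, bias vector) with matching dimensions. -/
inductive NeuralNetwork : ℕ → ℕ → Type
  | last {n m : ℕ} (W : Matrix (Fin m) (Fin n) ℝ) (b : Fin m → ℝ) : NeuralNetwork n m
  | cons {n k m : ℕ} (W : Matrix (Fin k) (Fin n) ℝ) (b : Fin k → ℝ)
      (Ψ : NeuralNetwork k m) : NeuralNetwork n m

namespace NeuralNetwork

/-- Number of layers. -/
def depth : {n m : ℕ} → NeuralNetwork n m → ℕ
  | _, _, last _ _ => 1
  | _, _, cons _ _ Ψ => Ψ.depth + 1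

/-- Number of non-zero entries of the weight matrix and the bias vector of one layer. -/
def layerParams {n m : ℕ} (W : Matrix (Fin m) (Fin n) ℝ) (b : Fin m → ℝ) : ℕ :=
  Set.ncard {p : Fin m × Fin n | W p.1 p.2 ≠ 0} + Set.ncard {i : Fin m | b i ≠ 0}

/-- Total number of non-zero parameters. -/
def numParams : {n m : ℕ} → NeuralNetwork n m → ℕ
  | _, _, last W b => layerParams W b
  | _, _, cons W b Ψ => layerParams W b + Ψ.numParams

/-- The function realized by the network with the activation `t ↦ max 0 t`, which is applied
componentwise after every layer except the last one. -/
def realize : {n m : ℕ} → NeuralNetwork n m → (Fin n → ℝ) → (Fin m → ℝ)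
  | _, _, last W b, x => W.mulVec x + b
  | _, _, cons W b Ψ, x => Ψ.realize (fun i => max 0 ((W.mulVec x + b) i))

end NeuralNetwork

/-- Columnwise reading of a vector of length `p * q` as a `p × q` matrix. -/
def matOfVec {p q : ℕ} (v : Fin (p * q) → ℝ) : Matrix (Fin p) (Fin q) ℝ :=
  Matrix.of fun i j => v (Fin.cast (Nat.mul_comm q p) (finProdFinEquiv (j, i)))

open scoped Matrix.Norms.L2Operator in
/-- The spectral norm: the operator norm with respect to the Euclidean vector norms. -/
def spectralNorm2 {p q : ℕ} (M : Matrix (Fin p) (Fin q) ℝ) : ℝ := ‖M‖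

/-! ### Cartesian meshes and first-order finite elements -/

/-- A uniform Cartesian mesh of an axis-parallel box in `ℝ^d`: the corner of the box, the edge
length of the elements and the number of elements in each direction. -/
structure CartesianMesh (d : ℕ) where
  origin : Fin d → ℝ
  size : ℝ
  count : Fin d → ℕ

/-- Polynomials of coordinate degree at most one, as functions on `ℝ^d`. -/
def Q1Poly (d : ℕ) : Submodule ℝ ((Fin d → ℝ) → ℝ) :=
  Submodule.span ℝ (Set.range fun (s : Finset (Fin d)) (x : Fin d → ℝ) => ∏ i ∈ s, x i)

/-- `p` is the `L²(S)`-orthogonal projection of `v` onto the polynomials of coordinate degree at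
most one. -/
def IsL2Proj {d : ℕ} (S : Set (Fin d → ℝ)) (v p : (Fin d → ℝ) → ℝ) : Prop :=
  p ∈ Q1Poly d ∧ ∀ q ∈ Q1Poly d, ∫ x in S, p x * q x = ∫ x in S, v x * q x

def l2Proj {d : ℕ} (S : Set (Fin d → ℝ)) (v : (Fin d → ℝ) → ℝ) : (Fin d → ℝ) → ℝ :=
  Classical.epsilon (IsL2Proj S v)

/-- `∫_S A ∇u · ∇v`. For piecewise polynomials `u`, `v` the classical partial derivatives exist
almost everywhere; for continuous ones they are the weak derivatives. -/
def energyForm {d : ℕ} (A : (Fin d → ℝ) → ℝ) (S : Set (Fin d → ℝ))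
    (u v : (Fin d → ℝ) → ℝ) : ℝ :=
  ∫ x in S, A x * ∑ i : Fin d, fderiv ℝ u x (Pi.single i 1) * fderiv ℝ v x (Pi.single i 1)

namespace CartesianMesh

variable {d : ℕ}

/-- The (open) box `D` which is meshed. -/
def domain (T : CartesianMesh d) : Set (Fin d → ℝ) :=
  {x | ∀ i, T.origin i < x i ∧ x i < T.origin i + T.count i * T.size}

/-- Multi-indices of the elements. -/
def elems (T : CartesianMesh d) : Finset (Fin d → ℕ) :=
  Fintype.piFinset fun i => Finset.range (T.count i)

/-- The closed element with multi-index `q`. -/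
def cell (T : CartesianMesh d) (q : Fin d → ℕ) : Set (Fin d → ℝ) :=
  Set.Icc (fun i => T.origin i + q i * T.size) (fun i => T.origin i + (q i + 1) * T.size)

/-- The node with multi-index `z`. -/
def node (T : CartesianMesh d) (z : Fin d → ℕ) : Fin d → ℝ :=
  fun i => T.origin i + z i * T.size

/-- Multi-indices of the nodes that do not lie on the boundary of the box. -/
def innerNodes (T : CartesianMesh d) : Finset (Fin d → ℕ) :=
  Fintype.piFinset fun i => Finset.Ioo 0 (T.count i)

/-- The uniform refinement which divides every edge into `r` parts. -/
def refine (T : CartesianMesh d) (r : ℕ) : CartesianMesh d where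
  origin := T.origin
  size := T.size / r
  count := fun i => r * T.count i

/-- The conforming finite element space `Q¹(T) ∩ H¹₀(D)`; its members are extended by zero to
`ℝ^d`. -/
def feSpace (T : CartesianMesh d) : Set ((Fin d → ℝ) → ℝ) :=
  {u | Continuous u ∧ (∀ q ∈ T.elems, ∃ p ∈ Q1Poly d, Set.EqOn u p (T.cell q)) ∧
    ∀ x, x ∉ T.domain → u x = 0}

/-- The nodal basis function of the node with multi-index `z`. -/
def hat (T : CartesianMesh d) (z : Fin d → ℕ) (x : Fin d → ℝ) : ℝ :=
  ∏ i, max 0 (1 - |x i - T.node z i| / T.size)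

open Classical in
/-- Multi-indices of the elements whose closure contains the node `z`. -/
def elemsAt (T : CartesianMesh d) (z : Fin d → ℕ) : Finset (Fin d → ℕ) :=
  T.elems.filter fun q => T.node z ∈ T.cell q

/-- The value at the node `z` of the average of the elementwise given functions `p q`. -/
def nodeAverage (T : CartesianMesh d) (p : (Fin d → ℕ) → (Fin d → ℝ) → ℝ)
    (z : Fin d → ℕ) : ℝ :=
  ∑ q ∈ T.elemsAt z, p q (T.node z) * (1 / ((T.elemsAt z).card : ℝ))

/-- The quasi-interpolation operator: elementwise `L²`-projection, then averaging of the values at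
the inner nodes, and zero values at the nodes on the boundary. -/
def quasiInterp (T : CartesianMesh d) (v : (Fin d → ℝ) → ℝ) (x : Fin d → ℝ) : ℝ :=
  ∑ z ∈ T.innerNodes, T.nodeAverage (fun q => l2Proj (T.cell q) v) z * T.hat z x

/-- The element patch `N(S)`: union of the closed elements which meet the closure of `S`. -/
def patch (T : CartesianMesh d) (S : Set (Fin d → ℝ)) : Set (Fin d → ℝ) :=
  ⋃ q ∈ {q | q ∈ T.elems ∧ (closure S ∩ T.cell q).Nonempty}, T.cell q

/-- The patch `ω = N^ℓ(K)` with `ℓ` layers of elements around the element `K`. -/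
def elemPatch (T : CartesianMesh d) (ℓ : ℕ) (K : Fin d → ℕ) : Set (Fin d → ℝ) :=
  T.patch^[ℓ] (T.cell K)

/-- `K` is an element that is at least `ℓ + 1` layers of elements away from the boundary. -/
def IsInner (T : CartesianMesh d) (ℓ : ℕ) (K : Fin d → ℕ) : Prop :=
  ∀ i, ℓ + 1 ≤ K i ∧ K i + 1 + (ℓ + 1) ≤ T.count i

/-- The local fine-scale space `W(S)`: functions of the space `V_h` on the fine mesh `Th` with
support in `S` which are in the kernel of the quasi-interpolation on the coarse mesh `T`. -/
def fineSpace (T Th : CartesianMesh d) (S : Set (Fin d → ℝ)) : Set ((Fin d → ℝ) → ℝ) :=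
  {w | w ∈ Th.feSpace ∧ T.quasiInterp w = 0 ∧ tsupport w ⊆ S}

/-- `φ` is the element corrector of `v` for the element `K` with `ℓ` layers. -/
def IsElementCorrector (T Th : CartesianMesh d) (A : (Fin d → ℝ) → ℝ) (ℓ : ℕ) (K : Fin d → ℕ)
    (v φ : (Fin d → ℝ) → ℝ) : Prop :=
  φ ∈ T.fineSpace Th (T.elemPatch ℓ K) ∧
    ∀ w ∈ T.fineSpace Th (T.elemPatch ℓ K),
      energyForm A T.domain φ w = energyForm A (T.cell K) v w

/-- The element corrector `Q^ℓ_K v`. -/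
def elementCorrector (T Th : CartesianMesh d) (A : (Fin d → ℝ) → ℝ) (ℓ : ℕ) (K : Fin d → ℕ)
    (v : (Fin d → ℝ) → ℝ) : (Fin d → ℝ) → ℝ :=
  Classical.epsilon (T.IsElementCorrector Th A ℓ K v)

/-- Multi-index of the `i`-th node of the patch `N^ℓ(K)` (`K` inner). -/
def patchNode (ℓ : ℕ) (K : Fin d → ℕ) (i : Fin ((2 * ℓ + 2) ^ d)) : Fin d → ℕ :=
  fun a => K a - ℓ + (finFunctionFinEquiv.symm i a : ℕ)

/-- Multi-index of the `j`-th vertex of the element `K`. -/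
def elemNode (K : Fin d → ℕ) (j : Fin (2 ^ d)) : Fin d → ℕ :=
  fun a => K a + (finFunctionFinEquiv.symm j a : ℕ)

/-- The local Petrov-Galerkin LOD matrix `S[i,j] = a(Λ_i, (id - Q^ℓ_K)(Λ_j|_K))` for the inner
element `K`; here `i` runs through the nodes of the patch `N^ℓ(K)`, `j` through the vertices of
`K`, and `a(Λ_i, Λ_j|_K)` is the integral over `K`. -/
def localPGLOD (T Th : CartesianMesh d) (A : (Fin d → ℝ) → ℝ) (ℓ : ℕ) (K : Fin d → ℕ) :
    Matrix (Fin ((2 * ℓ + 2) ^ d)) (Fin (2 ^ d)) ℝ :=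
  Matrix.of fun i j =>
    energyForm A (T.cell K) (T.hat (patchNode ℓ K i)) (T.hat (elemNode K j)) -
      energyForm A T.domain (T.hat (patchNode ℓ K i))
        (T.elementCorrector Th A ℓ K (T.hat (elemNode K j)))

/-! ### Admissible coefficients -/

/-- Coefficients in `L^∞(D)` with values in `[α, β]` that are constant on every element of the
mesh. -/
structure IsAdmissible (Te : CartesianMesh d) (α β : ℝ) (A : (Fin d → ℝ) → ℝ) : Prop where
  aemeasurable : AEMeasurable A (volume.restrict Te.domain)
  bounds : ∀ᵐ x ∂(volume.restrict Te.domain), α ≤ A x ∧ A x ≤ β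
  const : ∀ q ∈ Te.elems, ∃ c : ℝ, ∀ᵐ x ∂(volume.restrict (Te.cell q)), A x = c

/-- The vector of the values of an elementwise constant coefficient on the elements of the mesh
`T.refine r` that lie in the patch `N^ℓ(K)` (`K` inner); the (a.e. constant) value on an element is
expressed by the mean. -/
def coeffVector (T : CartesianMesh d) (r ℓ : ℕ) (K : Fin d → ℕ) (A : (Fin d → ℝ) → ℝ) :
    Fin (((2 * ℓ + 1) * r) ^ d) → ℝ :=
  fun t => ⨍ x in (T.refine r).cell
    (fun a => (K a - ℓ) * r + (finFunctionFinEquiv.symm t a : ℕ)), A x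

end CartesianMesh

end

/-! In a basis of the fine-scale space `𝒲(ω)` the local matrix is a Schur complement `g - c B⁻¹ b`:
`B` is the stiffness matrix, and `c`, `b`, `g` hold the energies of coarse hat functions against
basis functions and against each other. All four are linear in the coefficient vector `a`, because
the energy splits over the elements of `𝒯_ε` (`CartesianMesh.IsInner.localPGLOD_eq`).

The basis is chosen orthonormal for the Dirichlet form. Then `B = ∑ a_t G_t` with positive
semidefinite `G_t` that add up to the identity, so `R = 1 - B / β` has norm at most `1 - α / β`,
whatever the mesh sizes are (`Matrix.l2_opNorm_sum_smul_le`). The Neumann series of `B⁻¹` thus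
converges at a mesh-independent geometric rate.

Its partial sums are blocks of powers of one matrix that is affine in `a`
(`Matrix.neumannBlock_pow`), so `L` squarings provide about `2 ^ L` terms. After scaling `c`, `b`,
`g` down, all these powers have norm at most `3`, and an approximate squaring multiplies the error
by at most `7` (`NeuralNetwork.squareStep_iterate_spec`). The scaling is undone by the last layer;
it costs only a factor polynomial in `1 / h`.

A ReLU network multiplies numbers by polarization and the series `t - t² = ∑_{i ≥ 1} g^[i](t) / 4 ^
i` of iterates of the tent map `g`: `S` layers give accuracy `4 ^ (-S)`. Matrix entries are stored
with a shift by `4`, which makes them nonnegative and so invariant under the activation.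

One network serves every position of `K`: on a uniform mesh a translation carries the basis, the
coefficient cells and the averaging operator from one inner patch to another, so that all positions
share the same tensors (`CartesianMesh.IsInner.exists_pglod_tensors`).

With `λ = |log h|`, all dimensions and scalings are polynomial in `exp λ`. Taking `L ~ λ + log k`
and `S ~ k λ` makes the error at most `h ^ k ≤ H ^ k`. The depth is `L (S + 2) + 2`, hence of order
`k (λ² + log² k)`, and the number of parameters is of the order of the depth times the cube of the
matrix dimension. -/

noncomputable section

/-! ### ReLU networks as compositions of sparse layers -/

namespace NeuralNetwork

/-- `f` is computed by `L` hidden layers with at most `M` parameters: prepending them to any network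
composes it with `f`, up to an enumeration of the index type of the values of `f`. -/
def IsHiddenState {n : ℕ} {κ : Type} (f : (Fin n → ℝ) → κ → ℝ) (L M : ℕ) : Prop :=
  ∃ (k : ℕ) (e : κ ≃ Fin k), ∀ (m : ℕ) (Ψ : NeuralNetwork k m), ∃ Φ : NeuralNetwork n m,
    (∀ x, Φ.realize x = Ψ.realize (fun i => f x (e.symm i))) ∧ Φ.depth = L + Ψ.depth ∧
      Φ.numParams ≤ M + Ψ.numParams

theorem isHiddenState_id (n : ℕ) : IsHiddenState (fun x : Fin n → ℝ => x) 0 0 :=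
  ⟨n, Equiv.refl _, fun _ Ψ => ⟨Ψ, fun _ => rfl, by simp, by simp⟩⟩

/-- The matrix whose row `o` has the entries `coef o r` in the columns `idx o r`. -/
def sparseMatrix {k k' : ℕ} {κ κ' σ : Type} [Fintype σ] (e : κ ≃ Fin k) (e' : κ' ≃ Fin k')
    (idx : κ' → σ → κ) (coef : κ' → σ → ℝ) : Matrix (Fin k') (Fin k) ℝ :=
  Matrix.of fun o i => ∑ r, if e (idx (e'.symm o) r) = i then coef (e'.symm o) r else 0

/-- Entries are defined by a sum over `r`, so that coinciding columns add up. This happens when an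
entry of a matrix is multiplied by itself. -/
theorem sparseMatrix_mulVec {k k' : ℕ} {κ κ' σ : Type} [Fintype σ] (e : κ ≃ Fin k)
    (e' : κ' ≃ Fin k') (idx : κ' → σ → κ) (coef : κ' → σ → ℝ) (y : κ → ℝ) (o : Fin k') :
    (sparseMatrix e e' idx coef).mulVec (fun i => y (e.symm i)) o =
      ∑ r, coef (e'.symm o) r * y (idx (e'.symm o) r) := by
  simp only [Matrix.mulVec, dotProduct, sparseMatrix, Matrix.of_apply, Finset.sum_mul, ite_mul,
    zero_mul]
  rw [Finset.sum_comm]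
  simp

theorem layerParams_sparseMatrix_le {k k' : ℕ} {κ κ' σ : Type} [Fintype σ] [Fintype κ']
    (e : κ ≃ Fin k) (e' : κ' ≃ Fin k') (idx : κ' → σ → κ) (coef : κ' → σ → ℝ) (b : Fin k' → ℝ) :
    layerParams (sparseMatrix e e' idx coef) b ≤ Fintype.card κ' * (Fintype.card σ + 1) := by
  have hk : Fintype.card κ' = k' := by simpa using Fintype.card_congr e'
  have h1 : Set.ncard {p : Fin k' × Fin k | sparseMatrix e e' idx coef p.1 p.2 ≠ 0} ≤
      Fintype.card κ' * Fintype.card σ := by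
    have hsub : {p : Fin k' × Fin k | sparseMatrix e e' idx coef p.1 p.2 ≠ 0} ⊆
        Set.range fun q : κ' × σ => (e' q.1, e (idx q.1 q.2)) := by
      rintro ⟨o, i⟩ hp
      obtain ⟨r, -, hr⟩ := Finset.exists_ne_zero_of_sum_ne_zero hp
      refine ⟨(e'.symm o, r), ?_⟩
      have : e (idx (e'.symm o) r) = i := by
        by_contra hne
        exact hr (by simp [hne])
      simp [this]
    calc _ ≤ (Set.range fun q : κ' × σ => (e' q.1, e (idx q.1 q.2))).ncard :=
          Set.ncard_le_ncard hsub (Set.finite_range _)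
      _ ≤ Fintype.card (κ' × σ) := by
          rw [← Set.image_univ]
          refine (Set.ncard_image_le Set.finite_univ).trans ?_
          simp [Set.ncard_univ, Nat.card_eq_fintype_card]
      _ = _ := Fintype.card_prod _ _
  have h2 : Set.ncard {i : Fin k' | b i ≠ 0} ≤ Fintype.card κ' := by
    rw [hk]
    refine (Set.ncard_le_ncard (Set.subset_univ _)).trans ?_
    simp [Set.ncard_univ]
  unfold layerParams
  rw [mul_add, mul_one]
  exact add_le_add h1 h2

/-- Appending a hidden layer with sparse rows. -/
theorem IsHiddenState.layer {n : ℕ} {κ κ' σ : Type} [Fintype σ] [Fintype κ']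
    {f : (Fin n → ℝ) → κ → ℝ} {L M : ℕ} (hf : IsHiddenState f L M)
    (idx : κ' → σ → κ) (coef : κ' → σ → ℝ) (b : κ' → ℝ) :
    IsHiddenState (fun x o => max 0 (∑ r, coef o r * f x (idx o r) + b o)) (L + 1)
      (M + Fintype.card κ' * (Fintype.card σ + 1)) := by
  obtain ⟨k, e, hf⟩ := hf
  let e' := Fintype.equivFin κ'
  refine ⟨_, e', fun m Ψ => ?_⟩
  -- The new layer goes in front of `Ψ` and the earlier layers in front of both; quantifying over
  -- the continuation replaces concatenation of networks.
  obtain ⟨Φ, h1, h2, h3⟩ :=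
    hf m (cons (sparseMatrix e e' idx coef) (fun o => b (e'.symm o)) Ψ)
  refine ⟨Φ, fun x => ?_, ?_, ?_⟩
  · rw [h1]
    simp only [realize, Pi.add_apply, sparseMatrix_mulVec]
  · rw [h2, depth]
    omega
  · have := layerParams_sparseMatrix_le e e' idx coef (fun o => b (e'.symm o))
    rw [numParams] at h3
    omega

/-- Appending the last layer. -/
theorem IsHiddenState.last {n m : ℕ} {κ σ : Type} [Fintype σ]
    {f : (Fin n → ℝ) → κ → ℝ} {L M : ℕ} (hf : IsHiddenState f L M)
    (idx : Fin m → σ → κ) (coef : Fin m → σ → ℝ) (b : Fin m → ℝ) :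
    ∃ Φ : NeuralNetwork n m,
      (∀ x o, Φ.realize x o = ∑ r, coef o r * f x (idx o r) + b o) ∧ Φ.depth = L + 1 ∧
        Φ.numParams ≤ M + m * (Fintype.card σ + 1) := by
  obtain ⟨k, e, hf⟩ := hf
  obtain ⟨Φ, h1, h2, h3⟩ :=
    hf m (NeuralNetwork.last (sparseMatrix e (Equiv.refl _) idx coef) b)
  refine ⟨Φ, fun x o => ?_, h2, ?_⟩
  · rw [h1]
    simp [realize, Pi.add_apply, sparseMatrix_mulVec]
  · have := layerParams_sparseMatrix_le e (Equiv.refl _) idx coef b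
    rw [numParams] at h3
    rw [Fintype.card_fin] at this
    omega

theorem IsHiddenState.mono {n : ℕ} {κ : Type} {f : (Fin n → ℝ) → κ → ℝ} {L M M' : ℕ}
    (hf : IsHiddenState f L M) (h : M ≤ M') : IsHiddenState f L M' := by
  obtain ⟨k, e, hf⟩ := hf
  refine ⟨k, e, fun m Ψ => ?_⟩
  obtain ⟨Φ, h1, h2, h3⟩ := hf m Ψ
  exact ⟨Φ, h1, h2, h3.trans (by omega)⟩

/-! ### Approximate squaring of numbers -/

/-- One sawtooth step on the triple `(max 0 t, max 0 (t - 1/2), acc)`. -/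
def sawStep (k : ℕ) (u : Fin 3 → ℝ) : Fin 3 → ℝ :=
  ![max 0 (2 * u 0 - 4 * u 1), max 0 (2 * u 0 - 4 * u 1 - 1 / 2),
    max 0 (u 2 + (2 * u 0 - 4 * u 1) / 4 ^ (k + 1))]

def sawInit (t : ℝ) : Fin 3 → ℝ := ![max 0 t, max 0 (t - 1 / 2), 0]

def sawIter (t : ℝ) : ℕ → Fin 3 → ℝ
  | 0 => sawInit t
  | k + 1 => sawStep k (sawIter t k)

/-- The tent map `g(u) = 2 u - 4 max(0, u - 1/2)` satisfies `u - u² = (g(u) + (g(u) - g(u)²)) / 4`,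
so each step moves `g(u) / 4 ^ (k + 1)` from the remainder to the accumulator. The accumulator stays
nonnegative and is not changed by the activation. -/
theorem sawIter_spec {t : ℝ} (h0 : 0 ≤ t) (h1 : t ≤ 1) (k : ℕ) :
    0 ≤ sawIter t k 0 ∧ sawIter t k 0 ≤ 1 ∧ sawIter t k 1 = max 0 (sawIter t k 0 - 1 / 2) ∧
      0 ≤ sawIter t k 2 ∧
      sawIter t k 2 + (sawIter t k 0 - sawIter t k 0 ^ 2) / 4 ^ k = t - t ^ 2 := by
  induction k with
  | zero => simp [sawIter, sawInit, h0, h1]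
  | succ k ih =>
    obtain ⟨a0, a1, a2, a3, a4⟩ := ih
    simp only [sawIter, sawStep]
    generalize sawIter t k = u at *
    have key : 0 ≤ 2 * u 0 - 4 * u 1 ∧ 2 * u 0 - 4 * u 1 ≤ 1 ∧
        u 0 - u 0 ^ 2 = ((2 * u 0 - 4 * u 1) +
          ((2 * u 0 - 4 * u 1) - (2 * u 0 - 4 * u 1) ^ 2)) / 4 := by
      rw [a2]
      rcases le_total (u 0) (1 / 2) with h | h
      · rw [max_eq_left (by linarith)]
        refine ⟨by linarith, by linarith, by ring⟩
      · rw [max_eq_right (by linarith)]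
        refine ⟨by linarith, by linarith, by ring⟩
    obtain ⟨k0, k1, k2⟩ := key
    have h4 : (0 : ℝ) < 4 ^ (k + 1) := by positivity
    simp only [Matrix.cons_val_zero, Matrix.cons_val_one, Matrix.cons_val]
    rw [max_eq_right k0, max_eq_right (add_nonneg a3 (div_nonneg k0 h4.le))]
    refine ⟨k0, k1, rfl, add_nonneg a3 (div_nonneg k0 h4.le), ?_⟩
    rw [← a4, k2, pow_succ]
    field_simp
    ring

theorem abs_sawIter_sub_le {t : ℝ} (h0 : 0 ≤ t) (h1 : t ≤ 1) (k : ℕ) :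
    |sawIter t k 2 - (t - t ^ 2)| ≤ 1 / 4 ^ k := by
  obtain ⟨a0, a1, -, -, a4⟩ := sawIter_spec h0 h1 k
  have h4 : (0 : ℝ) < 4 ^ k := by positivity
  rw [← a4, sub_add_cancel_left, abs_neg, abs_div, abs_of_pos h4]
  gcongr
  rw [abs_le]
  constructor <;> nlinarith

/-! ### Approximate squaring of matrices -/

section MatrixSquare

variable {ι : Type} [Fintype ι]

/-- The argument of the sawtooth iteration for the product of `x` and `y` (shifted by `4`). -/
def polarArg (x y : ℝ) (b : Bool) : ℝ := 1 / 2 + ((x - 4) + (if b then 1 else -1) * (y - 4)) / 16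

/-- Approximation of `4 + X * X`, computed from `F = 4 + X`. -/
def squareStep (S : ℕ) (F : ι × ι → ℝ) (p : ι × ι) : ℝ :=
  max 0 (4 + ∑ j, (64 * sawIter (polarArg (F (p.1, j)) (F (j, p.2)) false) S 2 -
    64 * sawIter (polarArg (F (p.1, j)) (F (j, p.2)) true) S 2))

/-- Since `t - t² = 1/4 - (t - 1/2)²`, its values at `1/2 + (x - y)/16` and `1/2 + (x + y)/16`
differ by `x y / 64`. The divisor `16` brings both arguments into `[0, 1]`; each of the two values
contributes an error `64 / 4 ^ S`. -/
theorem abs_polar_sub_le {x y : ℝ} (hx : |x| ≤ 4) (hy : |y| ≤ 4) (S : ℕ) :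
    |64 * sawIter (polarArg (4 + x) (4 + y) false) S 2 -
      64 * sawIter (polarArg (4 + x) (4 + y) true) S 2 - x * y| ≤ 128 / 4 ^ S := by
  rw [abs_le] at hx hy
  have hf := abs_sawIter_sub_le (t := polarArg (4 + x) (4 + y) false)
    (by simp only [polarArg]; norm_num; linarith) (by simp only [polarArg]; norm_num; linarith) S
  have ht := abs_sawIter_sub_le (t := polarArg (4 + x) (4 + y) true)
    (by simp only [polarArg]; norm_num; linarith) (by simp only [polarArg]; norm_num; linarith) S
  have e : x * y = 64 * (polarArg (4 + x) (4 + y) false - polarArg (4 + x) (4 + y) false ^ 2) -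
      64 * (polarArg (4 + x) (4 + y) true - polarArg (4 + x) (4 + y) true ^ 2) := by
    simp only [polarArg]
    norm_num
    ring
  rw [e]
  have e2 : (128 : ℝ) / 4 ^ S = 128 * (1 / 4 ^ S) := by ring
  rw [e2]
  rw [abs_le] at *
  constructor <;> linarith

theorem abs_sum_polar_sub_le {X : Matrix ι ι ℝ} (hX : ∀ i j, |X i j| ≤ 4) (S : ℕ) (i l : ι) :
    |∑ j, (64 * sawIter (polarArg (4 + X i j) (4 + X j l) false) S 2 -
      64 * sawIter (polarArg (4 + X i j) (4 + X j l) true) S 2) - (X * X) i l| ≤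
      Fintype.card ι * (128 / 4 ^ S) := by
  rw [Matrix.mul_apply, ← Finset.sum_sub_distrib]
  refine (Finset.abs_sum_le_sum_abs _ _).trans ?_
  refine (Finset.sum_le_card_nsmul _ _ _ fun j _ => abs_polar_sub_le (hX i j) (hX j l) S).trans ?_
  simp

/-- The `12` counts three neurons with three weights and a bias each. -/
theorem IsHiddenState.sawIter {n : ℕ} {τ : Type} [Fintype τ] {t : (Fin n → ℝ) → τ → ℝ} {L M : ℕ}
    (h : IsHiddenState (fun x (p : τ × Fin 3) => sawInit (t x p.1) p.2) L M) (S : ℕ) :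
    IsHiddenState (fun x (p : τ × Fin 3) => sawIter (t x p.1) S p.2) (L + S)
      (M + S * (Fintype.card τ * 12)) := by
  induction S with
  | zero => simpa [NeuralNetwork.sawIter] using h
  | succ S ih =>
    have := ih.layer (κ' := τ × Fin 3) (σ := Fin 3) (fun p c => (p.1, c))
      (fun p => ![![2, -4, 0], ![2, -4, 0], ![2 / 4 ^ (S + 1), -4 / 4 ^ (S + 1), 1]] p.2)
      (fun p => ![0, -1 / 2, 0] p.2)
    rw [Fintype.card_prod, Fintype.card_fin] at this
    rw [← add_assoc L]
    convert this.mono (M' := M + (S + 1) * (Fintype.card τ * 12)) (by ring_nf; omega) using 1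
    funext x p
    obtain ⟨p, c⟩ := p
    simp only [NeuralNetwork.sawIter, sawStep, Fin.sum_univ_three]
    fin_cases c <;> simp <;> ring_nf

theorem IsHiddenState.squareStep {n : ℕ} {f : (Fin n → ℝ) → ι × ι → ℝ} {L M : ℕ}
    (hf : IsHiddenState f L M) (S : ℕ) :
    IsHiddenState (fun x => squareStep S (f x)) (L + (S + 2))
      (M + 24 * (S + 1) * Fintype.card ι ^ 3) := by
  -- For each of the products `F (i, j) * F (j, l)` this layer forms the initial sawtooth states of
  -- both polarization arguments. Together with the summation layer below it accounts for the `2` in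
  -- `S + 2`.
  have h1 := hf.layer (κ' := ((ι × ι) × ι × Bool) × Fin 3) (σ := Bool)
    (fun p b => if b then (p.1.1.1, p.1.2.1) else (p.1.2.1, p.1.1.2))
    (fun p b => if p.2 = 2 then 0 else if b then 1 / 16 else if p.1.2.2 then 1 / 16 else -1 / 16)
    (fun p => ![1 / 2 + (-4 + (if p.1.2.2 then 1 else -1) * (-4)) / 16,
      (-4 + (if p.1.2.2 then 1 else -1) * (-4)) / 16, 0] p.2)
  have e1 : (fun x (p : ((ι × ι) × ι × Bool) × Fin 3) =>
      sawInit (polarArg (f x (p.1.1.1, p.1.2.1)) (f x (p.1.2.1, p.1.1.2)) p.1.2.2) p.2) =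
      fun x o => max 0 (∑ r, (if o.2 = 2 then 0 else if r = true then 1 / 16 else
        if o.1.2.2 then 1 / 16 else -1 / 16) *
          f x (if r = true then (o.1.1.1, o.1.2.1) else (o.1.2.1, o.1.1.2)) +
        ![1 / 2 + (-4 + (if o.1.2.2 then 1 else -1) * (-4)) / 16,
          (-4 + (if o.1.2.2 then 1 else -1) * (-4)) / 16, (0 : ℝ)] o.2) := by
    funext x p
    obtain ⟨⟨⟨i, l⟩, j, b⟩, c⟩ := p
    simp only [sawInit, polarArg, Fintype.sum_bool]
    fin_cases c <;> cases b <;> simp <;> ring_nf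
  rw [← e1] at h1
  have h2 := IsHiddenState.sawIter
    (t := fun x (p : (ι × ι) × ι × Bool) => polarArg (f x (p.1.1, p.2.1)) (f x (p.2.1, p.1.2)) p.2.2)
    h1 S
  -- Only the accumulators, component `2`, are used; the bias `4` restores the shift for the next
  -- squaring.
  have h3 := h2.layer (κ' := ι × ι) (σ := ι × Bool) (fun p r => ((p, r), 2))
    (fun p r => if r.2 then -64 else 64) (fun _ => 4)
  have e3 : (fun x => NeuralNetwork.squareStep S (f x)) = fun x o => max 0
      (∑ r : ι × Bool, (if r.2 = true then (-64 : ℝ) else 64) * NeuralNetwork.sawIter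
        (polarArg (f x (o.1, r.1)) (f x (r.1, o.2)) r.2) S 2 + 4) := by
    funext x o
    rw [NeuralNetwork.squareStep, Fintype.sum_prod_type]
    rw [add_comm (4 : ℝ)]
    refine congrArg (max 0) (congrArg (· + (4 : ℝ)) (Finset.sum_congr rfl fun j _ => ?_))
    simp only [Fintype.sum_bool, if_true, Bool.false_eq_true, if_false]
    ring
  rw [e3]
  have hcard : Fintype.card (ι × ι) * (Fintype.card (ι × Bool) + 1) ≤ 3 * Fintype.card ι ^ 3 := by
    simp only [Fintype.card_prod, Fintype.card_bool]
    rcases Nat.eq_zero_or_pos (Fintype.card ι) with h | h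
    · simp [h]
    · calc _ ≤ Fintype.card ι * Fintype.card ι * (Fintype.card ι * 2 + Fintype.card ι) := by
            gcongr; exact h
        _ = _ := by ring
  have : L + 1 + S + 1 = L + (S + 2) := by ring
  rw [this] at h3
  refine h3.mono ?_
  simp only [Fintype.card_prod, Fintype.card_bool, Fintype.card_fin] at hcard ⊢
  have e4 : Fintype.card ι * Fintype.card ι * (Fintype.card ι * 2) = 2 * Fintype.card ι ^ 3 := by
    ring
  rw [e4]
  calc _ ≤ M + 2 * Fintype.card ι ^ 3 * 3 * (2 + 1) + S * (2 * Fintype.card ι ^ 3 * 12) +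
        3 * Fintype.card ι ^ 3 := by gcongr
    _ ≤ _ := by ring_nf; omega

end MatrixSquare

end NeuralNetwork

end
-- Spectral norms and powers of block matrices
noncomputable section

namespace Matrix

open scoped Matrix.Norms.L2Operator
open WithLp

variable {m n : Type*} [Fintype m] [Fintype n] [DecidableEq n]

theorem norm_toLp_mulVec_le (A : Matrix m n ℝ) (x : n → ℝ) :
    ‖toLp 2 (A *ᵥ x)‖ ≤ ‖A‖ * ‖toLp 2 x‖ :=
  l2_opNorm_mulVec A (toLp 2 x)

theorem l2_opNorm_le_of_forall {A : Matrix m n ℝ} {C : ℝ} (hC : 0 ≤ C)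
    (h : ∀ x : n → ℝ, ‖toLp 2 (A *ᵥ x)‖ ≤ C * ‖toLp 2 x‖) : ‖A‖ ≤ C :=
  ContinuousLinearMap.opNorm_le_bound _ hC fun x => h (ofLp x)

theorem abs_apply_le_l2_opNorm (A : Matrix m n ℝ) (i : m) (j : n) : |A i j| ≤ ‖A‖ := by
  have h := norm_toLp_mulVec_le A (Pi.single j 1)
  have h1 : ‖toLp 2 (Pi.single j 1 : n → ℝ)‖ = 1 := by simp
  rw [h1, mul_one] at h
  refine le_trans ?_ h
  have := PiLp.norm_apply_le (toLp 2 (A *ᵥ Pi.single j 1)) i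
  simpa using this

/-- The Frobenius bound, by Cauchy–Schwarz in every row. -/
theorem l2_opNorm_le_of_entries {A : Matrix m n ℝ} {δ : ℝ} (hδ : 0 ≤ δ)
    (h : ∀ i j, |A i j| ≤ δ) : ‖A‖ ≤ √(Fintype.card m * Fintype.card n) * δ := by
  refine l2_opNorm_le_of_forall (by positivity) fun x => ?_
  rw [EuclideanSpace.norm_eq, EuclideanSpace.norm_eq]
  have e : √(Fintype.card m * Fintype.card n) * δ * √(∑ i, ‖x i‖ ^ 2) =
      √(Fintype.card m * Fintype.card n * δ ^ 2 * ∑ i, ‖x i‖ ^ 2) := by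
    rw [Real.sqrt_mul (by positivity) (∑ i, ‖x i‖ ^ 2), Real.sqrt_mul' _ (sq_nonneg δ),
      Real.sqrt_sq hδ]
  simp only at e ⊢
  rw [e]
  refine Real.sqrt_le_sqrt ?_
  have key : ∀ i, ‖(A *ᵥ x) i‖ ^ 2 ≤ Fintype.card n * δ ^ 2 * ∑ i, ‖x i‖ ^ 2 := by
    intro i
    simp only [Real.norm_eq_abs, sq_abs]
    refine (Finset.sum_mul_sq_le_sq_mul_sq _ _ _).trans ?_
    gcongr
    refine (Finset.sum_le_card_nsmul _ _ (δ ^ 2) fun j _ => ?_).trans (by simp)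
    rw [← sq_abs]
    exact pow_le_pow_left₀ (abs_nonneg _) (h i j) 2
  refine (Finset.sum_le_card_nsmul _ _ _ fun i _ => key i).trans ?_
  simp [mul_assoc]

theorem l2_opNorm_le_of_entries_of_card_le {A : Matrix m n ℝ} {δ : ℝ} {P : ℝ} (hδ : 0 ≤ δ)
    (h : ∀ i j, |A i j| ≤ δ) (hm : (Fintype.card m : ℝ) ≤ P) (hn : (Fintype.card n : ℝ) ≤ P) :
    ‖A‖ ≤ P * δ := by
  refine (l2_opNorm_le_of_entries hδ h).trans ?_
  have hP : 0 ≤ P := le_trans (Nat.cast_nonneg _) hm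
  gcongr
  rw [Real.sqrt_le_left hP, sq]
  gcongr

/-- A symmetric matrix, weighted sum of positive semidefinite matrices which add up to the
identity, has norm at most the largest weight. -/
theorem l2_opNorm_sum_smul_le {τ : Type*} [Fintype τ] {G : τ → Matrix n n ℝ} {w : τ → ℝ} {q : ℝ}
    (hq : 0 ≤ q) (hw : ∀ t, |w t| ≤ q) (hG : ∀ t, (G t).IsSymm)
    (hpos : ∀ t x, 0 ≤ x ⬝ᵥ G t *ᵥ x) (hsum : ∑ t, G t = 1) : ‖∑ t, w t • G t‖ ≤ q := by
  have hsym : ∀ t (x y : n → ℝ), x ⬝ᵥ G t *ᵥ y = y ⬝ᵥ G t *ᵥ x := by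
    intro t x y
    rw [dotProduct_mulVec, ← mulVec_transpose, (hG t).eq, dotProduct_comm]
  have hone : ∀ x : n → ℝ, ∑ t, x ⬝ᵥ G t *ᵥ x = ‖toLp 2 x‖ ^ 2 := by
    intro x
    rw [← dotProduct_sum, ← sum_mulVec, hsum, one_mulVec, EuclideanSpace.norm_sq_eq]
    simp [dotProduct, sq]
  have key : ∀ x y : n → ℝ, y ⬝ᵥ (∑ t, w t • G t) *ᵥ x ≤
      q * ((‖toLp 2 x‖ ^ 2 + ‖toLp 2 y‖ ^ 2) / 2) := by
    intro x y
    rw [sum_mulVec, dotProduct_sum, ← hone, ← hone, ← Finset.sum_add_distrib, Finset.sum_div,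
      Finset.mul_sum]
    refine Finset.sum_le_sum fun t _ => ?_
    rw [smul_mulVec, dotProduct_smul, smul_eq_mul]
    refine (le_abs_self _).trans ?_
    rw [abs_mul]
    refine mul_le_mul (hw t) ?_ (abs_nonneg _) hq
    -- Positivity of `G t` at `x + y` and `x - y` bounds its bilinear form by the mean of the two
    -- quadratic forms; these sum to squared norms because the `G t` add up to the identity.
    have h1 := hpos t (x + y)
    have h2 := hpos t (x - y)
    simp only [mulVec_add, mulVec_sub, dotProduct_add, dotProduct_sub, add_dotProduct,
      sub_dotProduct] at h1 h2
    have h3 := hsym t x y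
    rw [abs_le]
    constructor <;> linarith
  refine l2_opNorm_le_of_forall hq fun x => ?_
  set z := (∑ t, w t • G t) *ᵥ x with hz
  rcases (norm_nonneg (toLp 2 z)).eq_or_lt with h0 | h0
  · rw [← h0]
    positivity
  have hzz : z ⬝ᵥ z = ‖toLp 2 z‖ ^ 2 := by
    rw [EuclideanSpace.norm_sq_eq]
    simp [dotProduct, sq]
  -- The multiple of `z` with the norm of `x` turns the mean of squares into `‖x‖ ^ 2`.
  have h1 := key x ((‖toLp 2 x‖ / ‖toLp 2 z‖) • z)
  rw [smul_dotProduct, ← hz, hzz, toLp_smul, norm_smul, smul_eq_mul, norm_div, norm_norm,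
    norm_norm, div_mul_cancel₀ _ h0.ne'] at h1
  have h2 : ‖toLp 2 x‖ / ‖toLp 2 z‖ * ‖toLp 2 z‖ ^ 2 = ‖toLp 2 x‖ * ‖toLp 2 z‖ := by
    field_simp
  rw [h2] at h1
  rcases (norm_nonneg (toLp 2 x)).eq_or_lt with hx | hx
  · have : x = 0 := by
      have := norm_eq_zero.1 hx.symm
      simpa using this
    rw [hz, this]
    simp
  · nlinarith

/-! ### Neumann series as powers of a block matrix -/

section Neumann

variable {I Y J : Type*} [Fintype I] [Fintype Y] [Fintype J] [DecidableEq I] [DecidableEq Y]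
  [DecidableEq J]

/-- The upper right block of the powers of this matrix is `g` plus a partial sum of
`∑ i, c * R ^ i * b`. -/
def neumannBlock (R : Matrix Y Y ℝ) (c : Matrix I Y ℝ) (b : Matrix Y J ℝ) (g : Matrix I J ℝ) :
    Matrix (I ⊕ (Y ⊕ J)) (I ⊕ (Y ⊕ J)) ℝ :=
  fromBlocks 1 (fromCols c g) 0 (fromBlocks R b 0 0)

/-- Multiplication by the block matrix adds one term to the partial sum. As `M` inverts `1 - R`, the
sums have closed forms: the corner `g + c M b - c M R ^ k b` equals `g + ∑_{i < k} c R ^ i b`. -/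
theorem neumannBlock_pow {R M : Matrix Y Y ℝ} (hM : M * (1 - R) = 1) (c : Matrix I Y ℝ)
    (b : Matrix Y J ℝ) (g : Matrix I J ℝ) (k : ℕ) :
    neumannBlock R c b g ^ (k + 1) = fromBlocks 1
      (fromCols (c * M * (1 - R ^ (k + 1))) (g + c * M * b - c * M * (R ^ k * b))) 0
      (fromBlocks (R ^ (k + 1)) (R ^ k * b) 0 0) := by
  have hc : ∀ X : Matrix Y J ℝ, c * X = c * M * X - c * M * (R * X) := by
    intro X
    have : c * X = c * (M * (1 - R)) * X := by rw [hM, Matrix.mul_one]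
    rw [this, Matrix.mul_sub, Matrix.mul_sub, Matrix.sub_mul]
    simp only [Matrix.mul_assoc, Matrix.one_mul]
  have hc' : ∀ X : Matrix Y Y ℝ, c * X = c * M * X - c * M * (R * X) := by
    intro X
    have : c * X = c * (M * (1 - R)) * X := by rw [hM, Matrix.mul_one]
    rw [this, Matrix.mul_sub, Matrix.mul_sub, Matrix.sub_mul]
    simp only [Matrix.mul_assoc, Matrix.one_mul]
  induction k with
  | zero =>
    have h1 : c * M * (1 - R) = c := by rw [Matrix.mul_assoc, hM, Matrix.mul_one]
    simp [neumannBlock, h1]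
  | succ k ih =>
    rw [pow_succ', ih, neumannBlock, fromBlocks_multiply, fromBlocks_multiply,
      fromCols_mul_fromBlocks]
    have e1 : c * M * (1 - R ^ (k + 1)) + c * R ^ (k + 1) = c * M * (1 - R ^ (k + 1 + 1)) := by
      rw [hc' (R ^ (k + 1)), ← pow_succ', Matrix.mul_sub, Matrix.mul_sub]
      abel
    have e2 : g + c * M * b - c * M * (R ^ k * b) + c * (R ^ k * b) =
        g + c * M * b - c * M * (R ^ (k + 1) * b) := by
      rw [hc (R ^ k * b), pow_succ', Matrix.mul_assoc R]
      abel
    simp only [Matrix.one_mul, Matrix.mul_zero, Matrix.zero_mul, add_zero, zero_add, ← pow_succ']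
    congr 1
    · rw [← e1, ← e2]
      ext i (j | j) <;> simp
    · rw [← Matrix.mul_assoc, ← pow_succ']

theorem norm_toLp_comp_le {f : m → n} (hf : Function.Injective f) (v : n → ℝ) :
    ‖toLp 2 (v ∘ f)‖ ≤ ‖toLp 2 v‖ := by
  rw [EuclideanSpace.norm_eq, EuclideanSpace.norm_eq]
  refine Real.sqrt_le_sqrt ?_
  change ∑ i, ‖v (f i)‖ ^ 2 ≤ ∑ i, ‖v i‖ ^ 2
  classical
  rw [← Finset.sum_image (s := Finset.univ) (g := f) (f := fun i => ‖v i‖ ^ 2) hf.injOn]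
  exact Finset.sum_le_sum_of_subset_of_nonneg (Finset.subset_univ _) fun _ _ _ => by positivity

theorem norm_toLp_sum_le {m n : Type*} [Fintype m] [Fintype n] (v : m ⊕ n → ℝ) :
    ‖toLp 2 v‖ ≤ ‖toLp 2 (v ∘ Sum.inl)‖ + ‖toLp 2 (v ∘ Sum.inr)‖ := by
  rw [← sq_le_sq₀ (norm_nonneg _) (by positivity), EuclideanSpace.norm_sq_eq, add_sq,
    EuclideanSpace.norm_sq_eq, EuclideanSpace.norm_sq_eq, Fintype.sum_sum_type]
  have : 0 ≤ 2 * ‖toLp 2 (v ∘ Sum.inl)‖ * ‖toLp 2 (v ∘ Sum.inr)‖ := by positivity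
  change ∑ i, ‖v (Sum.inl i)‖ ^ 2 + ∑ i, ‖v (Sum.inr i)‖ ^ 2 ≤ ∑ i, ‖v (Sum.inl i)‖ ^ 2 +
    2 * ‖toLp 2 (v ∘ Sum.inl)‖ * ‖toLp 2 (v ∘ Sum.inr)‖ + ∑ i, ‖v (Sum.inr i)‖ ^ 2
  linarith

/-- The sum of the Euclidean norms of the three components does not increase under one
multiplication: the column of `Y` has total weight `‖c‖ + ‖R‖ ≤ 1`, that of `J` has `‖b‖ + ‖g‖ ≤ 1`.
Comparing this sum with the Euclidean norm costs the factor `3`, once for all powers. -/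
theorem norm_neumannBlock_pow_le {R : Matrix Y Y ℝ} {c : Matrix I Y ℝ}
    {b : Matrix Y J ℝ} {g : Matrix I J ℝ} {q : ℝ} (hR : ‖R‖ ≤ q) (hc : ‖c‖ ≤ 1 - q)
    (hbg : ‖b‖ + ‖g‖ ≤ 1) (k : ℕ) : ‖neumannBlock R c b g ^ k‖ ≤ 3 := by
  let V : (I ⊕ (Y ⊕ J) → ℝ) → ℝ := fun v => ‖toLp 2 (v ∘ Sum.inl)‖ +
    (‖toLp 2 (v ∘ Sum.inr ∘ Sum.inl)‖ + ‖toLp 2 (v ∘ Sum.inr ∘ Sum.inr)‖)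
  have hstep : ∀ v, V (neumannBlock R c b g *ᵥ v) ≤ V v := by
    intro v
    have e1 : (neumannBlock R c b g *ᵥ v) ∘ Sum.inl = v ∘ Sum.inl +
        (c *ᵥ (v ∘ Sum.inr ∘ Sum.inl) + g *ᵥ (v ∘ Sum.inr ∘ Sum.inr)) := by
      ext i
      simp [neumannBlock, fromBlocks_mulVec, fromCols_mulVec, Function.comp_assoc]
    have e2 : (neumannBlock R c b g *ᵥ v) ∘ Sum.inr ∘ Sum.inl =
        R *ᵥ (v ∘ Sum.inr ∘ Sum.inl) + b *ᵥ (v ∘ Sum.inr ∘ Sum.inr) := by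
      ext i
      simp [neumannBlock, fromBlocks_mulVec, Function.comp_assoc]
    have e3 : (neumannBlock R c b g *ᵥ v) ∘ Sum.inr ∘ Sum.inr = 0 := by
      ext i
      simp [neumannBlock, fromBlocks_mulVec]
    simp only [V, e1, e2, e3, toLp_add, toLp_zero, norm_zero]
    generalize v ∘ Sum.inl = x
    generalize v ∘ Sum.inr ∘ Sum.inl = y
    generalize v ∘ Sum.inr ∘ Sum.inr = z
    have t1 := norm_add_le (toLp 2 x) (toLp 2 (c *ᵥ y) + toLp 2 (g *ᵥ z))
    have t2 := norm_add_le (toLp 2 (c *ᵥ y)) (toLp 2 (g *ᵥ z))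
    have t3 := norm_add_le (toLp 2 (R *ᵥ y)) (toLp 2 (b *ᵥ z))
    have s1 := norm_toLp_mulVec_le c y
    have s2 := norm_toLp_mulVec_le g z
    have s3 := norm_toLp_mulVec_le R y
    have s4 := norm_toLp_mulVec_le b z
    have u1 : ‖c‖ * ‖toLp 2 y‖ + ‖R‖ * ‖toLp 2 y‖ ≤ ‖toLp 2 y‖ := by
      rw [← add_mul]
      exact mul_le_of_le_one_left (norm_nonneg _) (by linarith)
    have u2 : ‖b‖ * ‖toLp 2 z‖ + ‖g‖ * ‖toLp 2 z‖ ≤ ‖toLp 2 z‖ := by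
      rw [← add_mul]
      exact mul_le_of_le_one_left (norm_nonneg _) hbg
    linarith
  have hpow : ∀ v, V ((neumannBlock R c b g ^ k) *ᵥ v) ≤ V v := by
    intro v
    induction k with
    | zero => simp
    | succ k ih =>
      rw [pow_succ', ← mulVec_mulVec]
      exact (hstep _).trans ih
  refine l2_opNorm_le_of_forall (by norm_num) fun x => ?_
  have h1 := norm_toLp_sum_le ((neumannBlock R c b g ^ k) *ᵥ x)
  have h2 := norm_toLp_sum_le (((neumannBlock R c b g ^ k) *ᵥ x) ∘ Sum.inr)
  have h3 := hpow x
  have h4 := norm_toLp_comp_le (m := I) (f := Sum.inl) Sum.inl_injective x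
  have h5 := norm_toLp_comp_le (m := Y) (f := Sum.inr ∘ Sum.inl)
    (Sum.inr_injective.comp Sum.inl_injective) x
  have h6 := norm_toLp_comp_le (m := J) (f := Sum.inr ∘ Sum.inr)
    (Sum.inr_injective.comp Sum.inr_injective) x
  simp only [V] at h3
  simp only [Function.comp_assoc] at h1 h2 h3 h4 h5 h6
  linarith

/-- From `M = 1 + M * R` and absorption. -/
theorem norm_le_of_mul_one_sub {R M : Matrix Y Y ℝ} {q : ℝ} (hq : q < 1) (hR : ‖R‖ ≤ q)
    (hM : M * (1 - R) = 1) : ‖M‖ ≤ 1 / (1 - q) := by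
  have h1 : M = 1 + M * R := by
    rw [Matrix.mul_sub, Matrix.mul_one] at hM
    rw [← hM]
    abel
  have h2 : ‖(1 : Matrix Y Y ℝ)‖ ≤ 1 := l2_opNorm_le_of_forall zero_le_one fun x => by simp
  have h3 : ‖M‖ ≤ 1 + ‖M‖ * q := by
    calc ‖M‖ = ‖1 + M * R‖ := by rw [← h1]
      _ ≤ ‖(1 : Matrix Y Y ℝ)‖ + ‖M * R‖ := norm_add_le _ _
      _ ≤ 1 + ‖M‖ * q := by
        gcongr
        exact (norm_mul_le _ _).trans (by gcongr)
  rw [le_div_iff₀ (by linarith)]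
  linarith

/-- The difference is exactly the tail `c M R ^ k b` of the geometric series. -/
theorem abs_neumannBlock_pow_sub_le {R M : Matrix Y Y ℝ} {c : Matrix I Y ℝ}
    {b : Matrix Y J ℝ} {g : Matrix I J ℝ} {q : ℝ} (hq : q < 1) (hR : ‖R‖ ≤ q) (hc : ‖c‖ ≤ 1)
    (hb : ‖b‖ ≤ 1) (hM : M * (1 - R) = 1) (k : ℕ) (i : I) (j : J) :
    |(neumannBlock R c b g ^ (k + 1)) (Sum.inl i) (Sum.inr (Sum.inr j)) -
      (g + c * M * b) i j| ≤ q ^ k / (1 - q) := by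
  have hq0 : 0 ≤ q := (norm_nonneg _).trans hR
  rw [neumannBlock_pow hM]
  simp only [fromBlocks_apply₁₂, fromCols_apply_inr, sub_apply, sub_sub_cancel_left, abs_neg]
  refine (abs_apply_le_l2_opNorm _ _ _).trans ?_
  have h1 : ‖R ^ k‖ ≤ q ^ k := by
    rcases k with _ | k
    · simpa using l2_opNorm_le_of_forall (A := (1 : Matrix Y Y ℝ)) zero_le_one fun x => by simp
    · exact (norm_pow_le' _ (Nat.succ_pos _)).trans (pow_le_pow_left₀ (norm_nonneg _) hR _)
  have h2 := norm_le_of_mul_one_sub hq hR hM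
  have h3 : 0 ≤ 1 / (1 - q) := (norm_nonneg _).trans h2
  calc ‖c * M * (R ^ k * b)‖ ≤ ‖c‖ * ‖M‖ * (‖R ^ k‖ * ‖b‖) :=
        (l2_opNorm_mul _ _).trans (mul_le_mul (l2_opNorm_mul _ _) (l2_opNorm_mul _ _)
          (norm_nonneg _) (by positivity))
    _ ≤ 1 * (1 / (1 - q)) * (q ^ k * 1) := by gcongr
    _ = _ := by ring

end Neumann

end Matrix

end
-- Networks for matrix powers and Schur complements
noncomputable section

namespace NeuralNetwork

open scoped Matrix.Norms.L2Operator

section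

variable {ι : Type} [Fintype ι] [DecidableEq ι]

/-- Writing `Y` for the exact power and `E = X - Y`, one has `X² - Y² = E X + Y E`, of norm at most
`(4 + 3) ‖E‖`; the inexact products add one `δ = 128 card² / 4 ^ S`. The bound `(7 ^ L - 1) δ`
reproduces itself under this recursion. The smallness assumption keeps `‖X‖ ≤ 3 + 1`, so entries
stay in the range of the polarization and the shifted ones are nonnegative. -/
theorem squareStep_iterate_spec {Z : Matrix ι ι ℝ} (hZ : ∀ k, ‖Z ^ k‖ ≤ 3) (S L : ℕ)
    (hδ : (7 : ℝ) ^ L * (128 * Fintype.card ι ^ 2 / 4 ^ S) ≤ 1) :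
    ∃ X : Matrix ι ι ℝ, (squareStep S)^[L] (fun p => max 0 (4 + Z p.1 p.2)) = (fun p => 4 + X p.1 p.2) ∧
      ‖X - Z ^ 2 ^ L‖ ≤ (7 ^ L - 1) * (128 * Fintype.card ι ^ 2 / 4 ^ S) := by
  set δ : ℝ := 128 * Fintype.card ι ^ 2 / 4 ^ S with hδdef
  have hδ0 : 0 ≤ δ := by positivity
  have hmax : ∀ (X : Matrix ι ι ℝ), ‖X‖ ≤ 4 →
      (fun p : ι × ι => max 0 (4 + X p.1 p.2)) = fun p => 4 + X p.1 p.2 := by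
    intro X hX
    funext p
    have := (Matrix.abs_apply_le_l2_opNorm X p.1 p.2).trans hX
    rw [abs_le] at this
    exact max_eq_right (by linarith)
  induction L with
  | zero =>
    refine ⟨Z, ?_, by simp⟩
    have := hZ 1
    rw [pow_one] at this
    exact hmax Z (by linarith)
  | succ L ih =>
    have h7 : (1 : ℝ) ≤ 7 ^ L := one_le_pow₀ (by norm_num)
    obtain ⟨X, hX1, hX2⟩ := ih (by
      refine le_trans ?_ hδ
      gcongr
      · norm_num
      · omega)
    rw [Function.iterate_succ_apply', hX1]
    have hE : ‖X - Z ^ 2 ^ L‖ ≤ 1 := by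
      refine hX2.trans (le_trans ?_ hδ)
      gcongr
      rw [pow_succ]
      linarith
    have hX4 : ‖X‖ ≤ 4 := by
      have := norm_add_le (X - Z ^ 2 ^ L) (Z ^ 2 ^ L)
      rw [sub_add_cancel] at this
      linarith [hZ (2 ^ L)]
    let X' : Matrix ι ι ℝ := Matrix.of fun i l =>
      ∑ j, (64 * NeuralNetwork.sawIter (polarArg (4 + X i j) (4 + X j l) false) S 2 -
        64 * NeuralNetwork.sawIter (polarArg (4 + X i j) (4 + X j l) true) S 2)
    have hX' : ‖X' - X * X‖ ≤ δ := by
      refine (Matrix.l2_opNorm_le_of_entries_of_card_le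
        (δ := Fintype.card ι * (128 / 4 ^ S)) (by positivity) (fun i j => ?_) le_rfl le_rfl).trans
        (le_of_eq ?_)
      · exact abs_sum_polar_sub_le
          (fun i j => (Matrix.abs_apply_le_l2_opNorm X i j).trans hX4) S i j
      · rw [hδdef]; ring
    have hsq : ‖X * X - Z ^ 2 ^ (L + 1)‖ ≤ 7 * ‖X - Z ^ 2 ^ L‖ := by
      set E := X - Z ^ 2 ^ L with hEdef
      have e : X * X - Z ^ 2 ^ (L + 1) = E * X + Z ^ 2 ^ L * E := by
        rw [hEdef, pow_succ, pow_mul, sq]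
        noncomm_ring
      rw [e]
      have t1 : ‖E * X‖ ≤ ‖E‖ * 4 := (norm_mul_le _ _).trans (by gcongr)
      have t2 : ‖Z ^ 2 ^ L * E‖ ≤ 3 * ‖E‖ := (norm_mul_le _ _).trans (by gcongr; exact hZ _)
      linarith [norm_add_le (E * X) (Z ^ 2 ^ L * E)]
    have hfin : ‖X' - Z ^ 2 ^ (L + 1)‖ ≤ (7 ^ (L + 1) - 1) * δ := by
      have := norm_add_le (X' - X * X) (X * X - Z ^ 2 ^ (L + 1))
      rw [sub_add_sub_cancel] at this
      have e : ((7 : ℝ) ^ (L + 1) - 1) * δ = 7 * ((7 ^ L - 1) * δ) + 6 * δ := by ring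
      rw [e]
      linarith
    refine ⟨X', ?_, hfin⟩
    have hX'4 : ‖X'‖ ≤ 4 := by
      have := norm_add_le (X' - Z ^ 2 ^ (L + 1)) (Z ^ 2 ^ (L + 1))
      rw [sub_add_cancel] at this
      linarith [hZ (2 ^ (L + 1))]
    exact hmax X' hX'4

/-- A network which approximates entries of the `2 ^ L`-th power of an affinely parametrized
matrix. -/
theorem exists_network_matrix_pow {n m : ℕ} (Z₀ : Matrix ι ι ℝ) (Z : Fin n → Matrix ι ι ℝ)
    (S L : ℕ) (c : ℝ) (idx : Fin m → ι × ι) :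
    ∃ Ψ : NeuralNetwork n m, Ψ.depth = L * (S + 2) + 2 ∧
      Ψ.numParams ≤ Fintype.card ι ^ 2 * (n + 1) + L * (24 * (S + 1) * Fintype.card ι ^ 3) +
        2 * m ∧
      ∀ x : Fin n → ℝ, (∀ k, ‖(Z₀ + ∑ t, x t • Z t) ^ k‖ ≤ 3) →
        (7 : ℝ) ^ L * (128 * Fintype.card ι ^ 2 / 4 ^ S) ≤ 1 → ∀ o,
          |Ψ.realize x o - c * ((Z₀ + ∑ t, x t • Z t) ^ 2 ^ L) (idx o).1 (idx o).2| ≤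
            |c| * (7 ^ L * (128 * Fintype.card ι ^ 2 / 4 ^ S)) := by
  have h0 := (isHiddenState_id n).layer (κ' := ι × ι) (σ := Fin n) (fun _ t => t)
    (fun p t => Z t p.1 p.2) (fun p => 4 + Z₀ p.1 p.2)
  have e0 : (fun (x : Fin n → ℝ) (o : ι × ι) => max 0 (∑ r, Z r o.1 o.2 * x r + (4 + Z₀ o.1 o.2))) =
      fun x o => max 0 (4 + (Z₀ + ∑ t, x t • Z t) o.1 o.2) := by
    funext x o
    rw [Matrix.add_apply, Matrix.sum_apply]
    congr 1
    simp only [Matrix.smul_apply, smul_eq_mul, mul_comm (x _)]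
    ring
  rw [e0] at h0
  have h1 : IsHiddenState (fun x => (squareStep S)^[L] fun o : ι × ι =>
      max 0 (4 + (Z₀ + ∑ t, x t • Z t) o.1 o.2)) (0 + 1 + L * (S + 2))
      (0 + Fintype.card (ι × ι) * (Fintype.card (Fin n) + 1) +
        L * (24 * (S + 1) * Fintype.card ι ^ 3)) := by
    induction L with
    | zero => simpa using h0
    | succ L ih =>
      have := ih.squareStep S
      simp only [Function.iterate_succ_apply']
      have e : 0 + 1 + (L + 1) * (S + 2) = 0 + 1 + L * (S + 2) + (S + 2) := by ring
      rw [e]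
      exact this.mono (by rw [add_mul L 1]; omega)
  -- The output layer picks the wanted entries, multiplies them by `c` and removes the shift by the
  -- bias `-4 * c`.
  obtain ⟨Ψ, hΨ, hd, hp⟩ := h1.last (σ := Unit) (fun o _ => idx o) (fun _ _ => c)
    (fun _ => -4 * c)
  refine ⟨Ψ, by rw [hd]; ring, hp.trans (le_of_eq ?_), fun x hZ hδ o => ?_⟩
  · simp only [Fintype.card_prod, Fintype.card_fin, Fintype.card_unit]
    ring
  obtain ⟨X, hX1, hX2⟩ := squareStep_iterate_spec hZ S L hδ
  rw [hΨ, hX1]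
  have e : ∑ r : Unit, c * (4 + X (idx o).1 (idx o).2) + -4 * c -
      c * ((Z₀ + ∑ t, x t • Z t) ^ 2 ^ L) (idx o).1 (idx o).2 =
      c * (X - (Z₀ + ∑ t, x t • Z t) ^ 2 ^ L) (idx o).1 (idx o).2 := by
    rw [Matrix.sub_apply]
    simp
    ring
  rw [e, abs_mul]
  gcongr
  refine (Matrix.abs_apply_le_l2_opNorm _ _ _).trans (hX2.trans ?_)
  gcongr
  linarith

end

/-- A network which approximates the entries of `g + c * (1 - R)⁻¹ * b` for matrices that depend
linearly on the input (up to the identity as a constant part of `R`). -/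
theorem exists_network_mul_inv_mul {Y I J : Type} [Fintype Y] [Fintype I] [Fintype J]
    [DecidableEq Y] [DecidableEq I] [DecidableEq J] {n m : ℕ}
    (R : Fin n → Matrix Y Y ℝ) (c : Fin n → Matrix I Y ℝ) (b : Fin n → Matrix Y J ℝ)
    (g : Fin n → Matrix I J ℝ) (S L : ℕ) (s : ℝ) (idx : Fin m → I × J) :
    ∃ Ψ : NeuralNetwork n m, Ψ.depth = L * (S + 2) + 2 ∧
      Ψ.numParams ≤ Fintype.card (I ⊕ (Y ⊕ J)) ^ 2 * (n + 1) +
        L * (24 * (S + 1) * Fintype.card (I ⊕ (Y ⊕ J)) ^ 3) + 2 * m ∧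
      ∀ (x : Fin n → ℝ) (q : ℝ) (M : Matrix Y Y ℝ), q < 1 → ‖1 + ∑ t, x t • R t‖ ≤ q →
        ‖∑ t, x t • c t‖ ≤ 1 - q → ‖∑ t, x t • b t‖ + ‖∑ t, x t • g t‖ ≤ 1 →
        M * (1 - (1 + ∑ t, x t • R t)) = 1 →
        (7 : ℝ) ^ L * (128 * Fintype.card (I ⊕ (Y ⊕ J)) ^ 2 / 4 ^ S) ≤ 1 → ∀ o,
          |Ψ.realize x o - s * (∑ t, x t • g t + (∑ t, x t • c t) * M * ∑ t, x t • b t)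
            (idx o).1 (idx o).2| ≤
            |s| * (7 ^ L * (128 * Fintype.card (I ⊕ (Y ⊕ J)) ^ 2 / 4 ^ S) +
              q ^ (2 ^ L - 1) / (1 - q)) := by
  -- The block matrix is affine in the input, so the first layer computes it exactly.
  obtain ⟨Ψ, hd, hp, hΨ⟩ := exists_network_matrix_pow (m := m)
    (Matrix.neumannBlock (1 : Matrix Y Y ℝ) (0 : Matrix I Y ℝ) (0 : Matrix Y J ℝ) 0)
    (fun t => Matrix.fromBlocks 0 (Matrix.fromCols (c t) (g t)) 0
      (Matrix.fromBlocks (R t) (b t) 0 0)) S L s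
    (fun o => (Sum.inl (idx o).1, Sum.inr (Sum.inr (idx o).2)))
  refine ⟨Ψ, hd, hp, fun x q M hq hR hc hbg hM hδ o => ?_⟩
  have hZ : Matrix.neumannBlock (1 : Matrix Y Y ℝ) (0 : Matrix I Y ℝ) (0 : Matrix Y J ℝ) 0 +
      ∑ t, x t • Matrix.fromBlocks 0 (Matrix.fromCols (c t) (g t)) 0
        (Matrix.fromBlocks (R t) (b t) 0 0) = Matrix.neumannBlock (1 + ∑ t, x t • R t)
          (∑ t, x t • c t) (∑ t, x t • b t) (∑ t, x t • g t) := by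
    ext (i | i | i) (j | j | j) <;>
      simp [Matrix.neumannBlock, Matrix.sum_apply]
  specialize hΨ x
  rw [hZ] at hΨ
  have h1 := hΨ (Matrix.norm_neumannBlock_pow_le hR hc hbg) hδ o
  have hq0 : 0 ≤ q := (norm_nonneg _).trans hR
  have h2 := Matrix.abs_neumannBlock_pow_sub_le (g := ∑ t, x t • g t) hq hR (by linarith)
    (by linarith [norm_nonneg (∑ t, x t • g t)]) hM (2 ^ L - 1) (idx o).1 (idx o).2
  -- The power `2 ^ L` contains the terms with `i < 2 ^ L - 1`, which explains the exponent of `q`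
  -- in the truncation error.
  rw [Nat.sub_add_cancel Nat.one_le_two_pow] at h2
  simp only at h1
  rw [mul_add |s|]
  refine (abs_sub_le _ _ _).trans (add_le_add h1 ?_)
  rw [← mul_sub, abs_mul]
  gcongr

end NeuralNetwork

end
-- Boxes, elements and patches of Cartesian meshes
noncomputable section

namespace CartesianMesh

variable {d : ℕ} (T : CartesianMesh d)

/-- The closed box between two nodes. -/
def box (lo hi : Fin d → ℕ) : Set (Fin d → ℝ) := Set.Icc (T.node lo) (T.node hi)

def openCell (q : Fin d → ℕ) : Set (Fin d → ℝ) :=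
  Set.pi Set.univ fun i => Set.Ioo (T.node q i) (T.node (q + 1) i)

/-- Multi-indices of the elements in the box between two nodes. -/
def boxElems (lo hi : Fin d → ℕ) : Finset (Fin d → ℕ) :=
  Fintype.piFinset fun i => Finset.Ico (lo i) (hi i)

variable {T} {lo hi q : Fin d → ℕ}

theorem mem_boxElems : q ∈ boxElems lo hi ↔ ∀ i, lo i ≤ q i ∧ q i < hi i := by
  simp [boxElems]

theorem cell_eq_box (q : Fin d → ℕ) : T.cell q = T.box q (q + 1) := by
  simp only [cell, box]
  congr 1
  funext i
  simp [node]

theorem mem_cell {x : Fin d → ℝ} : x ∈ T.cell q ↔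
    ∀ i, T.origin i + q i * T.size ≤ x i ∧ x i ≤ T.origin i + (q i + 1) * T.size := by
  simp [cell, Pi.le_def, forall_and]

theorem mem_box {x : Fin d → ℝ} : x ∈ T.box lo hi ↔
    ∀ i, T.origin i + lo i * T.size ≤ x i ∧ x i ≤ T.origin i + hi i * T.size := by
  simp [box, node, Pi.le_def, forall_and]

theorem mem_openCell {x : Fin d → ℝ} : x ∈ T.openCell q ↔
    ∀ i, T.origin i + q i * T.size < x i ∧ x i < T.origin i + (q i + 1) * T.size := by
  simp [openCell, node]

theorem isOpen_openCell : IsOpen (T.openCell q) :=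
  isOpen_set_pi Set.finite_univ fun _ _ => isOpen_Ioo

theorem openCell_subset_cell : T.openCell q ⊆ T.cell q := fun x hx => by
  rw [mem_openCell] at hx
  exact mem_cell.2 fun i => ⟨(hx i).1.le, (hx i).2.le⟩

theorem measurableSet_cell : MeasurableSet (T.cell q) := measurableSet_Icc

theorem isCompact_cell : IsCompact (T.cell q) := isCompact_Icc

theorem openCell_ae_eq_cell : T.openCell q =ᵐ[volume] T.cell q := by
  rw [cell_eq_box]
  exact Measure.univ_pi_Ioo_ae_eq_Icc

theorem closure_openCell (hT : 0 < T.size) : closure (T.openCell q) = T.cell q := by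
  rw [openCell, closure_pi_set, cell_eq_box, box, ← Set.pi_univ_Icc]
  congr 1
  funext i
  refine closure_Ioo (ne_of_lt ?_)
  simp [node]
  linarith

theorem volume_cell_lt_top : volume (T.cell q) < ⊤ := isCompact_cell.measure_lt_top

theorem volume_cell (hT : 0 < T.size) : volume.real (T.cell q) = T.size ^ d := by
  rw [cell, measureReal_def, Real.volume_Icc_pi]
  have : ∀ i : Fin d, T.origin i + (q i + 1) * T.size - (T.origin i + q i * T.size) = T.size := by
    intro i
    ring
  simp [this, ENNReal.toReal_ofReal hT.le]

/-- A continuous function that vanishes on the open cell vanishes on the cell. -/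
theorem eqOn_cell_of_eqOn_openCell (hT : 0 < T.size) {u v : (Fin d → ℝ) → ℝ} (hu : Continuous u)
    (hv : Continuous v) (h : Set.EqOn u v (T.openCell q)) : Set.EqOn u v (T.cell q) := by
  rw [← closure_openCell hT]
  exact h.closure hu hv

theorem openCell_disjoint_box (hT : 0 < T.size) (hq : q ∉ boxElems lo hi) :
    Disjoint (T.openCell q) (T.box lo hi) := by
  rw [Set.disjoint_left]
  intro x hx hx'
  rw [mem_openCell] at hx
  rw [mem_box] at hx'
  refine hq (mem_boxElems.2 fun i => ?_)
  constructor
  · by_contra! h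
    have h1 : (q i : ℝ) + 1 ≤ lo i := by exact_mod_cast h
    have := mul_le_mul_of_nonneg_right h1 hT.le
    linarith [(hx i).2, (hx' i).1]
  · by_contra! h
    have h1 : (hi i : ℝ) ≤ q i := by exact_mod_cast h
    have := mul_le_mul_of_nonneg_right h1 hT.le
    linarith [(hx i).1, (hx' i).2]

theorem cell_subset_box (hT : 0 < T.size) (hq : q ∈ boxElems lo hi) : T.cell q ⊆ T.box lo hi := by
  intro x hx
  rw [mem_boxElems] at hq
  rw [mem_cell] at hx
  refine mem_box.2 fun i => ⟨le_trans ?_ (hx i).1, (hx i).2.trans ?_⟩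
  · have : (lo i : ℝ) ≤ q i := by exact_mod_cast (hq i).1
    gcongr
  · have : (q i : ℝ) + 1 ≤ hi i := by exact_mod_cast (hq i).2
    gcongr

theorem exists_cell_index {o H x : ℝ} {m n : ℕ} (hmn : m < n) (h1 : o + m * H ≤ x)
    (h2 : x ≤ o + n * H) : ∃ q : ℕ, m ≤ q ∧ q < n ∧ o + q * H ≤ x ∧ x ≤ o + (q + 1) * H := by
  induction n, hmn using Nat.le_induction with
  | base => exact ⟨m, le_rfl, Nat.lt_succ_self m, h1, by push_cast at h2; exact h2⟩
  | succ n hn ih =>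
    rcases le_total x (o + n * H) with h | h
    · obtain ⟨q, a, b, c, e⟩ := ih h
      exact ⟨q, a, by omega, c, e⟩
    · exact ⟨n, by omega, by omega, h, by push_cast at h2; exact h2⟩

theorem box_eq_biUnion_cell (hT : 0 < T.size) (hlt : ∀ i, lo i < hi i) :
    T.box lo hi = ⋃ q ∈ boxElems lo hi, T.cell q := by
  refine Set.Subset.antisymm (fun x hx => ?_)
    (Set.iUnion₂_subset fun q hq => cell_subset_box hT hq)
  rw [mem_box] at hx
  choose q h1 h2 h3 h4 using fun i => exists_cell_index (hlt i) (hx i).1 (hx i).2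
  exact Set.mem_iUnion₂.2 ⟨q, mem_boxElems.2 fun i => ⟨h1 i, h2 i⟩, mem_cell.2 fun i => ⟨h3 i, h4 i⟩⟩

theorem ae_restrict_box (hT : 0 < T.size) (hlt : ∀ i, lo i < hi i) {P : (Fin d → ℝ) → Prop}
    (h : ∀ q ∈ boxElems lo hi, ∀ᵐ x ∂volume.restrict (T.openCell q), P x) :
    ∀ᵐ x ∂volume.restrict (T.box lo hi), P x := by
  rw [box_eq_biUnion_cell hT hlt, ae_restrict_biUnion_finset_iff]
  intro q hq
  rw [← Measure.restrict_congr_set openCell_ae_eq_cell]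
  exact h q hq

theorem openCell_pairwiseDisjoint (hT : 0 < T.size) {q q' : Fin d → ℕ} (hne : q ≠ q') :
    Disjoint (T.openCell q) (T.openCell q') := by
  have : q ∉ boxElems q' (q' + 1) := by
    intro h
    rw [mem_boxElems] at h
    refine hne (funext fun i => ?_)
    have := h i
    simp only [Pi.add_apply, Pi.one_apply] at this
    omega
  have := openCell_disjoint_box hT this
  rw [← cell_eq_box] at this
  exact this.mono_right openCell_subset_cell

/-- Closed cells overlap in faces; they are exchanged for the open cells, which are disjoint and
differ from them by null sets. -/
theorem setIntegral_box_inter (hT : 0 < T.size) (hlt : ∀ i, lo i < hi i) {S : Set (Fin d → ℝ)}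
    (hS : MeasurableSet S) {f : (Fin d → ℝ) → ℝ}
    (hf : ∀ q ∈ boxElems lo hi, IntegrableOn f (T.cell q ∩ S)) :
    ∫ x in T.box lo hi ∩ S, f x = ∑ q ∈ boxElems lo hi, ∫ x in T.cell q ∩ S, f x := by
  have hae : ∀ q, (T.openCell q ∩ S : Set _) =ᵐ[volume] (T.cell q ∩ S : Set _) := fun q =>
    openCell_ae_eq_cell.inter (Filter.EventuallyEq.refl _ _)
  have h1 : (T.box lo hi ∩ S : Set _) =ᵐ[volume]
      (⋃ q ∈ boxElems lo hi, (T.openCell q ∩ S) : Set _) := by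
    rw [box_eq_biUnion_cell hT hlt, Set.iUnion₂_inter]
    refine ((boxElems lo hi).finite_toSet.eventuallyEq_iUnion ?_).symm
    exact fun q _ => hae q
  rw [setIntegral_congr_set h1, integral_biUnion_finset]
  · exact Finset.sum_congr rfl fun q _ => setIntegral_congr_set (hae q)
  · exact fun q _ => isOpen_openCell.measurableSet.inter hS
  · intro q _ q' _ hne
    exact (openCell_pairwiseDisjoint hT hne).mono Set.inter_subset_left Set.inter_subset_left
  · exact fun q hq => (hf q hq).congr_set_ae (hae q)

theorem box_nonempty_inter (hT : 0 < T.size) {lo' hi' : Fin d → ℕ}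
    (h : (T.box lo hi ∩ T.box lo' hi').Nonempty) (i : Fin d) : lo i ≤ hi' i ∧ lo' i ≤ hi i := by
  obtain ⟨x, hx, hx'⟩ := h
  have h1 := mem_box.1 hx i
  have h2 := mem_box.1 hx' i
  constructor
  · have : (lo i : ℝ) * T.size ≤ hi' i * T.size := by linarith
    exact_mod_cast le_of_mul_le_mul_right this hT
  · have : (lo' i : ℝ) * T.size ≤ hi i * T.size := by linarith
    exact_mod_cast le_of_mul_le_mul_right this hT

/-- A patch adds one layer on each side. The truncated subtraction in `lo - 1` agrees with the end
of the mesh; on the other side `hhi` guarantees that the layer exists. -/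
theorem patch_box (hT : 0 < T.size) (hlt : ∀ i, lo i ≤ hi i)
    (hhi : ∀ i, hi i + 1 ≤ T.count i) :
    T.patch (T.box lo hi) = T.box (lo - 1) (hi + 1) := by
  have hcl : closure (T.box lo hi) = T.box lo hi := isClosed_Icc.closure_eq
  rw [box_eq_biUnion_cell hT (lo := lo - 1) fun i => ?_, patch, hcl]
  · refine Set.iUnion_congr fun q => Set.iUnion_congr_Prop ?_ fun _ => rfl
    constructor
    · rintro ⟨-, h⟩
      rw [cell_eq_box] at h
      have := box_nonempty_inter hT h
      refine mem_boxElems.2 fun i => ?_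
      have := this i
      simp only [Pi.add_apply, Pi.one_apply, Pi.sub_apply] at this ⊢
      omega
    · intro hq
      rw [mem_boxElems] at hq
      simp only [Pi.add_apply, Pi.one_apply, Pi.sub_apply] at hq
      refine ⟨?_, ?_⟩
      · simp only [elems, Fintype.mem_piFinset, Finset.mem_range]
        intro i
        have := hq i
        have := hhi i
        omega
      -- A node common to the cell and the box.
      · refine ⟨T.node fun i => max (lo i) (q i), ?_, ?_⟩
        · refine mem_box.2 fun i => ?_
          have h1 : (lo i : ℝ) ≤ max (lo i : ℝ) (q i) := le_max_left _ _
          have h2 : max (lo i : ℝ) (q i) ≤ hi i := by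
            exact_mod_cast max_le (hlt i) (by have := hq i; omega)
          simp only [node, Nat.cast_max]
          constructor <;> gcongr
        · refine mem_cell.2 fun i => ?_
          have h1 : (q i : ℝ) ≤ max (lo i : ℝ) (q i) := le_max_right _ _
          have h2 : max (lo i : ℝ) (q i) ≤ (q i : ℝ) + 1 := by
            have : max (lo i) (q i) ≤ q i + 1 := max_le (by have := hq i; omega) (by omega)
            exact_mod_cast this
          simp only [node, Nat.cast_max]
          constructor <;> gcongr
  · have := hlt i
    simp only [Pi.add_apply, Pi.one_apply, Pi.sub_apply]
    omega

theorem elemPatch_eq_box (hT : 0 < T.size) {K : Fin d → ℕ} (ℓ : ℕ)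
    (hK : ∀ i, ℓ ≤ K i ∧ K i + 1 + ℓ ≤ T.count i) :
    T.elemPatch ℓ K = T.box (fun i => K i - ℓ) (fun i => K i + 1 + ℓ) := by
  induction ℓ with
  | zero =>
    rw [elemPatch, Function.iterate_zero, id, cell_eq_box]
    rfl
  | succ ℓ ih =>
    rw [elemPatch, Function.iterate_succ_apply', ← elemPatch, ih, patch_box hT]
    · congr 1
    all_goals
      intro i
      have := hK i
      omega

theorem refine_node {r : ℕ} (hr : r ≠ 0) (z : Fin d → ℕ) :
    (T.refine r).node (r • z) = T.node z := by
  funext i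
  have : (r : ℝ) ≠ 0 := by exact_mod_cast hr
  simp only [node, refine, Pi.smul_apply, smul_eq_mul, Nat.cast_mul]
  field_simp

theorem refine_box {r : ℕ} (hr : r ≠ 0) (lo hi : Fin d → ℕ) :
    (T.refine r).box (r • lo) (r • hi) = T.box lo hi := by
  rw [box, box, refine_node hr, refine_node hr]

theorem refine_domain {r : ℕ} (hr : r ≠ 0) : (T.refine r).domain = T.domain := by
  have : (r : ℝ) ≠ 0 := by exact_mod_cast hr
  ext x
  simp only [domain, refine, Set.mem_ofPred_eq, Nat.cast_mul]
  refine forall_congr' fun i => ?_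
  have e : (r : ℝ) * T.count i * (T.size / r) = T.count i * T.size := by field_simp
  rw [e]

theorem size_refine_pos {r : ℕ} (hr : r ≠ 0) (hT : 0 < T.size) : 0 < (T.refine r).size :=
  div_pos hT (by positivity)

theorem box_subset_domain (hT : 0 < T.size) (hlo : ∀ i, 1 ≤ lo i)
    (hhi : ∀ i, hi i + 1 ≤ T.count i) : T.box lo hi ⊆ T.domain := by
  intro x hx i
  have h := mem_box.1 hx i
  have h1 : (1 : ℝ) ≤ lo i := by exact_mod_cast hlo i
  have h2 : (hi i : ℝ) + 1 ≤ T.count i := by exact_mod_cast hhi i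
  have h3 := mul_le_mul_of_nonneg_right h1 hT.le
  have h4 := mul_le_mul_of_nonneg_right h2 hT.le
  constructor <;> linarith

end CartesianMesh

end
-- The Dirichlet form and piecewise constant coefficients
noncomputable section

section Dirichlet

variable {d : ℕ} {Ω S : Set (Fin d → ℝ)}

def gradDot (u v : (Fin d → ℝ) → ℝ) (x : Fin d → ℝ) : ℝ :=
  ∑ i : Fin d, fderiv ℝ u x (Pi.single i 1) * fderiv ℝ v x (Pi.single i 1)

/-- The energy form with unit coefficient. -/
def dirichlet (S : Set (Fin d → ℝ)) (u v : (Fin d → ℝ) → ℝ) : ℝ := ∫ x in S, gradDot u v x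

/-- Functions that are differentiable with bounded derivative almost everywhere on `Ω`. -/
def regularOn (Ω : Set (Fin d → ℝ)) : Submodule ℝ ((Fin d → ℝ) → ℝ) where
  carrier := {u | ∃ C : ℝ, ∀ᵐ x ∂volume.restrict Ω, DifferentiableAt ℝ u x ∧ ‖fderiv ℝ u x‖ ≤ C}
  zero_mem' := ⟨0, by
    refine Filter.Eventually.of_forall fun x => ⟨differentiableAt_const (0 : ℝ), ?_⟩
    have : fderiv ℝ (0 : (Fin d → ℝ) → ℝ) x = 0 := fderiv_const_apply (0 : ℝ)
    simp [this]⟩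
  add_mem' := by
    rintro u v ⟨C, hu⟩ ⟨C', hv⟩
    refine ⟨C + C', ?_⟩
    filter_upwards [hu, hv] with x hx hx'
    refine ⟨hx.1.add hx'.1, ?_⟩
    rw [fderiv_add hx.1 hx'.1]
    exact (norm_add_le _ _).trans (add_le_add hx.2 hx'.2)
  smul_mem' := by
    rintro c u ⟨C, hu⟩
    refine ⟨‖c‖ * C, ?_⟩
    filter_upwards [hu] with x hx
    refine ⟨hx.1.const_smul c, ?_⟩
    rw [fderiv_const_smul hx.1, norm_smul]
    gcongr
    exact hx.2

theorem gradDot_comm (u v : (Fin d → ℝ) → ℝ) (x : Fin d → ℝ) : gradDot u v x = gradDot v u x := by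
  simp only [gradDot, mul_comm]

theorem gradDot_self_nonneg (u : (Fin d → ℝ) → ℝ) (x : Fin d → ℝ) : 0 ≤ gradDot u u x :=
  Finset.sum_nonneg fun _ _ => mul_self_nonneg _

theorem dirichlet_comm (u v : (Fin d → ℝ) → ℝ) : dirichlet S u v = dirichlet S v u := by
  simp only [dirichlet, gradDot_comm u v]

theorem measurable_gradDot (u v : (Fin d → ℝ) → ℝ) : Measurable (gradDot u v) := by
  unfold gradDot
  exact Finset.measurable_sum _ fun i _ =>
    (measurable_fderiv_apply_const ℝ u _).mul (measurable_fderiv_apply_const ℝ v _)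

theorem abs_fderiv_single_le {u : (Fin d → ℝ) → ℝ} {x : Fin d → ℝ} {C : ℝ}
    (h : ‖fderiv ℝ u x‖ ≤ C) (i : Fin d) : |fderiv ℝ u x (Pi.single i 1)| ≤ C := by
  have := (fderiv ℝ u x).le_opNorm (Pi.single i 1)
  rw [Pi.norm_single, norm_one, mul_one] at this
  exact this.trans h

theorem abs_gradDot_le {u v : (Fin d → ℝ) → ℝ} {x : Fin d → ℝ} {C C' : ℝ}
    (h : ‖fderiv ℝ u x‖ ≤ C) (h' : ‖fderiv ℝ v x‖ ≤ C') : |gradDot u v x| ≤ d * (C * C') := by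
  refine (Finset.abs_sum_le_sum_abs _ _).trans ?_
  refine (Finset.sum_le_card_nsmul _ _ (C * C') fun i _ => ?_).trans (by simp)
  rw [abs_mul]
  exact mul_le_mul (abs_fderiv_single_le h i) (abs_fderiv_single_le h' i) (abs_nonneg _)
    ((norm_nonneg _).trans h)

theorem integrableOn_gradDot {u v : (Fin d → ℝ) → ℝ} (hΩ : volume Ω < ⊤) (hu : u ∈ regularOn Ω)
    (hv : v ∈ regularOn Ω) : IntegrableOn (gradDot u v) Ω := by
  obtain ⟨C, hu⟩ := hu
  obtain ⟨C', hv⟩ := hv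
  refine IntegrableOn.of_bound hΩ (measurable_gradDot u v).aestronglyMeasurable (d * (C * C')) ?_
  filter_upwards [hu, hv] with x hx hx'
  exact abs_gradDot_le hx.2 hx'.2

theorem regularOn_mono (h : S ⊆ Ω) : regularOn Ω ≤ regularOn S := by
  rintro u ⟨C, hu⟩
  exact ⟨C, ae_restrict_of_ae_restrict_of_subset h hu⟩

theorem dirichlet_add_left {u u' v : (Fin d → ℝ) → ℝ} (hS : volume S < ⊤) (hu : u ∈ regularOn S)
    (hu' : u' ∈ regularOn S) (hv : v ∈ regularOn S) :
    dirichlet S (u + u') v = dirichlet S u v + dirichlet S u' v := by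
  rw [dirichlet, dirichlet, dirichlet, ← integral_add (integrableOn_gradDot hS hu hv)
    (integrableOn_gradDot hS hu' hv)]
  obtain ⟨C, hu⟩ := hu
  obtain ⟨C', hu'⟩ := hu'
  refine integral_congr_ae ?_
  filter_upwards [hu, hu'] with x hx hx'
  simp only [gradDot, fderiv_add hx.1 hx'.1, add_apply, add_mul,
    Finset.sum_add_distrib]

theorem dirichlet_smul_left {u : (Fin d → ℝ) → ℝ} (c : ℝ) (hu : u ∈ regularOn S)
    (v : (Fin d → ℝ) → ℝ) : dirichlet S (c • u) v = c * dirichlet S u v := by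
  rw [dirichlet, dirichlet, ← integral_const_mul]
  obtain ⟨C, hu⟩ := hu
  refine integral_congr_ae ?_
  filter_upwards [hu] with x hx
  simp only [gradDot, fderiv_const_smul hx.1, Finset.mul_sum]
  simp [mul_assoc]

theorem dirichlet_zero_left (v : (Fin d → ℝ) → ℝ) : dirichlet S 0 v = 0 := by
  have := dirichlet_smul_left (S := S) 0 (Submodule.zero_mem _) v
  simpa using this

theorem dirichlet_sum_left {κ : Type*} (s : Finset κ) (c : κ → ℝ) {u : κ → (Fin d → ℝ) → ℝ}
    {v : (Fin d → ℝ) → ℝ} (hS : volume S < ⊤) (hu : ∀ k, u k ∈ regularOn S)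
    (hv : v ∈ regularOn S) :
    dirichlet S (∑ k ∈ s, c k • u k) v = ∑ k ∈ s, c k * dirichlet S (u k) v := by
  classical
  induction s using Finset.induction_on with
  | empty => simp [dirichlet_zero_left]
  | insert k s hk ih =>
    rw [Finset.sum_insert hk, Finset.sum_insert hk, dirichlet_add_left hS
      (Submodule.smul_mem _ _ (hu k)) (Submodule.sum_mem _ fun j _ => Submodule.smul_mem _ _ (hu j))
      hv, dirichlet_smul_left _ (hu k), ih]

theorem dirichlet_self_nonneg (u : (Fin d → ℝ) → ℝ) : 0 ≤ dirichlet S u u :=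
  integral_nonneg fun x => gradDot_self_nonneg u x

/-- Nonnegativity at `u + v` and `u - v`; this form of the Cauchy–Schwarz inequality suffices for
bounding entries. -/
theorem abs_dirichlet_le {u v : (Fin d → ℝ) → ℝ} (hS : volume S < ⊤) (hu : u ∈ regularOn S)
    (hv : v ∈ regularOn S) : |dirichlet S u v| ≤ (dirichlet S u u + dirichlet S v v) / 2 := by
  have key : ∀ c : ℝ, c ^ 2 = 1 → 0 ≤ dirichlet S u u + 2 * c * dirichlet S u v +
      dirichlet S v v := by
    intro c hc
    have h := dirichlet_self_nonneg (S := S) (u + c • v)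
    have hcv := Submodule.smul_mem _ c hv
    have huv := Submodule.add_mem _ hu hcv
    rw [dirichlet_add_left hS hu hcv huv, dirichlet_comm u, dirichlet_comm (c • v),
      dirichlet_add_left hS hu hcv hu, dirichlet_add_left hS hu hcv hcv,
      dirichlet_smul_left c hv, dirichlet_smul_left c hv, dirichlet_comm u (c • v),
      dirichlet_smul_left c hv, dirichlet_comm v (c • v), dirichlet_smul_left c hv,
      dirichlet_comm v u] at h
    have e : c * (c * dirichlet S v v) = dirichlet S v v := by
      rw [← mul_assoc, ← sq, hc, one_mul]
    linarith
  have h1 := key 1 (by norm_num)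
  have h2 := key (-1) (by norm_num)
  rw [abs_le]
  constructor <;> linarith

theorem dirichlet_self_mono {u : (Fin d → ℝ) → ℝ} (hΩ : volume Ω < ⊤) (hu : u ∈ regularOn Ω)
    (h : S ⊆ Ω) : dirichlet S u u ≤ dirichlet Ω u u :=
  setIntegral_mono_set (integrableOn_gradDot hΩ hu hu)
    (Filter.Eventually.of_forall fun x => gradDot_self_nonneg u x)
    h.eventuallyLE

theorem energyForm_eq_const_mul {A : (Fin d → ℝ) → ℝ} {c : ℝ}
    (h : ∀ᵐ x ∂volume.restrict S, A x = c) (u v : (Fin d → ℝ) → ℝ) :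
    energyForm A S u v = c * dirichlet S u v := by
  rw [dirichlet, ← integral_const_mul]
  refine integral_congr_ae ?_
  filter_upwards [h] with x hx
  rw [hx, gradDot]

theorem dirichlet_translate (a : Fin d → ℝ) (S : Set (Fin d → ℝ)) (u v : (Fin d → ℝ) → ℝ) :
    dirichlet ((fun x => x - a) ⁻¹' S) (fun x => u (x - a)) (fun x => v (x - a)) =
      dirichlet S u v := by
  have h := (measurePreserving_sub_right (volume : Measure (Fin d → ℝ)) a).setIntegral_preimage_emb
    (MeasurableEquiv.subRight a).measurableEmbedding (gradDot u v) S
  rw [dirichlet, dirichlet, ← h]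
  simp only [gradDot, fderiv_comp_sub]

/-- Telescoping, one factor at a time; applied to the tensor product structure of hat functions. -/
theorem abs_prod_sub_prod_le {κ : Type*} (s : Finset κ) (a b : κ → ℝ) (ha : ∀ k, 0 ≤ a k ∧ a k ≤ 1)
    (hb : ∀ k, 0 ≤ b k ∧ b k ≤ 1) :
    |∏ k ∈ s, a k - ∏ k ∈ s, b k| ≤ ∑ k ∈ s, |a k - b k| := by
  classical
  induction s using Finset.induction_on with
  | empty => simp
  | insert k s hk ih =>
    rw [Finset.prod_insert hk, Finset.prod_insert hk, Finset.sum_insert hk]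
    have e : a k * ∏ j ∈ s, a j - b k * ∏ j ∈ s, b j =
        (a k - b k) * ∏ j ∈ s, a j + b k * (∏ j ∈ s, a j - ∏ j ∈ s, b j) := by ring
    have h1 : |∏ j ∈ s, a j| ≤ 1 := by
      rw [abs_of_nonneg (Finset.prod_nonneg fun j _ => (ha j).1)]
      exact Finset.prod_le_one (fun j _ => (ha j).1) fun j _ => (ha j).2
    rw [e]
    refine (abs_add_le _ _).trans (add_le_add ?_ ?_)
    · rw [abs_mul]
      exact mul_le_of_le_one_right (abs_nonneg _) h1
    · rw [abs_mul, abs_of_nonneg (hb k).1]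
      exact (mul_le_of_le_one_left (abs_nonneg _) (hb k).2).trans ih

end Dirichlet

namespace CartesianMesh

variable {d : ℕ} {T : CartesianMesh d}

/-- Each of the `d` factors has Lipschitz constant `1 / size`. Rademacher's theorem then yields
differentiability almost everywhere without a discussion of the kinks. -/
theorem lipschitzWith_hat (hT : 0 < T.size) (z : Fin d → ℕ) :
    LipschitzWith (d / T.size).toNNReal (T.hat z) := by
  refine LipschitzWith.of_dist_le_mul fun x y => ?_
  rw [Real.coe_toNNReal _ (by positivity), Real.dist_eq]
  have hb : ∀ (x : Fin d → ℝ) i, 0 ≤ max 0 (1 - |x i - T.node z i| / T.size) ∧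
      max 0 (1 - |x i - T.node z i| / T.size) ≤ 1 := fun x i =>
    ⟨le_max_left _ _, max_le zero_le_one (by
      have : 0 ≤ |x i - T.node z i| / T.size := by positivity
      linarith)⟩
  refine (abs_prod_sub_prod_le _ _ _ (hb x) (hb y)).trans ?_
  refine (Finset.sum_le_card_nsmul _ _ (dist x y / T.size) fun i _ => ?_).trans (le_of_eq ?_)
  · refine (abs_max_sub_max_le_max _ _ _ _).trans (max_le (by rw [sub_self, abs_zero]; positivity) ?_)
    have e : 1 - |x i - T.node z i| / T.size - (1 - |y i - T.node z i| / T.size) =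
        (|y i - T.node z i| - |x i - T.node z i|) / T.size := by ring
    rw [e, abs_div, abs_of_pos hT]
    gcongr
    refine (abs_abs_sub_abs_le _ _).trans ?_
    rw [sub_sub_sub_cancel_right, ← Real.dist_eq, dist_comm]
    exact dist_le_pi_dist x y i
  · simp
    ring

theorem norm_fderiv_hat_le (hT : 0 < T.size) (z : Fin d → ℕ) (x : Fin d → ℝ) :
    ‖fderiv ℝ (T.hat z) x‖ ≤ d / T.size := by
  have := norm_fderiv_le_of_lipschitz ℝ (x₀ := x) (lipschitzWith_hat hT z)
  rwa [Real.coe_toNNReal _ (by positivity)] at this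

theorem hat_mem_regularOn (hT : 0 < T.size) (z : Fin d → ℕ) (Ω : Set (Fin d → ℝ)) :
    T.hat z ∈ regularOn Ω := by
  refine ⟨d / T.size, ?_⟩
  filter_upwards [ae_restrict_of_ae (lipschitzWith_hat hT z).ae_differentiableAt] with x hx
  exact ⟨hx, norm_fderiv_hat_le hT z x⟩

theorem abs_dirichlet_hat_le (hT : 0 < T.size) (z z' : Fin d → ℕ) {S : Set (Fin d → ℝ)}
    (hS : volume S < ⊤) :
    |dirichlet S (T.hat z) (T.hat z')| ≤ d * (d / T.size * (d / T.size)) * volume.real S :=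
  norm_setIntegral_le_of_norm_le_const (f := gradDot (T.hat z) (T.hat z')) hS fun x _ =>
    abs_gradDot_le (norm_fderiv_hat_le hT z x) (norm_fderiv_hat_le hT z' x)

theorem volume_box_lt_top {lo hi : Fin d → ℕ} : volume (T.box lo hi) < ⊤ :=
  isCompact_Icc.measure_lt_top

/-- The energy of a piecewise constant coefficient on a box as a sum over the elements. -/
theorem energyForm_box_inter (hT : 0 < T.size) {lo hi : Fin d → ℕ} (hlt : ∀ i, lo i < hi i)
    {S : Set (Fin d → ℝ)} (hS : MeasurableSet S) {A : (Fin d → ℝ) → ℝ} {a : (Fin d → ℕ) → ℝ}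
    (hA : ∀ q ∈ boxElems lo hi, ∀ᵐ x ∂volume.restrict (T.cell q), A x = a q)
    {u v : (Fin d → ℝ) → ℝ} (hu : u ∈ regularOn (T.box lo hi)) (hv : v ∈ regularOn (T.box lo hi)) :
    energyForm A (T.box lo hi ∩ S) u v =
      ∑ q ∈ boxElems lo hi, a q * dirichlet (T.cell q ∩ S) u v := by
  have hA' : ∀ q ∈ boxElems lo hi, ∀ᵐ x ∂volume.restrict (T.cell q ∩ S), A x = a q :=
    fun q hq => ae_restrict_of_ae_restrict_of_subset Set.inter_subset_left (hA q hq)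
  rw [energyForm, setIntegral_box_inter hT hlt hS]
  · exact Finset.sum_congr rfl fun q hq => energyForm_eq_const_mul (hA' q hq) u v
  · intro q hq
    have h1 : IntegrableOn (gradDot u v) (T.cell q ∩ S) :=
      (integrableOn_gradDot volume_box_lt_top hu hv).mono_set
        (Set.inter_subset_left.trans (cell_subset_box hT hq))
    refine (h1.const_mul (a q)).congr ?_
    filter_upwards [hA' q hq] with x hx
    rw [hx, gradDot]

theorem dirichlet_box_eq_sum (hT : 0 < T.size) {lo hi : Fin d → ℕ} (hlt : ∀ i, lo i < hi i)
    {u v : (Fin d → ℝ) → ℝ} (hu : u ∈ regularOn (T.box lo hi)) (hv : v ∈ regularOn (T.box lo hi)) :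
    dirichlet (T.box lo hi) u v = ∑ q ∈ boxElems lo hi, dirichlet (T.cell q) u v := by
  have h := energyForm_box_inter hT hlt MeasurableSet.univ (A := fun _ => 1) (a := fun _ => 1)
    (fun q _ => Filter.Eventually.of_forall fun _ => rfl) hu hv
  simp only [Set.inter_univ, one_mul] at h
  rw [← h, energyForm_eq_const_mul (Filter.Eventually.of_forall fun _ => rfl), one_mul]

/-- The energy of functions one of which vanishes off a closed set. -/
theorem energyForm_eq_of_eq_zero {A : (Fin d → ℝ) → ℝ} {Ω D : Set (Fin d → ℝ)}
    (hΩ : IsClosed Ω) (hD : MeasurableSet D) (hΩD : Ω ⊆ D) {w : (Fin d → ℝ) → ℝ}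
    (hw : ∀ x, x ∉ Ω → w x = 0) (u : (Fin d → ℝ) → ℝ) :
    energyForm A D u w = energyForm A Ω u w := by
  refine setIntegral_eq_of_subset_of_forall_sdiff_eq_zero hD hΩD fun x hx => ?_
  have h0 : w =ᶠ[nhds x] fun _ => 0 := by
    filter_upwards [hΩ.isOpen_compl.mem_nhds hx.2] with y hy using hw y hy
  rw [h0.fderiv_eq]
  simp

theorem measurableSet_domain : MeasurableSet T.domain := by
  have : T.domain = Set.pi Set.univ fun i =>
      Set.Ioo (T.origin i) (T.origin i + T.count i * T.size) := by
    ext x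
    simp [domain]
  rw [this]
  exact (isOpen_set_pi Set.finite_univ fun _ _ => isOpen_Ioo).measurableSet

end CartesianMesh

end
-- Local `L²`-projections and the quasi-interpolation
noncomputable section

section Q1

variable {d : ℕ}

theorem contDiff_of_mem_Q1Poly {p : (Fin d → ℝ) → ℝ} (hp : p ∈ Q1Poly d) : ContDiff ℝ 1 p := by
  refine Submodule.span_induction ?_ ?_ ?_ ?_ hp
  · rintro _ ⟨s, rfl⟩
    exact contDiff_prod fun i _ => contDiff_apply ℝ ℝ i
  · exact contDiff_const
  · exact fun _ _ _ _ hu hv => hu.add hv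
  · exact fun c _ _ hu => contDiff_const.smul hu

instance : FiniteDimensional ℝ (Q1Poly d) :=
  FiniteDimensional.span_of_finite ℝ (Set.finite_range _)

theorem finrank_Q1Poly_le : Module.finrank ℝ (Q1Poly d) ≤ 2 ^ d := by
  refine (finrank_range_le_card (R := ℝ) fun (s : Finset (Fin d)) (x : Fin d → ℝ) =>
    ∏ i ∈ s, x i).trans (by simp)

theorem Q1Poly_translate (a : Fin d → ℝ) {p : (Fin d → ℝ) → ℝ} (hp : p ∈ Q1Poly d) :
    (fun x => p (x - a)) ∈ Q1Poly d := by
  refine Submodule.span_induction (p := fun p _ => (fun x => p (x - a)) ∈ Q1Poly d) ?_ ?_ ?_ ?_ hp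
  · rintro _ ⟨s, rfl⟩
    have e : (fun x : Fin d → ℝ => ∏ i ∈ s, (x - a) i) =
        ∑ t ∈ s.powerset, (∏ i ∈ s \ t, -a i) • fun x : Fin d → ℝ => ∏ i ∈ t, x i := by
      funext x
      simp only [Pi.sub_apply, sub_eq_add_neg, Finset.prod_add, Finset.sum_apply, Pi.smul_apply,
        smul_eq_mul, mul_comm]
    simp only
    rw [e]
    exact Submodule.sum_mem _ fun t _ => Submodule.smul_mem _ _ (Submodule.subset_span ⟨t, rfl⟩)
  · exact Submodule.zero_mem _
  · exact fun _ _ _ _ hu hv => Submodule.add_mem _ hu hv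
  · exact fun c _ _ hu => Submodule.smul_mem _ c hu

variable {S : Set (Fin d → ℝ)} {u v p p' : (Fin d → ℝ) → ℝ}

theorem integrableOn_mul_of_continuous (hS : IsCompact S) (hu : Continuous u) (hv : Continuous v) :
    IntegrableOn (fun x => u x * v x) S :=
  (hu.mul hv).continuousOn.integrableOn_compact hS

theorem ae_eq_zero_of_integral_mul_self (hS : IsCompact S) (hu : Continuous u)
    (h : ∫ x in S, u x * u x = 0) : ∀ᵐ x ∂volume.restrict S, u x = 0 := by
  rw [integral_eq_zero_iff_of_nonneg (fun x => mul_self_nonneg (u x))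
    (integrableOn_mul_of_continuous hS hu hu)] at h
  filter_upwards [h] with x hx
  exact mul_self_eq_zero.1 hx

/-- The Gram map may fail to be injective for a general compact `S`, for instance a null set. Its
kernel consists of polynomials that vanish almost everywhere on `S`; the right-hand side annihilates
them and so lies in the range. -/
theorem exists_isL2Proj (hS : IsCompact S) (hv : Continuous v) : ∃ p, IsL2Proj S v p := by
  have hc : ∀ p : Q1Poly d, Continuous p.1 := fun p => (contDiff_of_mem_Q1Poly p.2).continuous
  let f : Q1Poly d →ₗ[ℝ] Module.Dual ℝ (Q1Poly d) := LinearMap.mk₂ ℝ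
    (fun p q => ∫ x in S, p.1 x * q.1 x)
    (fun p p' q => by
      rw [← integral_add (integrableOn_mul_of_continuous hS (hc p) (hc q))
        (integrableOn_mul_of_continuous hS (hc p') (hc q))]
      simp [add_mul])
    (fun c p q => by
      rw [smul_eq_mul, ← integral_const_mul]
      simp [mul_assoc])
    (fun p q q' => by
      rw [← integral_add (integrableOn_mul_of_continuous hS (hc p) (hc q))
        (integrableOn_mul_of_continuous hS (hc p) (hc q'))]
      simp [mul_add])
    (fun c p q => by
      rw [smul_eq_mul, ← integral_const_mul]
      simp [mul_left_comm])
  let g : Module.Dual ℝ (Q1Poly d) :=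
    { toFun := fun q => ∫ x in S, v x * q.1 x
      map_add' := fun q q' => by
        rw [← integral_add (integrableOn_mul_of_continuous hS hv (hc q))
          (integrableOn_mul_of_continuous hS hv (hc q'))]
        simp [mul_add]
      map_smul' := fun c q => by
        rw [RingHom.id_apply, smul_eq_mul, ← integral_const_mul]
        simp [mul_left_comm] }
  have hg : g ∈ LinearMap.range f.dualMap := by
    rw [LinearMap.range_dualMap_eq_dualAnnihilator_ker, Submodule.mem_dualAnnihilator]
    intro q hq
    have h0 : f q q = 0 := by
      rw [LinearMap.mem_ker] at hq
      simp [hq]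
    have h1 := ae_eq_zero_of_integral_mul_self hS (hc q) h0
    change ∫ x in S, v x * q.1 x = 0
    refine integral_eq_zero_of_ae ?_
    filter_upwards [h1] with x hx
    simp [hx]
  obtain ⟨φ, hφ⟩ := hg
  let p := (Module.evalEquiv ℝ (Q1Poly d)).symm φ
  have hp : φ = Module.Dual.eval ℝ (Q1Poly d) p :=
    ((Module.evalEquiv ℝ (Q1Poly d)).apply_symm_apply φ).symm
  refine ⟨p.1, p.2, fun q hq => ?_⟩
  have h2 := LinearMap.congr_fun hφ ⟨q, hq⟩
  rw [hp] at h2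
  refine Eq.trans ?_ h2
  change _ = ∫ x in S, q x * p.1 x
  simp only [mul_comm]

theorem isL2Proj_l2Proj (hS : IsCompact S) (hv : Continuous v) : IsL2Proj S v (l2Proj S v) :=
  Classical.epsilon_spec (exists_isL2Proj hS hv)

theorem IsL2Proj.ae_eq (hS : IsCompact S) (h : IsL2Proj S v p) (h' : IsL2Proj S v p') :
    ∀ᵐ x ∂volume.restrict S, p x = p' x := by
  have hsub := Submodule.sub_mem _ h.1 h'.1
  have hc := (contDiff_of_mem_Q1Poly h.1).continuous
  have hc' := (contDiff_of_mem_Q1Poly h'.1).continuous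
  have h0 : ∫ x in S, (p - p') x * (p - p') x = 0 := by
    have e : ∀ x, (p - p') x * (p - p') x = p x * (p - p') x - p' x * (p - p') x := fun x => by
      simp [sub_mul]
    simp only [e]
    rw [integral_sub (integrableOn_mul_of_continuous hS hc (hc.sub hc'))
      (integrableOn_mul_of_continuous hS hc' (hc.sub hc')), h.2 _ hsub, h'.2 _ hsub, sub_self]
  filter_upwards [ae_eq_zero_of_integral_mul_self hS (hc.sub hc') h0] with x hx
  exact sub_eq_zero.1 hx

theorem IsL2Proj.add (hS : IsCompact S) (hu : Continuous u) (hv : Continuous v)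
    (h : IsL2Proj S u p) (h' : IsL2Proj S v p') : IsL2Proj S (u + v) (p + p') := by
  refine ⟨Submodule.add_mem _ h.1 h'.1, fun q hq => ?_⟩
  have hc := (contDiff_of_mem_Q1Poly h.1).continuous
  have hc' := (contDiff_of_mem_Q1Poly h'.1).continuous
  have hq' := (contDiff_of_mem_Q1Poly hq).continuous
  simp only [Pi.add_apply, add_mul]
  rw [integral_add (integrableOn_mul_of_continuous hS hc hq')
    (integrableOn_mul_of_continuous hS hc' hq'), h.2 q hq, h'.2 q hq,
    integral_add (integrableOn_mul_of_continuous hS hu hq')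
    (integrableOn_mul_of_continuous hS hv hq')]

theorem IsL2Proj.smul (c : ℝ) (h : IsL2Proj S u p) : IsL2Proj S (c • u) (c • p) := by
  refine ⟨Submodule.smul_mem _ c h.1, fun q hq => ?_⟩
  simp only [Pi.smul_apply, smul_eq_mul, mul_assoc]
  rw [integral_const_mul, integral_const_mul, h.2 q hq]

theorem IsL2Proj.translate (a : Fin d → ℝ) (h : IsL2Proj S u p) :
    IsL2Proj ((fun x => x - a) ⁻¹' S) (fun x => u (x - a)) (fun x => p (x - a)) := by
  refine ⟨Q1Poly_translate a h.1, fun q hq => ?_⟩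
  have hq' : (fun x => q (x + a)) ∈ Q1Poly d := by
    have := Q1Poly_translate (-a) hq
    simpa using this
  have h1 : ∀ w : (Fin d → ℝ) → ℝ, ∫ x in (fun x => x - a) ⁻¹' S, w (x - a) * q x =
      ∫ x in S, w x * q (x + a) := by
    intro w
    have := (measurePreserving_sub_right (volume : Measure (Fin d → ℝ)) a).setIntegral_preimage_emb
      (MeasurableEquiv.subRight a).measurableEmbedding (fun x => w x * q (x + a)) S
    simpa using this
  rw [h1, h1]
  exact h.2 _ hq'

theorem IsL2Proj.zero_of_eqOn (hS : MeasurableSet S) (h : ∀ x ∈ S, u x = 0) : IsL2Proj S u 0 := by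
  refine ⟨Submodule.zero_mem _, fun q _ => ?_⟩
  refine setIntegral_congr_fun hS fun x hx => ?_
  simp [h x hx]

end Q1

namespace CartesianMesh

variable {d : ℕ} {T : CartesianMesh d} {q : Fin d → ℕ} {u v p : (Fin d → ℝ) → ℝ}

/-- Projections are unique only almost everywhere, but nodal averages evaluate them at vertices;
continuity up to the boundary of the cell closes the gap. -/
theorem l2Proj_cell_eqOn (hT : 0 < T.size) (hv : Continuous v) (h : IsL2Proj (T.cell q) v p) :
    Set.EqOn (l2Proj (T.cell q) v) p (T.cell q) := by
  have h' := isL2Proj_l2Proj (isCompact_cell (T := T) (q := q)) hv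
  refine eqOn_cell_of_eqOn_openCell hT (contDiff_of_mem_Q1Poly h'.1).continuous
    (contDiff_of_mem_Q1Poly h.1).continuous ?_
  have hae := h'.ae_eq isCompact_cell h
  rw [← Measure.restrict_congr_set openCell_ae_eq_cell] at hae
  exact Measure.eqOn_open_of_ae_eq hae isOpen_openCell
    (contDiff_of_mem_Q1Poly h'.1).continuous.continuousOn
    (contDiff_of_mem_Q1Poly h.1).continuous.continuousOn

/-- The nodal values of the quasi-interpolation. -/
def quasiValue (T : CartesianMesh d) (v : (Fin d → ℝ) → ℝ) (z : Fin d → ℕ) : ℝ :=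
  T.nodeAverage (fun q => l2Proj (T.cell q) v) z

/-- Frees the nodal values from the arbitrary choice in `l2Proj`; linearity and translation
invariance follow by exhibiting suitable projections. -/
theorem quasiValue_congr {P : (Fin d → ℕ) → (Fin d → ℝ) → ℝ} {z : Fin d → ℕ} (hT : 0 < T.size)
    (hv : Continuous v) (hP : ∀ q ∈ T.elemsAt z, IsL2Proj (T.cell q) v (P q)) :
    T.quasiValue v z = ∑ q ∈ T.elemsAt z, P q (T.node z) * (1 / ((T.elemsAt z).card : ℝ)) := by
  refine Finset.sum_congr rfl fun q hq => ?_
  beta_reduce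
  rw [l2Proj_cell_eqOn hT hv (hP q hq)]
  simp only [elemsAt, Finset.mem_filter] at hq
  exact hq.2

theorem quasiValue_add (hT : 0 < T.size) (hu : Continuous u) (hv : Continuous v) (z : Fin d → ℕ) :
    T.quasiValue (u + v) z = T.quasiValue u z + T.quasiValue v z := by
  rw [quasiValue_congr hT (hu.add hv) fun q _ => (isL2Proj_l2Proj isCompact_cell hu).add
    isCompact_cell hu hv (isL2Proj_l2Proj isCompact_cell hv), quasiValue, quasiValue, nodeAverage,
    nodeAverage, ← Finset.sum_add_distrib]
  simp [add_mul]

theorem quasiValue_smul (hT : 0 < T.size) (c : ℝ) (hu : Continuous u) (z : Fin d → ℕ) :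
    T.quasiValue (c • u) z = c * T.quasiValue u z := by
  rw [quasiValue_congr hT (hu.const_smul c) fun q _ => (isL2Proj_l2Proj isCompact_cell hu).smul c,
    quasiValue, nodeAverage, Finset.mul_sum]
  simp [mul_assoc]

theorem hat_node (hT : 0 < T.size) (z z' : Fin d → ℕ) :
    T.hat z (T.node z') = if z = z' then 1 else 0 := by
  split_ifs with h
  · simp [hat, h]
  · obtain ⟨i, hi⟩ := Function.ne_iff.1 h
    refine Finset.prod_eq_zero (Finset.mem_univ i) (max_eq_left ?_)
    have e : T.node z' i - T.node z i = ((z' i : ℤ) - z i : ℤ) * T.size := by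
      simp only [node]
      push_cast
      ring
    rw [e, abs_mul, abs_of_pos hT, mul_div_cancel_right₀ _ hT.ne', sub_nonpos, ← Int.cast_abs]
    have : 1 ≤ |(z' i : ℤ) - z i| := Int.one_le_abs (by omega)
    exact_mod_cast this

theorem quasiInterp_eq_zero_iff (hT : 0 < T.size) (v : (Fin d → ℝ) → ℝ) :
    T.quasiInterp v = 0 ↔ ∀ z ∈ T.innerNodes, T.quasiValue v z = 0 := by
  constructor
  · intro h z hz
    have := congrFun h (T.node z)
    simp only [quasiInterp, hat_node hT, mul_ite, mul_one, mul_zero, Finset.sum_ite_eq', if_pos hz,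
      Pi.zero_apply] at this
    exact this
  · intro h
    funext x
    exact Finset.sum_eq_zero fun z hz => by
      rw [← quasiValue, h z hz, zero_mul]

theorem tsupport_subset_iff {S : Set (Fin d → ℝ)} (hS : IsClosed S) :
    tsupport v ⊆ S ↔ ∀ x, x ∉ S → v x = 0 := by
  constructor
  · intro h x hx
    by_contra hne
    exact hx (h (subset_tsupport v hne))
  · intro h
    refine closure_minimal (fun x hx => ?_) hS
    by_contra hne
    exact hx (h x hne)

/-- The local fine-scale space as a subspace. -/
def fineSubmodule (T Th : CartesianMesh d) (hT : 0 < T.size) {S : Set (Fin d → ℝ)}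
    (hS : IsClosed S) : Submodule ℝ ((Fin d → ℝ) → ℝ) where
  carrier := T.fineSpace Th S
  zero_mem' := by
    refine ⟨⟨continuous_const, fun q _ => ⟨0, Submodule.zero_mem _, fun _ _ => rfl⟩,
      fun _ _ => rfl⟩, ?_, by rw [tsupport_subset_iff hS]; exact fun _ _ => rfl⟩
    rw [quasiInterp_eq_zero_iff hT]
    intro z _
    have := quasiValue_smul hT 0 (continuous_const : Continuous fun _ : Fin d → ℝ => (0 : ℝ)) z
    rw [zero_smul, zero_mul] at this
    exact this
  add_mem' := by
    rintro u v ⟨⟨u1, u2, u3⟩, u4, u5⟩ ⟨⟨v1, v2, v3⟩, v4, v5⟩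
    rw [quasiInterp_eq_zero_iff hT] at u4 v4
    rw [tsupport_subset_iff hS] at u5 v5
    refine ⟨⟨u1.add v1, fun q hq => ?_, fun x hx => ?_⟩, ?_, ?_⟩
    · obtain ⟨p, hp, hp'⟩ := u2 q hq
      obtain ⟨p', hp2, hp2'⟩ := v2 q hq
      exact ⟨p + p', Submodule.add_mem _ hp hp2, fun x hx => by
        rw [Pi.add_apply, Pi.add_apply, hp' hx, hp2' hx]⟩
    · rw [Pi.add_apply, u3 x hx, v3 x hx, add_zero]
    · rw [quasiInterp_eq_zero_iff hT]
      intro z hz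
      rw [quasiValue_add hT u1 v1, u4 z hz, v4 z hz, add_zero]
    · rw [tsupport_subset_iff hS]
      intro x hx
      rw [Pi.add_apply, u5 x hx, v5 x hx, add_zero]
  smul_mem' := by
    rintro c u ⟨⟨u1, u2, u3⟩, u4, u5⟩
    rw [quasiInterp_eq_zero_iff hT] at u4
    rw [tsupport_subset_iff hS] at u5
    refine ⟨⟨u1.const_smul c, fun q hq => ?_, fun x hx => ?_⟩, ?_, ?_⟩
    · obtain ⟨p, hp, hp'⟩ := u2 q hq
      exact ⟨c • p, Submodule.smul_mem _ c hp, fun x hx => by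
        rw [Pi.smul_apply, Pi.smul_apply, hp' hx]⟩
    · rw [Pi.smul_apply, u3 x hx, smul_zero]
    · rw [quasiInterp_eq_zero_iff hT]
      intro z hz
      rw [quasiValue_smul hT c u1, u4 z hz, mul_zero]
    · rw [tsupport_subset_iff hS]
      intro x hx
      rw [Pi.smul_apply, u5 x hx, smul_zero]

end CartesianMesh

end
-- Finite elements on a box of cells
noncomputable section

namespace CartesianMesh

variable {d : ℕ} {T : CartesianMesh d} {lo hi q : Fin d → ℕ} {u v w p : (Fin d → ℝ) → ℝ}

/-- Continuous functions supported in a box of elements which are polynomials of coordinate degree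
at most one on each of these elements. -/
def boxSpace (T : CartesianMesh d) (lo hi : Fin d → ℕ) : Submodule ℝ ((Fin d → ℝ) → ℝ) where
  carrier := {u | Continuous u ∧ (∀ q ∈ boxElems lo hi, ∃ p ∈ Q1Poly d, Set.EqOn u p (T.cell q)) ∧
    ∀ x, x ∉ T.box lo hi → u x = 0}
  zero_mem' := ⟨continuous_const, fun _ _ => ⟨0, Submodule.zero_mem _, fun _ _ => rfl⟩,
    fun _ _ => rfl⟩
  add_mem' := by
    rintro u v ⟨u1, u2, u3⟩ ⟨v1, v2, v3⟩
    refine ⟨u1.add v1, fun q hq => ?_, fun x hx => ?_⟩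
    · obtain ⟨p, hp, hp'⟩ := u2 q hq
      obtain ⟨p', hp2, hp2'⟩ := v2 q hq
      exact ⟨p + p', Submodule.add_mem _ hp hp2, fun x hx => by
        rw [Pi.add_apply, Pi.add_apply, hp' hx, hp2' hx]⟩
    · rw [Pi.add_apply, u3 x hx, v3 x hx, add_zero]
  smul_mem' := by
    rintro c u ⟨u1, u2, u3⟩
    refine ⟨u1.const_smul c, fun q hq => ?_, fun x hx => ?_⟩
    · obtain ⟨p, hp, hp'⟩ := u2 q hq
      exact ⟨c • p, Submodule.smul_mem _ c hp, fun x hx => by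
        rw [Pi.smul_apply, Pi.smul_apply, hp' hx]⟩
    · rw [Pi.smul_apply, u3 x hx, smul_zero]

theorem mem_boxSpace : u ∈ T.boxSpace lo hi ↔ Continuous u ∧
    (∀ q ∈ boxElems lo hi, ∃ p ∈ Q1Poly d, Set.EqOn u p (T.cell q)) ∧
    ∀ x, x ∉ T.box lo hi → u x = 0 := Iff.rfl

theorem eq_zero_on_cell (hT : 0 < T.size) (hu : Continuous u)
    (h0 : ∀ x, x ∉ T.box lo hi → u x = 0) (hq : q ∉ boxElems lo hi) : ∀ x ∈ T.cell q, u x = 0 :=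
  eqOn_cell_of_eqOn_openCell hT hu (continuous_const (y := (0 : ℝ)))
    fun x hx => h0 x fun hx' => Set.disjoint_left.1 (openCell_disjoint_box hT hq) hx hx'

theorem eventuallyEq_of_mem_openCell (h : Set.EqOn u p (T.cell q)) {x : Fin d → ℝ}
    (hx : x ∈ T.openCell q) : u =ᶠ[nhds x] p := by
  filter_upwards [isOpen_openCell.mem_nhds hx] with y hy using h (openCell_subset_cell hy)

/-- On each open cell the function is a polynomial with bounded gradient, and the faces are null
sets. -/
theorem boxSpace_le_regularOn (hT : 0 < T.size) (hlt : ∀ i, lo i < hi i) :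
    T.boxSpace lo hi ≤ regularOn (T.box lo hi) := by
  rintro u ⟨-, h, -⟩
  have h1 : ∀ q : boxElems lo hi, ∃ C : ℝ, 0 ≤ C ∧ ∀ x ∈ T.openCell q,
      DifferentiableAt ℝ u x ∧ ‖fderiv ℝ u x‖ ≤ C := by
    rintro ⟨q, hq⟩
    obtain ⟨p, hp, hp'⟩ := h q hq
    have hd := contDiff_of_mem_Q1Poly hp
    obtain ⟨C, hC⟩ := (isCompact_cell (T := T) (q := q)).exists_bound_of_continuousOn
      (hd.continuous_fderiv one_ne_zero).continuousOn
    refine ⟨max C 0, le_max_right _ _, fun x hx => ?_⟩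
    have he := eventuallyEq_of_mem_openCell hp' hx
    refine ⟨he.differentiableAt_iff.2 (hd.differentiable one_ne_zero x), ?_⟩
    rw [he.fderiv_eq]
    exact (hC x (openCell_subset_cell hx)).trans (le_max_left _ _)
  choose C hC0 hC using h1
  refine ⟨∑ q, C q, ae_restrict_box hT hlt fun q hq => ?_⟩
  refine (ae_restrict_iff' isOpen_openCell.measurableSet).2 (Filter.Eventually.of_forall fun x hx => ?_)
  refine ⟨(hC ⟨q, hq⟩ x hx).1, (hC ⟨q, hq⟩ x hx).2.trans ?_⟩
  exact Finset.single_le_sum (fun q _ => hC0 q) (Finset.mem_univ (⟨q, hq⟩ : boxElems lo hi))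

theorem isPreconnected_openCell : IsPreconnected (T.openCell q) :=
  isPreconnected_univ_pi fun _ => isPreconnected_Ioo

/-- The gradient of the polynomial is continuous, so vanishing almost everywhere means vanishing on
the whole connected open cell. -/
theorem exists_const_on_cell (hT : 0 < T.size) (hu : Continuous u) (hp : p ∈ Q1Poly d)
    (hup : Set.EqOn u p (T.cell q))
    (h : ∀ᵐ x ∂volume.restrict (T.openCell q), gradDot u u x = 0) :
    ∃ c : ℝ, ∀ x ∈ T.cell q, u x = c := by
  have hd := contDiff_of_mem_Q1Poly hp
  have hgrad : ∀ x ∈ T.openCell q, gradDot u u x = gradDot p p x := by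
    intro x hx
    simp only [gradDot, (eventuallyEq_of_mem_openCell hup hx).fderiv_eq]
  have hc : Continuous (gradDot p p) := by
    have := hd.continuous_fderiv one_ne_zero
    unfold gradDot
    fun_prop
  have h0 : Set.EqOn (gradDot p p) (fun _ => 0) (T.openCell q) := by
    refine Measure.eqOn_open_of_ae_eq (μ := volume) ?_ isOpen_openCell hc.continuousOn
      continuousOn_const
    filter_upwards [h, ae_restrict_mem isOpen_openCell.measurableSet] with x hx hx'
    rw [← hgrad x hx', hx]
  have hfd : Set.EqOn (fderiv ℝ p) 0 (T.openCell q) := by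
    intro x hx
    have h1 := h0 hx
    simp only [gradDot] at h1
    rw [Finset.sum_eq_zero_iff_of_nonneg fun i _ => mul_self_nonneg _] at h1
    ext e
    rw [← Finset.univ_sum_single e, map_sum]
    simp only [Pi.zero_apply, zero_apply]
    refine Finset.sum_eq_zero fun i hi => ?_
    have h2 := mul_self_eq_zero.1 (h1 i hi)
    have e2 : (Pi.single i (e i) : Fin d → ℝ) = e i • Pi.single i 1 := by
      rw [← Pi.single_smul, smul_eq_mul, mul_one]
    rw [e2, map_smul, h2, smul_zero]
  obtain ⟨c, hc⟩ := isOpen_openCell.exists_is_const_of_fderiv_eq_zero isPreconnected_openCell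
    (hd.differentiable one_ne_zero).differentiableOn hfd
  refine ⟨c, eqOn_cell_of_eqOn_openCell hT hu continuous_const fun x hx => ?_⟩
  rw [hup (openCell_subset_cell hx), hc x hx]

/-- Definiteness of the Dirichlet form. -/
theorem eq_zero_of_dirichlet_eq_zero (hd : 0 < d) (hT : 0 < T.size) (hlt : ∀ i, lo i < hi i)
    (hu : u ∈ T.boxSpace lo hi) (h : dirichlet (T.box lo hi) u u = 0) : u = 0 := by
  have hreg := boxSpace_le_regularOn hT hlt hu
  rw [dirichlet, integral_eq_zero_iff_of_nonneg
    (fun x => gradDot_self_nonneg u x)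
    (integrableOn_gradDot volume_box_lt_top hreg hreg)] at h
  have h1 : ∀ q : boxElems lo hi, ∃ c : ℝ, ∀ x ∈ T.cell q, u x = c := by
    rintro ⟨q, hq⟩
    obtain ⟨p, hp, hp'⟩ := hu.2.1 q hq
    refine exists_const_on_cell hT hu.1 hp hp' ?_
    exact ae_restrict_of_ae_restrict_of_subset
      (openCell_subset_cell.trans (cell_subset_box hT hq)) h
  choose c hc using h1
  -- A continuous function with finite range on the connected space `ℝ^d` is constant; this replaces
  -- the comparison of neighbouring cells.
  have hfin : (Set.range u).Finite := by
    refine ((Set.finite_range c).insert 0).subset ?_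
    rintro _ ⟨x, rfl⟩
    by_cases hx : x ∈ T.box lo hi
    · rw [box_eq_biUnion_cell hT hlt] at hx
      obtain ⟨q, hq, hx⟩ := Set.mem_iUnion₂.1 hx
      exact Or.inr ⟨⟨q, hq⟩, (hc ⟨q, hq⟩ x hx).symm⟩
    · exact Or.inl (hu.2.2 x hx)
  have hsub : (Set.range u).Subsingleton := by
    rw [← Set.not_nontrivial_iff]
    intro hn
    exact (isPreconnected_range hu.1).infinite_of_nontrivial hn hfin
  funext x
  -- A point outside the box, where the constant is `0`; it exists only because `d > 0`.
  have hout : T.node hi + 1 ∉ T.box lo hi := by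
    intro hmem
    have := hmem.2 ⟨0, hd⟩
    simp only [Pi.add_apply, Pi.one_apply] at this
    linarith
  rw [Pi.zero_apply, ← hu.2.2 _ hout]
  exact hsub ⟨x, rfl⟩ ⟨_, rfl⟩

/-- The restriction of the functions in the box space to the elements of the box. -/
def boxRestrict (T : CartesianMesh d) (lo hi : Fin d → ℕ) : T.boxSpace lo hi →ₗ[ℝ]
    ((q : boxElems lo hi) → (Q1Poly d).map (LinearMap.funLeft ℝ ℝ
      (Subtype.val : T.cell q → (Fin d → ℝ)))) :=
  LinearMap.pi fun q => LinearMap.codRestrict _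
    ((LinearMap.funLeft ℝ ℝ (Subtype.val : T.cell q → (Fin d → ℝ))).comp
      (T.boxSpace lo hi).subtype) fun u => by
    obtain ⟨p, hp, hp'⟩ := u.2.2.1 q q.2
    refine ⟨p, hp, ?_⟩
    funext x
    exact (hp' x.2).symm

theorem boxRestrict_injective (hT : 0 < T.size) (hlt : ∀ i, lo i < hi i) :
    Function.Injective (T.boxRestrict lo hi) := by
  rw [← LinearMap.ker_eq_bot, LinearMap.ker_eq_bot']
  rintro ⟨u, hu⟩ h
  ext x
  change u x = 0
  by_cases hx : x ∈ T.box lo hi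
  · rw [box_eq_biUnion_cell hT hlt] at hx
    obtain ⟨q, hq, hx⟩ := Set.mem_iUnion₂.1 hx
    exact congrFun (congrArg Subtype.val (congrFun h ⟨q, hq⟩)) ⟨x, hx⟩
  · exact hu.2.2 x hx

theorem finiteDimensional_boxSpace (hT : 0 < T.size) (hlt : ∀ i, lo i < hi i) :
    FiniteDimensional ℝ (T.boxSpace lo hi) :=
  Module.Finite.of_injective _ (boxRestrict_injective hT hlt)

/-- Counting polynomials on cells instead of nodes loses only a constant depending on `d`. -/
theorem finrank_boxSpace_le (hT : 0 < T.size) (hlt : ∀ i, lo i < hi i) :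
    Module.finrank ℝ (T.boxSpace lo hi) ≤ (boxElems lo hi).card * 2 ^ d := by
  refine (LinearMap.finrank_le_finrank_of_injective (boxRestrict_injective hT hlt)).trans ?_
  rw [Module.finrank_pi_fintype]
  refine (Finset.sum_le_card_nsmul _ _ (2 ^ d) fun q _ => ?_).trans (by simp)
  exact (Submodule.finrank_map_le _ _).trans finrank_Q1Poly_le

/-! ### Translations -/

section Translate

variable {k k' q' lo' hi' : Fin d → ℕ}

/-- The relation `q' + k = q + k'` expresses a shift of indices by `k' - k` without subtraction in
`ℕ`; all translation lemmas use this form. -/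
theorem node_sub (h : q' + k = q + k') : T.node q' - (T.node k' - T.node k) = T.node q := by
  funext i
  have h1 : (q' i : ℝ) + k i = q i + k' i := by exact_mod_cast congrFun h i
  simp only [node, Pi.sub_apply]
  have h2 : (q' i : ℝ) = q i + k' i - k i := by linarith
  rw [h2]
  ring

theorem preimage_box (hlo : lo' + k = lo + k') (hhi : hi' + k = hi + k') :
    (fun x => x - (T.node k' - T.node k)) ⁻¹' T.box lo hi = T.box lo' hi' := by
  rw [box, box, ← node_sub hlo, ← node_sub hhi]
  ext x
  simp

theorem preimage_cell (h : q' + k = q + k') :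
    (fun x => x - (T.node k' - T.node k)) ⁻¹' T.cell q = T.cell q' := by
  rw [cell_eq_box, cell_eq_box]
  refine preimage_box h ?_
  rw [add_right_comm, h, add_right_comm]

theorem hat_translate (h : q' + k = q + k') (x : Fin d → ℝ) :
    T.hat q' x = T.hat q (x - (T.node k' - T.node k)) := by
  rw [hat, hat, ← node_sub h]
  simp

theorem translate_mem_boxSpace (hlo : lo' + k = lo + k') (hhi : hi' + k = hi + k')
    (hu : u ∈ T.boxSpace lo hi) :
    (fun x => u (x - (T.node k' - T.node k))) ∈ T.boxSpace lo' hi' := by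
  refine ⟨hu.1.comp (continuous_id.sub continuous_const), fun q' hq' => ?_, fun x hx => ?_⟩
  · rw [mem_boxElems] at hq'
    have hq : (fun i => q' i - lo' i + lo i) ∈ boxElems lo hi := by
      rw [mem_boxElems]
      intro i
      have := hq' i
      have h1 := congrFun hlo i
      have h2 := congrFun hhi i
      simp only [Pi.add_apply] at h1 h2
      omega
    have hqq : q' + k = (fun i => q' i - lo' i + lo i) + k' := by
      funext i
      have := hq' i
      have h1 := congrFun hlo i
      simp only [Pi.add_apply] at h1 ⊢
      omega
    obtain ⟨p, hp, hp'⟩ := hu.2.1 _ hq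
    refine ⟨_, Q1Poly_translate (T.node k' - T.node k) hp, fun x hx => hp' ?_⟩
    rw [← preimage_cell hqq] at hx
    exact hx
  · refine hu.2.2 _ fun hx' => hx ?_
    rw [← preimage_box hlo hhi]
    exact hx'

/-- An inner node has the full stencil of `2 ^ d` cells. This makes the averaging weights
independent of the position. -/
theorem elemsAt_eq_image {z : Fin d → ℕ} (hT : 0 < T.size) (hz : z ∈ T.innerNodes) :
    T.elemsAt z = Finset.univ.image fun (e : Fin d → Fin 2) i => z i - 1 + (e i : ℕ) := by
  simp only [innerNodes, Fintype.mem_piFinset, Finset.mem_Ioo] at hz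
  ext q
  simp only [elemsAt, Finset.mem_filter, Finset.mem_image, Finset.mem_univ, true_and]
  constructor
  · rintro ⟨-, h⟩
    rw [mem_cell] at h
    have hq : ∀ i, q i ≤ z i ∧ z i ≤ q i + 1 := by
      intro i
      have h1 := h i
      simp only [node, add_le_add_iff_left, mul_le_mul_iff_left₀ hT] at h1
      exact_mod_cast h1
    refine ⟨fun i => ⟨q i - (z i - 1), by have := hq i; have := hz i; omega⟩, funext fun i => ?_⟩
    have := hq i
    have := hz i
    simp only
    omega
  · rintro ⟨e, rfl⟩
    constructor
    · simp only [elems, Fintype.mem_piFinset, Finset.mem_range]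
      intro i
      have := hz i
      have := (e i).2
      omega
    · rw [mem_cell]
      intro i
      simp only [node, add_le_add_iff_left, mul_le_mul_iff_left₀ hT]
      have := hz i
      have := (e i).2
      constructor
      · exact_mod_cast (by omega : z i - 1 + (e i : ℕ) ≤ z i)
      · exact_mod_cast (by omega : z i ≤ z i - 1 + (e i : ℕ) + 1)

theorem quasiValue_eq_sum {z : Fin d → ℕ} (hT : 0 < T.size) (hz : z ∈ T.innerNodes) :
    T.quasiValue v z = ∑ e : Fin d → Fin 2,
      l2Proj (T.cell fun i => z i - 1 + (e i : ℕ)) v (T.node z) * (1 / ((2 ^ d : ℕ) : ℝ)) := by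
  have hinj : Function.Injective fun (e : Fin d → Fin 2) i => z i - 1 + (e i : ℕ) := by
    intro e e' h
    funext i
    have := congrFun h i
    simp only at this
    exact Fin.ext (by omega)
  rw [quasiValue, nodeAverage, elemsAt_eq_image hT hz, Finset.sum_image hinj.injOn,
    Finset.card_image_of_injective _ hinj]
  simp

theorem quasiValue_translate {z z' : Fin d → ℕ} (hT : 0 < T.size) (hz : z ∈ T.innerNodes)
    (hz' : z' ∈ T.innerNodes) (h : z' + k = z + k') (hv : Continuous v) :
    T.quasiValue (fun x => v (x - (T.node k' - T.node k))) z' = T.quasiValue v z := by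
  rw [quasiValue_eq_sum hT hz, quasiValue_eq_sum hT hz']
  simp only [innerNodes, Fintype.mem_piFinset, Finset.mem_Ioo] at hz hz'
  refine Finset.sum_congr rfl fun e _ => ?_
  have hq : (fun i => z' i - 1 + (e i : ℕ)) + k = (fun i => z i - 1 + (e i : ℕ)) + k' := by
    funext i
    have h1 := congrFun h i
    have := hz i
    have := hz' i
    simp only [Pi.add_apply] at h1 ⊢
    omega
  have hp := (isL2Proj_l2Proj (isCompact_cell (T := T) (q := fun i => z i - 1 + (e i : ℕ)))
    hv).translate (T.node k' - T.node k)
  rw [preimage_cell hq] at hp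
  have hv' : Continuous fun x => v (x - (T.node k' - T.node k)) := by fun_prop
  rw [l2Proj_cell_eqOn hT hv' hp]
  · beta_reduce
    rw [node_sub h]
  rw [mem_cell]
  intro i
  have := hz' i
  have := (e i).2
  simp only [node, add_le_add_iff_left, mul_le_mul_iff_left₀ hT]
  constructor
  · exact_mod_cast (by omega : z' i - 1 + (e i : ℕ) ≤ z' i)
  · exact_mod_cast (by omega : z' i ≤ z' i - 1 + (e i : ℕ) + 1)

end Translate

end CartesianMesh

end
-- The fine-scale space and the energy on an inner patch
noncomputable section

/-- Orthonormal bases for a definite symmetric bilinear form on a finite-dimensional subspace. -/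
theorem exists_orthonormal_family {E : Type*} [AddCommGroup E] [Module ℝ E] (V : Submodule ℝ E)
    [FiniteDimensional ℝ V] (f : E → E → ℝ) (hsymm : ∀ u ∈ V, ∀ v ∈ V, f u v = f v u)
    (hnonneg : ∀ u ∈ V, 0 ≤ f u u) (hdef : ∀ u ∈ V, f u u = 0 → u = 0)
    (hadd : ∀ u ∈ V, ∀ v ∈ V, ∀ w ∈ V, f (u + v) w = f u w + f v w)
    (hsmul : ∀ (c : ℝ), ∀ u ∈ V, ∀ v ∈ V, f (c • u) v = c * f u v) :
    ∃ φ : Fin (Module.finrank ℝ V) → E, (∀ p, φ p ∈ V) ∧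
      (∀ w ∈ V, ∃ y : Fin (Module.finrank ℝ V) → ℝ, w = ∑ p, y p • φ p) ∧
      ∀ p q, f (φ p) (φ q) = if p = q then 1 else 0 := by
  let core : InnerProductSpace.Core ℝ V :=
    { inner := fun u v => f u v
      conj_inner_symm := fun u v => hsymm v v.2 u u.2
      re_inner_nonneg := fun u => hnonneg u u.2
      definite := fun u h => Subtype.ext (hdef u u.2 h)
      add_left := fun u v w => hadd u u.2 v v.2 w w.2
      smul_left := fun u v c => hsmul c u u.2 v v.2 }
  let _ : NormedAddCommGroup V := core.toNormedAddCommGroup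
  let _ : InnerProductSpace ℝ V := InnerProductSpace.ofCore core.toCore
  let b := stdOrthonormalBasis ℝ V
  refine ⟨fun p => b p, fun p => (b p).2, fun w hw => ⟨fun p => b.repr ⟨w, hw⟩ p, ?_⟩, fun p q => ?_⟩
  · have h := congrArg (Subtype.val) (b.sum_repr ⟨w, hw⟩)
    simpa using h.symm
  · have := orthonormal_iff_ite.1 b.orthonormal p q
    exact this

namespace CartesianMesh

variable {d : ℕ} {T : CartesianMesh d} {r s ℓ : ℕ} {K K' : Fin d → ℕ}

def patchLo (ℓ : ℕ) (K : Fin d → ℕ) : Fin d → ℕ := fun i => K i - ℓ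

def patchHi (ℓ : ℕ) (K : Fin d → ℕ) : Fin d → ℕ := fun i => K i + 1 + ℓ

theorem patchLo_lt_patchHi (ℓ : ℕ) (K : Fin d → ℕ) (i : Fin d) : patchLo ℓ K i < patchHi ℓ K i := by
  simp only [patchLo, patchHi]
  omega

theorem smul_patchLo_lt_patchHi {m : ℕ} (hm : m ≠ 0) (ℓ : ℕ) (K : Fin d → ℕ) (i : Fin d) :
    (m • patchLo ℓ K) i < (m • patchHi ℓ K) i :=
  Nat.mul_lt_mul_of_pos_left (patchLo_lt_patchHi ℓ K i) (Nat.pos_of_ne_zero hm)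

theorem IsInner.elemPatch_eq (hK : T.IsInner ℓ K) (hT : 0 < T.size) :
    T.elemPatch ℓ K = T.box (patchLo ℓ K) (patchHi ℓ K) :=
  elemPatch_eq_box hT ℓ fun i => by
    have := hK i
    omega

theorem IsInner.elemPatch_eq_refine (hK : T.IsInner ℓ K) (hT : 0 < T.size) (hr : r ≠ 0) :
    T.elemPatch ℓ K = (T.refine r).box (r • patchLo ℓ K) (r • patchHi ℓ K) := by
  rw [hK.elemPatch_eq hT, refine_box hr]

theorem IsInner.elemPatch_eq_refine_refine (hK : T.IsInner ℓ K) (hT : 0 < T.size) (hr : r ≠ 0)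
    (hs : s ≠ 0) : T.elemPatch ℓ K =
      ((T.refine r).refine s).box (s • r • patchLo ℓ K) (s • r • patchHi ℓ K) := by
  rw [hK.elemPatch_eq_refine hT hr, refine_box hs]

theorem IsInner.elemPatch_subset_domain (hK : T.IsInner ℓ K) (hT : 0 < T.size) :
    T.elemPatch ℓ K ⊆ T.domain := by
  rw [hK.elemPatch_eq hT]
  refine box_subset_domain hT (fun i => ?_) fun i => ?_ <;>
  · have := hK i
    simp only [patchLo, patchHi]
    omega

theorem IsInner.isClosed_elemPatch (hK : T.IsInner ℓ K) (hT : 0 < T.size) :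
    IsClosed (T.elemPatch ℓ K) := by
  rw [hK.elemPatch_eq hT]
  exact isClosed_Icc

theorem IsInner.cell_subset_elemPatch (hK : T.IsInner ℓ K) (hT : 0 < T.size) :
    T.cell K ⊆ T.elemPatch ℓ K := by
  rw [hK.elemPatch_eq hT]
  refine cell_subset_box hT (mem_boxElems.2 fun i => ?_)
  simp only [patchLo, patchHi]
  omega

/-- The layer beyond the `ℓ` layers of the patch is needed here: also the nodes on `∂ω` are inner
nodes, hence carry the same constraint for every position of `K`. -/
theorem IsInner.mem_innerNodes (hK : T.IsInner ℓ K) {z : Fin d → ℕ}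
    (hz : ∀ i, patchLo ℓ K i ≤ z i ∧ z i ≤ patchHi ℓ K i) : z ∈ T.innerNodes := by
  simp only [innerNodes, Fintype.mem_piFinset, Finset.mem_Ioo]
  intro i
  have := hz i
  have := hK i
  simp only [patchLo, patchHi] at *
  omega

theorem IsInner.mem_elems_of_mem_boxElems (hK : T.IsInner ℓ K) {m : ℕ} {M : CartesianMesh d}
    (hM : ∀ i, M.count i = m * T.count i) {q : Fin d → ℕ}
    (hq : q ∈ boxElems (m • patchLo ℓ K) (m • patchHi ℓ K)) : q ∈ M.elems := by
  simp only [elems, Fintype.mem_piFinset, Finset.mem_range]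
  intro i
  rw [hM]
  refine lt_of_lt_of_le (mem_boxElems.1 hq i).2 (Nat.mul_le_mul_left _ ?_)
  have := hK i
  simp only [patchHi]
  omega

/-- The local fine-scale space of an inner element is described by conditions that do not depend
on the position of the element. -/
theorem IsInner.mem_fineSpace_iff (hK : T.IsInner ℓ K) (hT : 0 < T.size) (hr : r ≠ 0) (hs : s ≠ 0)
    {w : (Fin d → ℝ) → ℝ} :
    w ∈ T.fineSpace ((T.refine r).refine s) (T.elemPatch ℓ K) ↔
      w ∈ ((T.refine r).refine s).boxSpace (s • r • patchLo ℓ K) (s • r • patchHi ℓ K) ∧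
      ∀ z, (∀ i, patchLo ℓ K i ≤ z i ∧ z i ≤ patchHi ℓ K i) → T.quasiValue w z = 0 := by
  have hTh := size_refine_pos hs (size_refine_pos hr hT)
  rw [fineSpace, Set.mem_ofPred_eq, tsupport_subset_iff (hK.isClosed_elemPatch hT),
    quasiInterp_eq_zero_iff hT, mem_boxSpace, ← hK.elemPatch_eq_refine_refine hT hr hs]
  constructor
  · rintro ⟨⟨h1, h2, -⟩, h3, h4⟩
    refine ⟨⟨h1, fun q hq => h2 q ?_, h4⟩, fun z hz => h3 z (hK.mem_innerNodes hz)⟩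
    rw [smul_smul] at hq
    rw [smul_smul] at hq
    exact hK.mem_elems_of_mem_boxElems (m := s * r) (fun i => by simp [refine, mul_assoc]) hq
  · rintro ⟨⟨h1, h2, h4⟩, h3⟩
    refine ⟨⟨h1, fun q _ => ?_, fun x hx => h4 x fun hx' =>
      hx ?_⟩, fun z hz => ?_, h4⟩
    · by_cases hq : q ∈ boxElems (s • r • patchLo ℓ K) (s • r • patchHi ℓ K)
      · exact h2 q hq
      · rw [hK.elemPatch_eq_refine_refine hT hr hs] at h4
        exact ⟨0, Submodule.zero_mem _, eq_zero_on_cell hTh h1 h4 hq⟩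
    · rw [refine_domain hs, refine_domain hr]
      exact hK.elemPatch_subset_domain hT hx'
    -- At a node outside the patch the constraint is automatic, since all cells at this node lie
    -- outside the patch and `w` vanishes on them.
    · by_cases hzK : ∀ i, patchLo ℓ K i ≤ z i ∧ z i ≤ patchHi ℓ K i
      · exact h3 z hzK
      · rw [hK.elemPatch_eq hT] at h4
        rw [quasiValue_congr hT h1 (P := fun _ => 0) fun q hq => ?_]
        · simp
        refine IsL2Proj.zero_of_eqOn measurableSet_cell (eq_zero_on_cell hT h1 h4 fun hq' => hzK ?_)
        simp only [elemsAt, Finset.mem_filter, mem_cell, node, add_le_add_iff_left,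
          mul_le_mul_iff_left₀ hT] at hq
        intro i
        have h5 : q i ≤ z i ∧ z i ≤ q i + 1 := by exact_mod_cast hq.2 i
        have := mem_boxElems.1 hq' i
        omega

theorem IsInner.patchLo_add (hK : T.IsInner ℓ K) (hK' : T.IsInner ℓ K') :
    patchLo ℓ K' + K = patchLo ℓ K + K' := by
  funext i
  have := hK i
  have := hK' i
  simp only [patchLo, Pi.add_apply]
  omega

theorem patchHi_add (ℓ : ℕ) (K K' : Fin d → ℕ) : patchHi ℓ K' + K = patchHi ℓ K + K' := by
  funext i
  simp only [patchHi, Pi.add_apply]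
  omega

theorem IsInner.translate_mem_fineSpace (hK : T.IsInner ℓ K) (hK' : T.IsInner ℓ K')
    (hT : 0 < T.size) (hr : r ≠ 0) (hs : s ≠ 0) {w : (Fin d → ℝ) → ℝ}
    (hw : w ∈ T.fineSpace ((T.refine r).refine s) (T.elemPatch ℓ K)) :
    (fun x => w (x - (T.node K' - T.node K))) ∈
      T.fineSpace ((T.refine r).refine s) (T.elemPatch ℓ K') := by
  rw [hK.mem_fineSpace_iff hT hr hs] at hw
  rw [hK'.mem_fineSpace_iff hT hr hs]
  constructor
  · rw [← refine_node hr K, ← refine_node hr K', ← refine_node hs (r • K),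
      ← refine_node hs (r • K')]
    refine translate_mem_boxSpace ?_ ?_ hw.1
    · rw [← smul_add, ← smul_add, hK.patchLo_add hK', smul_add, smul_add]
    · rw [← smul_add, ← smul_add, patchHi_add, smul_add, smul_add]
  · intro z' hz'
    have hzz : ∀ i, patchLo ℓ K i ≤ (z' - patchLo ℓ K' + patchLo ℓ K) i ∧
        (z' - patchLo ℓ K' + patchLo ℓ K) i ≤ patchHi ℓ K i := by
      intro i
      have := hz' i
      have := hK i
      have := hK' i
      simp only [patchLo, patchHi, Pi.add_apply, Pi.sub_apply] at *
      omega
    have hadd : z' + K = (z' - patchLo ℓ K' + patchLo ℓ K) + K' := by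
      funext i
      have := hz' i
      have := hK i
      have := hK' i
      simp only [patchLo, patchHi, Pi.add_apply, Pi.sub_apply] at *
      omega
    rw [quasiValue_translate hT (hK.mem_innerNodes hzz) (hK'.mem_innerNodes hz') hadd hw.1.1]
    exact hw.2 _ hzz

/-! ### The coefficient cells of a patch -/

/-- The elements of the coefficient mesh in the patch of an inner element. -/
def coeffCell (T : CartesianMesh d) (r ℓ : ℕ) (K : Fin d → ℕ) (t : Fin (((2 * ℓ + 1) * r) ^ d)) :
    Set (Fin d → ℝ) :=
  (T.refine r).cell fun a => (K a - ℓ) * r + (finFunctionFinEquiv.symm t a : ℕ)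

theorem boxElems_eq_image {lo hi : Fin d → ℕ} {n : ℕ} (h : ∀ i, hi i = lo i + n) :
    boxElems lo hi = Finset.univ.image fun (f : Fin d → Fin n) i => lo i + (f i : ℕ) := by
  ext q
  simp only [mem_boxElems, Finset.mem_image, Finset.mem_univ, true_and]
  constructor
  · intro hq
    refine ⟨fun i => ⟨q i - lo i, by have := hq i; have := h i; omega⟩, funext fun i => ?_⟩
    have := hq i
    simp only
    omega
  · rintro ⟨f, rfl⟩ i
    have := (f i).2
    have := h i
    beta_reduce
    omega

/-- Matches sums over cells with the enumeration used in `coeffVector`. -/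
theorem sum_boxElems {lo hi : Fin d → ℕ} {n : ℕ} (h : ∀ i, hi i = lo i + n)
    (F : (Fin d → ℕ) → ℝ) : ∑ q ∈ boxElems lo hi, F q =
      ∑ t : Fin (n ^ d), F fun i => lo i + (finFunctionFinEquiv.symm t i : ℕ) := by
  have hinj : Function.Injective fun (f : Fin d → Fin n) i => lo i + (f i : ℕ) := by
    intro f f' hf
    funext i
    have := congrFun hf i
    simp only at this
    exact Fin.ext (by omega)
  rw [boxElems_eq_image h, Finset.sum_image hinj.injOn]
  exact (Equiv.sum_comp finFunctionFinEquiv.symm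
    fun f : Fin d → Fin n => F fun i => lo i + (f i : ℕ)).symm

theorem card_boxElems {lo hi : Fin d → ℕ} {n : ℕ} (h : ∀ i, hi i = lo i + n) :
    (boxElems lo hi).card = n ^ d := by
  simp [boxElems, Fintype.card_piFinset, h]

theorem IsInner.smul_patchHi_eq (hK : T.IsInner ℓ K) (m : ℕ) (i : Fin d) :
    (m • patchHi ℓ K) i = (m • patchLo ℓ K) i + (2 * ℓ + 1) * m := by
  have : patchHi ℓ K i = patchLo ℓ K i + (2 * ℓ + 1) := by
    have := hK i
    simp only [patchHi, patchLo]
    omega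
  simp only [Pi.smul_apply, smul_eq_mul, this]
  ring

theorem IsInner.sum_coeffCell (hK : T.IsInner ℓ K) (F : Set (Fin d → ℝ) → ℝ) :
    ∑ q ∈ boxElems (r • patchLo ℓ K) (r • patchHi ℓ K), F ((T.refine r).cell q) =
      ∑ t, F (T.coeffCell r ℓ K t) := by
  rw [sum_boxElems (hK.smul_patchHi_eq r)]
  simp only [coeffCell, patchLo, Pi.smul_apply, smul_eq_mul, mul_comm r]

theorem IsInner.coeffCell_index_mem (hK : T.IsInner ℓ K) (t : Fin (((2 * ℓ + 1) * r) ^ d)) :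
    (fun a => (K a - ℓ) * r + (finFunctionFinEquiv.symm t a : ℕ)) ∈
      boxElems (r • patchLo ℓ K) (r • patchHi ℓ K) := by
  rw [boxElems_eq_image (hK.smul_patchHi_eq r), Finset.mem_image]
  exact ⟨finFunctionFinEquiv.symm t, Finset.mem_univ _, by
    simp only [patchLo, Pi.smul_apply, smul_eq_mul, mul_comm r]⟩

theorem IsInner.coeffCell_subset (hK : T.IsInner ℓ K) (hT : 0 < T.size) (hr : r ≠ 0)
    (t : Fin (((2 * ℓ + 1) * r) ^ d)) : T.coeffCell r ℓ K t ⊆ T.elemPatch ℓ K := by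
  rw [hK.elemPatch_eq_refine hT hr]
  exact cell_subset_box (size_refine_pos hr hT) (hK.coeffCell_index_mem t)

theorem volume_coeffCell_lt_top (t : Fin (((2 * ℓ + 1) * r) ^ d)) :
    volume (T.coeffCell r ℓ K t) < ⊤ := volume_cell_lt_top

theorem ae_eq_setAverage {M : CartesianMesh d} (hM : 0 < M.size) {A : (Fin d → ℝ) → ℝ}
    {q : Fin d → ℕ} (h : ∃ c : ℝ, ∀ᵐ x ∂(volume.restrict (M.cell q)), A x = c) :
    ∀ᵐ x ∂(volume.restrict (M.cell q)), A x = ⨍ y in M.cell q, A y := by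
  obtain ⟨c, hc⟩ := h
  have hpos : volume.real (M.cell q) ≠ 0 := by
    rw [volume_cell hM]
    positivity
  have : ⨍ y in M.cell q, A y = c := by
    rw [setAverage_eq, integral_congr_ae hc, setIntegral_const, smul_smul, inv_mul_cancel₀ hpos,
      one_smul]
  rw [this]
  exact hc

theorem IsInner.coeffVector_mem_Icc (hK : T.IsInner ℓ K) (hT : 0 < T.size) (hr : r ≠ 0)
    {α β : ℝ} {A : (Fin d → ℝ) → ℝ} (hA : (T.refine r).IsAdmissible α β A)
    (t : Fin (((2 * ℓ + 1) * r) ^ d)) :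
    α ≤ T.coeffVector r ℓ K A t ∧ T.coeffVector r ℓ K A t ≤ β := by
  have hTe := size_refine_pos hr hT
  have h1 := ae_eq_setAverage hTe (hA.const _ (hK.mem_elems_of_mem_boxElems (fun i => rfl)
    (hK.coeffCell_index_mem t)))
  have h2 := hA.bounds
  rw [refine_domain hr] at h2
  have h3 := ae_restrict_of_ae_restrict_of_subset ((hK.coeffCell_subset hT hr t).trans
    (hK.elemPatch_subset_domain hT)) h2
  have hne : NeZero (volume.restrict (T.coeffCell r ℓ K t)) := by
    refine ⟨fun h0 => ?_⟩
    rw [Measure.restrict_eq_zero] at h0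
    have := volume_cell hTe (q := fun a => (K a - ℓ) * r + (finFunctionFinEquiv.symm t a : ℕ))
    rw [measureReal_def, ← coeffCell, h0] at this
    have h4 : 0 < (T.refine r).size ^ d := by positivity
    rw [← this] at h4
    simp at h4
  have hbot : (ae (volume.restrict (T.coeffCell r ℓ K t))).NeBot := ae_neBot.2 hne.out
  -- The cell has positive measure, so some point has both the mean value and the bounds.
  obtain ⟨x, hx1, hx2⟩ := Filter.Eventually.exists
    (f := ae (volume.restrict (T.coeffCell r ℓ K t))) (h1.and h3)
  rw [hx1] at hx2
  exact hx2

/-- The set `S` is the whole space for `a(·,·)` and the element `K` for the right-hand side of the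
corrector problem. -/
theorem IsInner.energyForm_inter_eq (hK : T.IsInner ℓ K) (hT : 0 < T.size) (hr : r ≠ 0)
    {α β : ℝ} {A : (Fin d → ℝ) → ℝ} (hA : (T.refine r).IsAdmissible α β A)
    {S : Set (Fin d → ℝ)} (hS : MeasurableSet S) {u v : (Fin d → ℝ) → ℝ}
    (hu : u ∈ regularOn (T.elemPatch ℓ K)) (hv : v ∈ regularOn (T.elemPatch ℓ K)) :
    energyForm A (T.elemPatch ℓ K ∩ S) u v =
      ∑ t, T.coeffVector r ℓ K A t * dirichlet (T.coeffCell r ℓ K t ∩ S) u v := by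
  rw [hK.elemPatch_eq_refine hT hr] at hu hv ⊢
  rw [energyForm_box_inter (size_refine_pos hr hT) (smul_patchLo_lt_patchHi hr ℓ K) hS
    (a := fun q => ⨍ y in (T.refine r).cell q, A y) (fun q hq => ?_) hu hv]
  · exact hK.sum_coeffCell fun C => (⨍ y in C, A y) * dirichlet (C ∩ S) u v
  · exact ae_eq_setAverage (size_refine_pos hr hT)
      (hA.const _ (hK.mem_elems_of_mem_boxElems (fun i => rfl) hq))

theorem IsInner.dirichlet_elemPatch_eq_sum (hK : T.IsInner ℓ K) (hT : 0 < T.size) (hr : r ≠ 0)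
    {u v : (Fin d → ℝ) → ℝ}
    (hu : u ∈ regularOn (T.elemPatch ℓ K)) (hv : v ∈ regularOn (T.elemPatch ℓ K)) :
    dirichlet (T.elemPatch ℓ K) u v = ∑ t, dirichlet (T.coeffCell r ℓ K t) u v := by
  rw [hK.elemPatch_eq_refine hT hr] at hu hv ⊢
  rw [dirichlet_box_eq_sum (size_refine_pos hr hT) (smul_patchLo_lt_patchHi hr ℓ K) hu hv]
  exact hK.sum_coeffCell fun C => dirichlet C u v

theorem IsInner.mem_regularOn_of_mem_fineSpace (hK : T.IsInner ℓ K) (hT : 0 < T.size) (hr : r ≠ 0)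
    (hs : s ≠ 0) {w : (Fin d → ℝ) → ℝ}
    (hw : w ∈ T.fineSpace ((T.refine r).refine s) (T.elemPatch ℓ K)) :
    w ∈ regularOn (T.elemPatch ℓ K) := by
  rw [hK.mem_fineSpace_iff hT hr hs] at hw
  rw [hK.elemPatch_eq_refine_refine hT hr hs]
  refine boxSpace_le_regularOn (size_refine_pos hs (size_refine_pos hr hT)) ?_ hw.1
  rw [smul_smul, smul_smul]
  exact smul_patchLo_lt_patchHi (mul_ne_zero hs hr) ℓ K

theorem IsInner.energyForm_domain_eq (hK : T.IsInner ℓ K) (hT : 0 < T.size) (hr : r ≠ 0)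
    (hs : s ≠ 0) {α β : ℝ} {A : (Fin d → ℝ) → ℝ} (hA : (T.refine r).IsAdmissible α β A)
    {u w : (Fin d → ℝ) → ℝ} (hu : u ∈ regularOn (T.elemPatch ℓ K))
    (hw : w ∈ T.fineSpace ((T.refine r).refine s) (T.elemPatch ℓ K)) :
    energyForm A T.domain u w =
      ∑ t, T.coeffVector r ℓ K A t * dirichlet (T.coeffCell r ℓ K t) u w := by
  rw [energyForm_eq_of_eq_zero (hK.isClosed_elemPatch hT) measurableSet_domain
    (hK.elemPatch_subset_domain hT)
    ((tsupport_subset_iff (hK.isClosed_elemPatch hT)).1 hw.2.2)]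
  have := hK.energyForm_inter_eq hT hr hA MeasurableSet.univ hu
    (hK.mem_regularOn_of_mem_fineSpace hT hr hs hw)
  simpa using this

end CartesianMesh

end
-- The local matrix as a Schur complement
noncomputable section

namespace CartesianMesh

open Matrix

variable {d : ℕ} {T : CartesianMesh d} {r s ℓ : ℕ} {K K' : Fin d → ℕ}

/-- The local matrix as a Schur complement, in terms of a spanning family of the fine-scale space. -/
theorem IsInner.localPGLOD_eq (hK : T.IsInner ℓ K) (hT : 0 < T.size) (hr : r ≠ 0)
    (hs : s ≠ 0) {α β : ℝ} {A : (Fin d → ℝ) → ℝ} (hA : (T.refine r).IsAdmissible α β A)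
    {n : ℕ} {φ : Fin n → (Fin d → ℝ) → ℝ}
    (hφ : ∀ p, φ p ∈ T.fineSpace ((T.refine r).refine s) (T.elemPatch ℓ K))
    (hspan : ∀ w ∈ T.fineSpace ((T.refine r).refine s) (T.elemPatch ℓ K),
      ∃ y : Fin n → ℝ, w = ∑ p, y p • φ p)
    {G : Fin (((2 * ℓ + 1) * r) ^ d) → Matrix (Fin n) (Fin n) ℝ}
    {c : Fin (((2 * ℓ + 1) * r) ^ d) → Matrix (Fin ((2 * ℓ + 2) ^ d)) (Fin n) ℝ}
    {b : Fin (((2 * ℓ + 1) * r) ^ d) → Matrix (Fin n) (Fin (2 ^ d)) ℝ}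
    {g : Fin (((2 * ℓ + 1) * r) ^ d) → Matrix (Fin ((2 * ℓ + 2) ^ d)) (Fin (2 ^ d)) ℝ}
    (hG : ∀ t p q, G t p q = dirichlet (T.coeffCell r ℓ K t) (φ p) (φ q))
    (hc : ∀ t i p, c t i p = dirichlet (T.coeffCell r ℓ K t) (T.hat (patchNode ℓ K i)) (φ p))
    (hb : ∀ t p j, b t p j =
      dirichlet (T.coeffCell r ℓ K t ∩ T.cell K) (φ p) (T.hat (elemNode K j)))
    (hg : ∀ t i j, g t i j = dirichlet (T.coeffCell r ℓ K t ∩ T.cell K)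
      (T.hat (patchNode ℓ K i)) (T.hat (elemNode K j)))
    {M : Matrix (Fin n) (Fin n) ℝ} (hM : M * ∑ t, T.coeffVector r ℓ K A t • G t = 1) :
    T.localPGLOD ((T.refine r).refine s) A ℓ K =
      ∑ t, T.coeffVector r ℓ K A t • g t - (∑ t, T.coeffVector r ℓ K A t • c t) * M *
        ∑ t, T.coeffVector r ℓ K A t • b t := by
  set a := T.coeffVector r ℓ K A with ha
  set W := T.fineSpace ((T.refine r).refine s) (T.elemPatch ℓ K) with hW
  have hWsub : ∀ y : Fin n → ℝ, ∑ p, y p • φ p ∈ W := fun y =>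
    Submodule.sum_mem (fineSubmodule T ((T.refine r).refine s) hT (hK.isClosed_elemPatch hT))
      fun p _ => Submodule.smul_mem _ _ (hφ p)
  have hreg : ∀ w ∈ W, w ∈ regularOn (T.elemPatch ℓ K) := fun w hw =>
    hK.mem_regularOn_of_mem_fineSpace hT hr hs hw
  have hhat : ∀ z, T.hat z ∈ regularOn (T.elemPatch ℓ K) := fun z => hat_mem_regularOn hT z _
  have hcell : ∀ t, T.coeffCell r ℓ K t ⊆ T.elemPatch ℓ K := fun t => hK.coeffCell_subset hT hr t
  have hcell' : ∀ t, T.coeffCell r ℓ K t ∩ T.cell K ⊆ T.elemPatch ℓ K := fun t =>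
    Set.inter_subset_left.trans (hcell t)
  have hvol : ∀ t, volume (T.coeffCell r ℓ K t) < ⊤ := volume_coeffCell_lt_top
  have hvol' : ∀ t, volume (T.coeffCell r ℓ K t ∩ T.cell K) < ⊤ := fun t =>
    (measure_mono Set.inter_subset_left).trans_lt (hvol t)
  have hKcell : ∀ u v, u ∈ regularOn (T.elemPatch ℓ K) → v ∈ regularOn (T.elemPatch ℓ K) →
      energyForm A (T.cell K) u v =
        ∑ t, a t * dirichlet (T.coeffCell r ℓ K t ∩ T.cell K) u v := by
    intro u v hu hv
    rw [← hK.energyForm_inter_eq hT hr hA measurableSet_cell hu hv,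
      Set.inter_eq_right.2 (hK.cell_subset_elemPatch hT)]
  have hBv : ∀ y z : Fin n → ℝ, energyForm A T.domain (∑ p, y p • φ p) (∑ q, z q • φ q) =
      z ⬝ᵥ (∑ t, a t • G t) *ᵥ y := by
    intro y z
    rw [hK.energyForm_domain_eq hT hr hs hA (hreg _ (hWsub y)) (hWsub z), sum_mulVec,
      dotProduct_sum]
    refine Finset.sum_congr rfl fun t _ => ?_
    rw [smul_mulVec, dotProduct_smul, smul_eq_mul, ← ha]
    congr 1
    have h1 : ∀ p, φ p ∈ regularOn (T.coeffCell r ℓ K t) := fun p =>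
      regularOn_mono (hcell t) (hreg _ (hφ p))
    rw [dirichlet_comm, dirichlet_sum_left _ _ (hvol t) h1
      (regularOn_mono (hcell t) (hreg _ (hWsub y)))]
    refine Finset.sum_congr rfl fun q _ => ?_
    rw [dirichlet_comm, dirichlet_sum_left _ _ (hvol t) h1 (h1 q)]
    congr 1
    exact Finset.sum_congr rfl fun p _ => by
      beta_reduce
      rw [hG, dirichlet_comm, mul_comm]
  have hbv : ∀ j (z : Fin n → ℝ), energyForm A (T.cell K) (T.hat (elemNode K j))
      (∑ q, z q • φ q) = z ⬝ᵥ (∑ t, a t • b t).col j := by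
    intro j z
    rw [hKcell _ _ (hhat _) (hreg _ (hWsub z))]
    have e : ∀ t, dirichlet (T.coeffCell r ℓ K t ∩ T.cell K) (T.hat (elemNode K j))
        (∑ q, z q • φ q) = ∑ q, z q * b t q j := by
      intro t
      rw [dirichlet_comm, dirichlet_sum_left _ _ (hvol' t)
        (fun p => regularOn_mono (hcell' t) (hreg _ (hφ p))) (regularOn_mono (hcell' t) (hhat _))]
      simp only [hb]
    simp only [e, dotProduct, col_apply, Matrix.sum_apply, Matrix.smul_apply, smul_eq_mul, Finset.mul_sum]
    rw [Finset.sum_comm]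
    simp only [mul_left_comm]
  have hcv : ∀ i (z : Fin n → ℝ), energyForm A T.domain (T.hat (patchNode ℓ K i))
      (∑ q, z q • φ q) = ((∑ t, a t • c t) *ᵥ z) i := by
    intro i z
    rw [hK.energyForm_domain_eq hT hr hs hA (hhat _) (hWsub z)]
    have e : ∀ t, dirichlet (T.coeffCell r ℓ K t) (T.hat (patchNode ℓ K i))
        (∑ q, z q • φ q) = ∑ q, z q * c t i q := by
      intro t
      rw [dirichlet_comm, dirichlet_sum_left _ _ (hvol t)
        (fun p => regularOn_mono (hcell t) (hreg _ (hφ p))) (regularOn_mono (hcell t) (hhat _))]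
      simp only [hc, dirichlet_comm (φ _)]
    simp only [e, mulVec, dotProduct, Matrix.sum_apply, Matrix.smul_apply, smul_eq_mul, Finset.mul_sum,
      Finset.sum_mul, ← ha]
    rw [Finset.sum_comm]
    refine Finset.sum_congr rfl fun q _ => Finset.sum_congr rfl fun t _ => by ring
  have hM' : (∑ t, a t • G t) * M = 1 := mul_eq_one_comm.1 hM
  ext i j
  -- Existence makes the choice in `elementCorrector` meaningful. Uniqueness follows below, as the
  -- coordinates of any solution are forced by the inverse `M`.
  have hex : ∃ ψ, T.IsElementCorrector ((T.refine r).refine s) A ℓ K (T.hat (elemNode K j)) ψ := by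
    refine ⟨∑ p, (M *ᵥ (∑ t, a t • b t).col j) p • φ p, hWsub _, fun w hw => ?_⟩
    obtain ⟨z, rfl⟩ := hspan w hw
    rw [hBv, hbv, mulVec_mulVec, hM', one_mulVec]
  obtain ⟨h1, h2⟩ := Classical.epsilon_spec hex
  change T.elementCorrector ((T.refine r).refine s) A ℓ K (T.hat (elemNode K j)) ∈ _ at h1
  change ∀ w ∈ _, energyForm A T.domain (T.elementCorrector ((T.refine r).refine s) A ℓ K
    (T.hat (elemNode K j))) w = _ at h2
  rw [localPGLOD, of_apply]
  obtain ⟨y, hy⟩ := hspan _ h1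
  rw [hy] at h2 ⊢
  have hy2 : (∑ t, a t • G t) *ᵥ y = (∑ t, a t • b t).col j := by
    refine dotProduct_eq _ _ fun z => ?_
    rw [dotProduct_comm, ← hBv, dotProduct_comm _ z, ← hbv]
    exact h2 _ (hWsub z)
  have hy3 : y = M *ᵥ (∑ t, a t • b t).col j := by
    rw [← hy2, mulVec_mulVec, hM, one_mulVec]
  rw [hcv, hy3, mulVec_mulVec, hKcell _ _ (hhat _) (hhat _), Matrix.sub_apply]
  congr 1
  simp only [Matrix.sum_apply, Matrix.smul_apply, smul_eq_mul, hg]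

end CartesianMesh

end
-- The same tensors for all positions of the element
noncomputable section

namespace CartesianMesh

open Matrix

variable {d : ℕ} {T : CartesianMesh d} {r s ℓ : ℕ} {K K' : Fin d → ℕ}

theorem IsInner.preimage_coeffCell (hK : T.IsInner ℓ K) (hK' : T.IsInner ℓ K') (hr : r ≠ 0)
    (t : Fin (((2 * ℓ + 1) * r) ^ d)) :
    (fun x => x - (T.node K' - T.node K)) ⁻¹' T.coeffCell r ℓ K t = T.coeffCell r ℓ K' t := by
  rw [← refine_node hr K, ← refine_node hr K']
  refine preimage_cell ?_
  funext i
  simp only [Pi.add_apply, Pi.smul_apply, smul_eq_mul]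
  obtain ⟨m, hm⟩ : ∃ m, K i = ℓ + m := ⟨K i - ℓ, by have := hK i; omega⟩
  obtain ⟨m', hm'⟩ : ∃ m, K' i = ℓ + m := ⟨K' i - ℓ, by have := hK' i; omega⟩
  rw [hm, hm', Nat.add_sub_cancel_left, Nat.add_sub_cancel_left]
  ring

theorem IsInner.patchNode_add (hK : T.IsInner ℓ K) (hK' : T.IsInner ℓ K')
    (i : Fin ((2 * ℓ + 2) ^ d)) : patchNode ℓ K' i + K = patchNode ℓ K i + K' := by
  funext a
  have := hK a
  have := hK' a
  simp only [patchNode, Pi.add_apply]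
  omega

theorem elemNode_add (K K' : Fin d → ℕ) (j : Fin (2 ^ d)) :
    elemNode K' j + K = elemNode K j + K' := by
  funext a
  simp only [elemNode, Pi.add_apply]
  omega

/-- Orthonormality for the form with unit coefficient acts as an exact preconditioner: `α ≤ A ≤ β`
becomes a spectral bound for the stiffness matrix, free of inverse inequalities in `h`. -/
theorem IsInner.exists_orthonormal_fineSpace (hd : 0 < d) (hK : T.IsInner ℓ K) (hT : 0 < T.size)
    (hr : r ≠ 0) (hs : s ≠ 0) :
    ∃ n ≤ ((2 * ℓ + 1) * (s * r)) ^ d * 2 ^ d, ∃ φ : Fin n → (Fin d → ℝ) → ℝ,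
      (∀ p, φ p ∈ T.fineSpace ((T.refine r).refine s) (T.elemPatch ℓ K)) ∧
      (∀ w ∈ T.fineSpace ((T.refine r).refine s) (T.elemPatch ℓ K),
        ∃ y : Fin n → ℝ, w = ∑ p, y p • φ p) ∧
      ∀ p q, dirichlet (T.elemPatch ℓ K) (φ p) (φ q) = if p = q then 1 else 0 := by
  have hTh := size_refine_pos hs (size_refine_pos hr hT)
  let V := fineSubmodule T ((T.refine r).refine s) hT (hK.isClosed_elemPatch (T := T) hT)
  have hlt : ∀ i, (s • r • patchLo ℓ K) i < (s • r • patchHi ℓ K) i := by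
    rw [smul_smul, smul_smul]
    exact smul_patchLo_lt_patchHi (mul_ne_zero hs hr) ℓ K
  have hle : V ≤ ((T.refine r).refine s).boxSpace (s • r • patchLo ℓ K) (s • r • patchHi ℓ K) :=
    fun w hw => ((hK.mem_fineSpace_iff hT hr hs).1 hw).1
  have := finiteDimensional_boxSpace hTh hlt
  have hVfin : FiniteDimensional ℝ V := Submodule.finiteDimensional_of_le hle
  have hcard : (boxElems (s • r • patchLo ℓ K) (s • r • patchHi ℓ K)).card =
      ((2 * ℓ + 1) * (s * r)) ^ d := by
    rw [smul_smul, smul_smul]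
    exact card_boxElems (hK.smul_patchHi_eq (s * r))
  refine ⟨Module.finrank ℝ V, ?_, ?_⟩
  · rw [← hcard]
    exact (Submodule.finrank_mono hle).trans (finrank_boxSpace_le hTh hlt)
  have hreg : ∀ w ∈ V, w ∈ regularOn (T.elemPatch ℓ K) := fun w hw =>
    hK.mem_regularOn_of_mem_fineSpace hT hr hs hw
  have hvol : volume (T.elemPatch ℓ K) < ⊤ := by
    rw [hK.elemPatch_eq hT]
    exact volume_box_lt_top
  refine exists_orthonormal_family V (dirichlet (T.elemPatch ℓ K))
    (fun u _ v _ => dirichlet_comm u v) (fun u _ => dirichlet_self_nonneg u) (fun u hu h => ?_)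
    (fun u hu v hv w hw => dirichlet_add_left hvol (hreg u hu) (hreg v hv) (hreg w hw))
    (fun c u hu v _ => dirichlet_smul_left c (hreg u hu) v)
  rw [hK.elemPatch_eq_refine_refine hT hr hs] at h
  exact eq_zero_of_dirichlet_eq_zero hd hTh hlt (hle hu) h

/-- The local matrices of all inner elements as one function of the vector of coefficients. -/
theorem IsInner.exists_pglod_tensors (hd : 0 < d) (hK : T.IsInner ℓ K) (hT : 0 < T.size)
    (hT1 : T.size ≤ 1) (hr : r ≠ 0) (hs : s ≠ 0) :
    ∃ n ≤ ((2 * ℓ + 1) * (s * r)) ^ d * 2 ^ d,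
    ∃ (G : Fin (((2 * ℓ + 1) * r) ^ d) → Matrix (Fin n) (Fin n) ℝ)
      (c : Fin (((2 * ℓ + 1) * r) ^ d) → Matrix (Fin ((2 * ℓ + 2) ^ d)) (Fin n) ℝ)
      (b : Fin (((2 * ℓ + 1) * r) ^ d) → Matrix (Fin n) (Fin (2 ^ d)) ℝ)
      (g : Fin (((2 * ℓ + 1) * r) ^ d) → Matrix (Fin ((2 * ℓ + 2) ^ d)) (Fin (2 ^ d)) ℝ),
      (∀ t, (G t).IsSymm) ∧ (∀ t x, 0 ≤ x ⬝ᵥ G t *ᵥ x) ∧ ∑ t, G t = 1 ∧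
      (∀ t i p, |c t i p| ≤ d * (d / T.size * (d / T.size)) + 1) ∧
      (∀ t p j, |b t p j| ≤ d * (d / T.size * (d / T.size)) + 1) ∧
      (∀ t i j, |g t i j| ≤ d * (d / T.size * (d / T.size)) + 1) ∧
      ∀ K', T.IsInner ℓ K' → ∀ (α β : ℝ) (A : (Fin d → ℝ) → ℝ),
        (T.refine r).IsAdmissible α β A → ∀ M : Matrix (Fin n) (Fin n) ℝ,
          M * ∑ t, T.coeffVector r ℓ K' A t • G t = 1 →
          T.localPGLOD ((T.refine r).refine s) A ℓ K' =
            ∑ t, T.coeffVector r ℓ K' A t • g t - (∑ t, T.coeffVector r ℓ K' A t • c t) * M *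
              ∑ t, T.coeffVector r ℓ K' A t • b t := by
  obtain ⟨n, hn, φ, hφ, hspan, hortho⟩ := hK.exists_orthonormal_fineSpace hd hT hr hs
  refine ⟨n, hn, fun t => of fun p q => dirichlet (T.coeffCell r ℓ K t) (φ p) (φ q),
    fun t => of fun i p => dirichlet (T.coeffCell r ℓ K t) (T.hat (patchNode ℓ K i)) (φ p),
    fun t => of fun p j => dirichlet (T.coeffCell r ℓ K t ∩ T.cell K) (φ p)
      (T.hat (elemNode K j)),
    fun t => of fun i j => dirichlet (T.coeffCell r ℓ K t ∩ T.cell K)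
      (T.hat (patchNode ℓ K i)) (T.hat (elemNode K j)), ?_, ?_, ?_, ?_, ?_, ?_, ?_⟩
  all_goals
    have hreg : ∀ p, φ p ∈ regularOn (T.elemPatch ℓ K) := fun p =>
      hK.mem_regularOn_of_mem_fineSpace hT hr hs (hφ p)
    have hcell : ∀ t, T.coeffCell r ℓ K t ⊆ T.elemPatch ℓ K := fun t =>
      hK.coeffCell_subset hT hr t
    have hregc : ∀ t p, φ p ∈ regularOn (T.coeffCell r ℓ K t) := fun t p =>
      regularOn_mono (hcell t) (hreg p)
    have hvolω : volume (T.elemPatch ℓ K) < ⊤ := by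
      rw [hK.elemPatch_eq hT]
      exact volume_box_lt_top
    have hvol1 : ∀ t, volume.real (T.coeffCell r ℓ K t) ≤ 1 := by
      intro t
      rw [coeffCell, volume_cell (size_refine_pos hr hT)]
      refine pow_le_one₀ (size_refine_pos hr hT).le ?_
      have : (1 : ℝ) ≤ r := by exact_mod_cast Nat.one_le_iff_ne_zero.2 hr
      exact (div_le_self hT.le this).trans hT1
    have hhat : ∀ t (S : Set (Fin d → ℝ)) z z', S ⊆ T.coeffCell r ℓ K t →
        |dirichlet S (T.hat z) (T.hat z')| ≤ d * (d / T.size * (d / T.size)) := by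
      intro t S z z' hS
      have hv := (measure_mono hS).trans_lt (volume_coeffCell_lt_top t)
      refine (abs_dirichlet_hat_le hT z z' hv).trans ?_
      refine mul_le_of_le_one_right (by positivity) ?_
      exact (measureReal_mono hS (volume_coeffCell_lt_top t).ne).trans (hvol1 t)
    -- The summand `1` comes from the basis function, whose energy on `S` is at most its energy on
    -- the patch, which is `1`.
    have hmixed : ∀ t (S : Set (Fin d → ℝ)) z p, S ⊆ T.coeffCell r ℓ K t →
        |dirichlet S (T.hat z) (φ p)| ≤ d * (d / T.size * (d / T.size)) + 1 := by
      intro t S z p hS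
      have hv := (measure_mono hS).trans_lt (volume_coeffCell_lt_top t)
      refine (abs_dirichlet_le hv (hat_mem_regularOn hT z S)
        (regularOn_mono hS (hregc t p))).trans ?_
      have h1 := (le_abs_self _).trans (hhat t S z z hS)
      have h2 := dirichlet_self_mono hvolω (hreg p) (hS.trans (hcell t))
      rw [hortho, if_pos rfl] at h2
      have h3 : (0 : ℝ) ≤ d * (d / T.size * (d / T.size)) := by positivity
      linarith
  · intro t
    ext p q
    simp only [transpose_apply, of_apply]
    exact dirichlet_comm _ _
  · intro t x
    have h1 := dirichlet_self_nonneg (S := T.coeffCell r ℓ K t) (∑ p, x p • φ p)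
    rw [dirichlet_sum_left _ _ (volume_coeffCell_lt_top t) (hregc t)
      (Submodule.sum_mem _ fun p _ => Submodule.smul_mem _ _ (hregc t p))] at h1
    refine h1.trans (le_of_eq (Finset.sum_congr rfl fun p _ => ?_))
    rw [dirichlet_comm, dirichlet_sum_left _ _ (volume_coeffCell_lt_top t) (hregc t) (hregc t p)]
    congr 1
    refine Finset.sum_congr rfl fun q _ => ?_
    rw [dirichlet_comm, mul_comm]
    rfl
  · ext p q
    rw [Matrix.sum_apply]
    simp only [of_apply]
    rw [← hK.dirichlet_elemPatch_eq_sum hT hr (hreg p) (hreg q), hortho, one_apply]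
  · exact fun t i p => hmixed t _ _ p subset_rfl
  · intro t p j
    beta_reduce
    rw [of_apply, dirichlet_comm]
    exact hmixed t _ _ p Set.inter_subset_left
  · intro t i j
    exact (hhat t _ _ _ Set.inter_subset_left).trans (by linarith)
  · intro K' hK' α β A hA M hM
    have hpat : ∀ i, T.hat (patchNode ℓ K' i) =
        fun x => T.hat (patchNode ℓ K i) (x - (T.node K' - T.node K)) := fun i =>
      funext fun x => hat_translate (hK.patchNode_add hK' i) x
    have hele : ∀ j, T.hat (elemNode K' j) =
        fun x => T.hat (elemNode K j) (x - (T.node K' - T.node K)) := fun j =>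
      funext fun x => hat_translate (elemNode_add K K' j) x
    have hcap : ∀ t, T.coeffCell r ℓ K' t ∩ T.cell K' =
        (fun x => x - (T.node K' - T.node K)) ⁻¹' (T.coeffCell r ℓ K t ∩ T.cell K) := fun t => by
      rw [Set.preimage_inter, hK.preimage_coeffCell hK' hr, preimage_cell (add_comm K' K)]
    -- At `K'` the translated basis is used; it spans because translating back lands in the space at
    -- `K`. Its energies equal those at `K` by translation invariance of Lebesgue measure.
    refine hK'.localPGLOD_eq hT hr hs hA
      (φ := fun p x => φ p (x - (T.node K' - T.node K)))
      (fun p => hK.translate_mem_fineSpace hK' hT hr hs (hφ p)) (fun w hw => ?_)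
      (fun t p q => ?_) (fun t i p => ?_) (fun t p j => ?_) (fun t i j => ?_) hM
    · obtain ⟨y, hy⟩ := hspan _ (hK'.translate_mem_fineSpace hK hT hr hs hw)
      refine ⟨y, funext fun x => ?_⟩
      have := congrFun hy (x - (T.node K' - T.node K))
      simp only [sub_sub, sub_add_sub_cancel, sub_self, sub_zero,
        Finset.sum_apply, Pi.smul_apply] at this
      rw [Finset.sum_apply]
      simpa using this
    · rw [← hK.preimage_coeffCell hK' hr, dirichlet_translate, of_apply]
    · rw [← hK.preimage_coeffCell hK' hr, hpat, dirichlet_translate, of_apply]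
    · rw [hcap, hele, dirichlet_translate, of_apply]
    · rw [hcap, hele, hpat, dirichlet_translate, of_apply]

end CartesianMesh

end
-- Iteration counts and the network for a given accuracy
noncomputable section

theorem iteration_count_bound {L S a b k lam l : ℝ} (hL : 0 ≤ L) (hS : 0 ≤ S) (ha : 0 ≤ a)
    (hb : 0 ≤ b) (hk : 0 ≤ k) (h1 : L ≤ (a + 4) * (lam + l))
    (h2 : S + 2 ≤ (2 * b + 2) * (k * lam)) (h3 : lam * (lam + l) ≤ 2 * (lam ^ 2 + l ^ 2))
    (h4 : 1 ≤ k * (lam ^ 2 + l ^ 2)) :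
    L * (S + 2) + 2 ≤ (2 * (a + 4) * (2 * b + 2) + 2) * k * (lam ^ 2 + l ^ 2) := by
  have h5 : L * (S + 2) ≤ (a + 4) * (lam + l) * ((2 * b + 2) * (k * lam)) :=
    mul_le_mul h1 h2 (by linarith) (hL.trans h1)
  have h6 : (a + 4) * (2 * b + 2) * k * (lam * (lam + l)) ≤
      (a + 4) * (2 * b + 2) * k * (2 * (lam ^ 2 + l ^ 2)) :=
    mul_le_mul_of_nonneg_left h3 (by positivity)
  linarith

/-- Numbers of squarings and of sawtooth steps that suffice for a given accuracy. -/
theorem exists_iteration_counts (ρ : ℝ) (hρ : 0 < ρ) (hρ1 : ρ ≤ 1) (E : ℕ) :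
    ∃ C : ℝ, 0 < C ∧ ∀ (lam : ℝ) (k : ℕ), 1 ≤ lam → 1 ≤ k → ∃ L S : ℕ,
      Real.exp (E * lam) * (7 ^ L / 4 ^ S) ≤ Real.exp (-(k * lam)) ∧
      Real.exp (E * lam) * (1 - ρ) ^ (2 ^ L - 1) ≤ Real.exp (-(k * lam)) ∧
      (L : ℝ) * (S + 2) + 2 ≤ C * k * (lam ^ 2 + Real.log k ^ 2) := by
  -- With `y = k * lam` this will give `ρ * 2 ^ L ≥ (E + 2) * y`; one `y` is the accuracy, and the
  -- other pays for the `-1` in the exponent `2 ^ L - 1`.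
  obtain ⟨A₀, hA₀⟩ : ∃ A₀ : ℕ, (E + 2) / ρ ≤ (2 : ℝ) ^ A₀ := by
    obtain ⟨n, hn⟩ := pow_unbounded_of_one_lt ((E + 2) / ρ) (one_lt_two : (1 : ℝ) < 2)
    exact ⟨n, hn.le⟩
  -- Since `7 ≤ exp 2` and `L ≤ (A₀ + 5) * y`, the factor `4 ^ S ≥ exp (A₁ * y)` outweighs `exp (E *
  -- lam) * 7 ^ L` by `exp y`.
  obtain ⟨A₁, hA₁⟩ : ∃ A₁ : ℕ, A₁ = E + 1 + 2 * (A₀ + 5) := ⟨_, rfl⟩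
  refine ⟨2 * (A₀ + 4) * (2 * A₁ + 2) + 2, by positivity, fun lam k hlam hk => ?_⟩
  have hk1 : (1 : ℝ) ≤ k := by exact_mod_cast hk
  have hkpos : (0 : ℝ) < k := by linarith
  set l := Real.log k with hl
  have hl0 : 0 ≤ l := Real.log_nonneg hk1
  set y : ℝ := k * lam with hy
  have hlamy : lam ≤ y := by nlinarith
  have hy1 : 1 ≤ y := hlam.trans hlamy
  have hly : l ≤ y := by
    have := Real.log_le_sub_one_of_pos hkpos
    nlinarith
  -- `2 ^ ⌈lam⌉₊ ≥ lam` and `2 ^ ⌈2 * l⌉₊ ≥ k`, so that `2 ^ L ≥ 2 ^ A₀ * y`. The product of the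
  -- counts is of order `(lam + l) * k * lam`, the source of the squared logarithms.
  refine ⟨A₀ + ⌈lam⌉₊ + ⌈2 * l⌉₊, A₁ * ⌈y⌉₊, ?_, ?_, ?_⟩
  all_goals
    have hc1 := Nat.le_ceil lam
    have hc2 := (Nat.ceil_lt_add_one (by linarith : 0 ≤ lam)).le
    have hc3 := Nat.le_ceil (2 * l)
    have hc4 := (Nat.ceil_lt_add_one (by linarith : 0 ≤ 2 * l)).le
    have hc5 := Nat.le_ceil y
    have hc6 := (Nat.ceil_lt_add_one (by linarith : 0 ≤ y)).le
    have hA₀0 : (0 : ℝ) ≤ A₀ := Nat.cast_nonneg _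
    have hE0 : (0 : ℝ) ≤ E := Nat.cast_nonneg _
    have hA₁r : (A₁ : ℝ) = E + 1 + 2 * (A₀ + 5) := by rw [hA₁]; push_cast; ring
  · set L := A₀ + ⌈lam⌉₊ + ⌈2 * l⌉₊ with hL
    have hLr : (L : ℝ) ≤ (A₀ + 5) * y := by
      rw [hL]
      push_cast
      nlinarith
    have h7 : (7 : ℝ) ^ L ≤ Real.exp (2 * L) := by
      have : (7 : ℝ) ≤ Real.exp 2 := by
        have h1 := Real.exp_one_gt_d9
        have h2 : Real.exp 2 = Real.exp 1 * Real.exp 1 := by rw [← Real.exp_add]; norm_num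
        rw [h2]
        nlinarith
      rw [mul_comm, Real.exp_nat_mul]
      exact pow_le_pow_left₀ (by norm_num) this L
    have h4 : Real.exp (A₁ * y) ≤ (4 : ℝ) ^ (A₁ * ⌈y⌉₊) := by
      have h1 : Real.exp 1 ≤ 4 := by linarith [Real.exp_one_lt_d9]
      calc Real.exp (A₁ * y) ≤ Real.exp ((A₁ * ⌈y⌉₊ : ℕ) * 1) := by
            push_cast
            rw [mul_one]
            gcongr
        _ = Real.exp 1 ^ (A₁ * ⌈y⌉₊) := by rw [Real.exp_nat_mul]
        _ ≤ _ := pow_le_pow_left₀ (Real.exp_pos _).le h1 _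
    calc Real.exp (E * lam) * (7 ^ L / 4 ^ (A₁ * ⌈y⌉₊))
        ≤ Real.exp (E * y) * (Real.exp (2 * ((A₀ + 5) * y)) / Real.exp (A₁ * y)) := by
          gcongr
          exact h7.trans (by gcongr)
      _ = Real.exp (-y) := by
          rw [← Real.exp_sub, ← Real.exp_add, hA₁r]
          ring_nf
  · set L := A₀ + ⌈lam⌉₊ + ⌈2 * l⌉₊ with hL
    have h2L : (2 : ℝ) ^ A₀ * y ≤ 2 ^ L := by
      have h1 : lam ≤ 2 ^ ⌈lam⌉₊ :=
        hc1.trans (by exact_mod_cast (Nat.lt_two_pow_self (n := ⌈lam⌉₊)).le)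
      have h2 : (k : ℝ) ≤ 2 ^ ⌈2 * l⌉₊ := by
        have h3 : Real.exp (1 / 2) ≤ 2 := by
          have h5 : Real.exp (1 / 2) * Real.exp (1 / 2) = Real.exp 1 := by
            rw [← Real.exp_add]; norm_num
          have := Real.exp_one_lt_d9
          nlinarith [Real.exp_pos (1 / 2)]
        calc (k : ℝ) = Real.exp l := (Real.exp_log hkpos).symm
          _ ≤ Real.exp (⌈2 * l⌉₊ * (1 / 2)) := by
            gcongr
            linarith
          _ = Real.exp (1 / 2) ^ ⌈2 * l⌉₊ := by rw [Real.exp_nat_mul]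
          _ ≤ _ := pow_le_pow_left₀ (Real.exp_pos _).le h3 _
      rw [hL, pow_add, pow_add, hy, mul_assoc, mul_comm (k : ℝ)]
      gcongr
    have hexp : (1 - ρ) ^ (2 ^ L - 1) ≤ Real.exp (-(ρ * (2 ^ L - 1))) := by
      have h1 : 1 - ρ ≤ Real.exp (-ρ) := by linarith [Real.add_one_le_exp (-ρ)]
      refine (pow_le_pow_left₀ (by linarith) h1 _).trans (le_of_eq ?_)
      rw [← Real.exp_nat_mul, Nat.cast_sub Nat.one_le_two_pow]
      push_cast
      ring_nf
    have h3 : (E + 2) * y ≤ ρ * 2 ^ L := by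
      rw [div_le_iff₀ hρ] at hA₀
      calc (E + 2) * y ≤ 2 ^ A₀ * ρ * y := by gcongr
        _ = ρ * (2 ^ A₀ * y) := by ring
        _ ≤ _ := by gcongr
    calc Real.exp (E * lam) * (1 - ρ) ^ (2 ^ L - 1)
        ≤ Real.exp (E * y) * Real.exp (-(ρ * (2 ^ L - 1))) := by gcongr
      _ ≤ Real.exp (-y) := by
          rw [← Real.exp_add]
          gcongr
          nlinarith
  · push_cast
    have h1 : (A₀ : ℝ) + ⌈lam⌉₊ + ⌈2 * l⌉₊ ≤ (A₀ + 4) * (lam + l) := by nlinarith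
    have h2 : (A₁ : ℝ) * ⌈y⌉₊ + 2 ≤ (2 * A₁ + 2) * y := by
      have : (0 : ℝ) ≤ A₁ := Nat.cast_nonneg _
      nlinarith
    have h3 : lam * (lam + l) ≤ 2 * (lam ^ 2 + l ^ 2) := by nlinarith [sq_nonneg (lam - l)]
    have h4 : 1 ≤ k * (lam ^ 2 + l ^ 2) := by
      have : 1 ≤ lam ^ 2 + l ^ 2 := by nlinarith [sq_nonneg l]
      nlinarith
    exact iteration_count_bound (by positivity) (by positivity) hA₀0 (Nat.cast_nonneg _) hkpos.le
      h1 h2 h3 h4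

namespace CartesianMesh

open scoped Matrix.Norms.L2Operator

variable {d : ℕ} {T : CartesianMesh d} {r s ℓ : ℕ} {K K' : Fin d → ℕ}

/-- One bound for all dimensions in play; `8 * ℓ` absorbs `2 * (2 * ℓ + 1)`, where the `2` stems
from the `2 ^ d` polynomials per fine cell. -/
theorem card_bounds (d : ℕ) {ℓ r s n : ℕ} (hℓ : 1 ≤ ℓ) (hr : 1 ≤ r) (hs : 1 ≤ s)
    (hn : n ≤ ((2 * ℓ + 1) * (s * r)) ^ d * 2 ^ d) :
    (2 * ℓ + 2) ^ d + (n + 2 ^ d) ≤ 3 * (8 * ℓ * (r * s)) ^ d ∧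
      ((2 * ℓ + 1) * r) ^ d ≤ (8 * ℓ * (r * s)) ^ d := by
  have hrs : 1 ≤ r * s := Nat.one_le_iff_ne_zero.2 (by positivity)
  have h0 : 8 * ℓ ≤ 8 * ℓ * (r * s) := Nat.le_mul_of_pos_right _ (by omega)
  have h1 : (2 * ℓ + 2) ^ d ≤ (8 * ℓ * (r * s)) ^ d :=
    Nat.pow_le_pow_left ((by omega : 2 * ℓ + 2 ≤ 8 * ℓ).trans h0) d
  have h2 : n ≤ (8 * ℓ * (r * s)) ^ d := by
    refine hn.trans ?_
    rw [← mul_pow]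
    refine Nat.pow_le_pow_left ?_ d
    rw [mul_comm s r, mul_right_comm]
    exact Nat.mul_le_mul_right _ (by omega)
  have h3 : 2 ^ d ≤ (8 * ℓ * (r * s)) ^ d :=
    Nat.pow_le_pow_left ((by omega : 2 ≤ 8 * ℓ).trans h0) d
  refine ⟨by omega, Nat.pow_le_pow_left ?_ d⟩
  calc (2 * ℓ + 1) * r ≤ 8 * ℓ * r := Nat.mul_le_mul_right _ (by omega)
    _ ≤ 8 * ℓ * (r * s) := Nat.mul_le_mul_left _ (Nat.le_mul_of_pos_right _ (by omega))

theorem norm_sum_smul_le {τ m n : Type*} [Fintype τ] [Fintype m] [Fintype n] [DecidableEq n]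
    {x : τ → ℝ} {X : τ → Matrix m n ℝ} {β Q P : ℝ} (hx : ∀ t, |x t| ≤ β)
    (hX : ∀ t i j, |X t i j| ≤ Q) (hβ : 0 ≤ β) (hQ : 0 ≤ Q) (hτ : (Fintype.card τ : ℝ) ≤ P)
    (hm : (Fintype.card m : ℝ) ≤ P) (hn : (Fintype.card n : ℝ) ≤ P) :
    ‖∑ t, x t • X t‖ ≤ P ^ 2 * β * Q := by
  have hP : 0 ≤ P := (Nat.cast_nonneg _).trans hτ
  refine (Matrix.l2_opNorm_le_of_entries_of_card_le (δ := P * (β * Q)) (by positivity)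
    (fun i j => ?_) hm hn).trans (le_of_eq (by ring))
  rw [Matrix.sum_apply]
  refine (Finset.abs_sum_le_sum_abs _ _).trans ?_
  refine (Finset.sum_le_card_nsmul _ _ (β * Q) fun t _ => ?_).trans ?_
  · rw [Matrix.smul_apply, smul_eq_mul, abs_mul]
    exact mul_le_mul (hx t) (hX t i j) (abs_nonneg _) hβ
  · rw [nsmul_eq_mul, Finset.card_univ]
    gcongr

/-- The network for given numbers of squarings and sawtooth steps. -/
theorem IsInner.exists_network (hd : 0 < d) (hK : T.IsInner ℓ K) (hT : 0 < T.size)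
    (hT1 : T.size ≤ 1) (hr : 1 ≤ r) (hs : 1 ≤ s) (hℓ : 1 ≤ ℓ) {α β : ℝ} (hα : 0 < α)
    (hαβ : α ≤ β) (L S : ℕ) {P D : ℝ} (hP : P = 3 * (8 * ℓ * (r * s)) ^ d)
    (hD : D = 1 + P ^ 2 * β * (d * (d / T.size * (d / T.size)) + 1) * (1 / α + 2))
    (hδ : (7 : ℝ) ^ L * (128 * P ^ 2 / 4 ^ S) ≤ 1) :
    ∃ Ψ : NeuralNetwork (((2 * ℓ + 1) * r) ^ d) ((2 * ℓ + 2) ^ d * 2 ^ d),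
      (∀ K', T.IsInner ℓ K' → ∀ A, (T.refine r).IsAdmissible α β A →
        spectralNorm2 (T.localPGLOD ((T.refine r).refine s) A ℓ K' -
          matOfVec (Ψ.realize (T.coeffVector r ℓ K' A))) ≤
          P * (D ^ 2 * (7 ^ L * (128 * P ^ 2 / 4 ^ S) +
            (1 - α / β) ^ (2 ^ L - 1) * (β / α)))) ∧
      Ψ.depth = L * (S + 2) + 2 ∧ (Ψ.numParams : ℝ) ≤ 28 * (L * (S + 2) + 2) * P ^ 3 := by
  have hr0 : r ≠ 0 := by omega
  have hs0 : s ≠ 0 := by omega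
  have hβ : 0 < β := hα.trans_le hαβ
  obtain ⟨n, hn, G, c, b, g, hGs, hGp, hG1, hcQ, hbQ, hgQ, hS⟩ :=
    hK.exists_pglod_tensors hd hT hT1 hr0 hs0
  set Q : ℝ := d * (d / T.size * (d / T.size)) + 1 with hQ
  have hQ0 : 0 ≤ Q := by positivity
  have hP0 : 0 ≤ P := by rw [hP]; positivity
  set Γ := P ^ 2 * β * Q with hΓ
  have hΓ0 : 0 ≤ Γ := by positivity
  have hD1 : 1 ≤ D := by
    rw [hD]
    have : 0 ≤ Γ * (1 / α + 2) := by positivity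
    linarith
  have hDpos : 0 < D := by linarith
  -- `Γ` bounds the norms of `c`, `b` and `g`. The choice of `D` gives `η * Γ ≤ α`, needed for `‖c‖
  -- ≤ 1 - q`, and `η * Γ ≤ 1 / 2`, needed for `‖b‖ + ‖g‖ ≤ 1`.
  set η := 1 / D with hη
  have hη0 : 0 < η := by positivity
  have hη1 : η ≤ 1 := by rw [hη, div_le_one hDpos]; exact hD1
  have hΓα : η * Γ ≤ α := by
    rw [hη, one_div_mul_eq_div, div_le_iff₀ hDpos, hD]
    have : α * (1 + Γ * (1 / α + 2)) = α + Γ + 2 * α * Γ := by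
      field_simp
      ring
    rw [this]
    have : 0 ≤ α * Γ := by positivity
    linarith
  have hΓ2 : η * Γ ≤ 1 / 2 := by
    rw [hη, one_div_mul_eq_div, div_le_iff₀ hDpos, hD]
    have : 0 ≤ Γ * (1 / α) := by positivity
    nlinarith
  obtain ⟨hcard, hcard_m⟩ := card_bounds d hℓ hr hs hn
  set N' := Fintype.card (Fin ((2 * ℓ + 2) ^ d) ⊕ (Fin n ⊕ Fin (2 ^ d))) with hN'
  have hN'eq : N' = (2 * ℓ + 2) ^ d + (n + 2 ^ d) := by simp [hN']
  have hN'P : (N' : ℝ) ≤ P := by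
    rw [hN'eq, hP]
    exact_mod_cast hcard
  have hmP : ((((2 * ℓ + 1) * r) ^ d : ℕ) : ℝ) ≤ P := by
    rw [hP]
    have h1 : ((((2 * ℓ + 1) * r) ^ d : ℕ) : ℝ) ≤ (8 * ℓ * (r * s)) ^ d := by
      exact_mod_cast hcard_m
    have h2 : (0 : ℝ) ≤ (8 * ℓ * (r * s)) ^ d := by positivity
    linarith
  have hIP : (((2 * ℓ + 2) ^ d : ℕ) : ℝ) ≤ P := by
    refine le_trans ?_ hN'P
    rw [hN'eq]
    exact_mod_cast Nat.le_add_right _ _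
  have hYP : (n : ℝ) ≤ P := by
    refine le_trans ?_ hN'P
    rw [hN'eq]
    exact_mod_cast (Nat.le_add_right _ _).trans (Nat.le_add_left _ _)
  have hJP : ((2 ^ d : ℕ) : ℝ) ≤ P := by
    refine le_trans ?_ hN'P
    rw [hN'eq]
    exact_mod_cast (Nat.le_add_left _ _).trans (Nat.le_add_left _ _)
  have hP1 : 1 ≤ P := le_trans (by exact_mod_cast Nat.one_le_two_pow) hJP
  -- Both `c M b` and `g` are scaled by `η ^ 2`, which the output factor `D ^ 2` undoes. The sign of
  -- the Schur complement and the `1 / β` from `(1 - R)⁻¹ = β B⁻¹` are put into `c`.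
  obtain ⟨Ψ, hdep, hpar, hΨ⟩ := NeuralNetwork.exists_network_mul_inv_mul
    (fun t => (-(1 / β)) • G t) (fun t => (-(η / β)) • c t) (fun t => η • b t)
    (fun t => η ^ 2 • g t) S L (D ^ 2)
    (fun o : Fin ((2 * ℓ + 2) ^ d * 2 ^ d) =>
      (finProdFinEquiv.symm (Fin.cast (Nat.mul_comm _ _) o) : Fin (2 ^ d) × _).swap)
  refine ⟨Ψ, fun K' hK' A hA => ?_, hdep, ?_⟩
  · set a := T.coeffVector r ℓ K' A with ha
    have hab : ∀ t, α ≤ a t ∧ a t ≤ β := fun t => hK'.coeffVector_mem_Icc hT hr0 hA t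
    have habs : ∀ t, |a t| ≤ β := fun t => by
      rw [abs_of_pos (hα.trans_le (hab t).1)]
      exact (hab t).2
    -- As the `G t` add up to the identity, `R` is a combination of them with weights in `[0, 1 - α
    -- / β]`.
    have hRsum : 1 + ∑ t, a t • (-(1 / β)) • G t = ∑ t, (1 - a t / β) • G t := by
      simp only [sub_smul, one_smul, Finset.sum_sub_distrib, hG1, smul_smul]
      rw [sub_eq_add_neg, ← Finset.sum_neg_distrib]
      congr 1
      refine Finset.sum_congr rfl fun t _ => ?_
      rw [← neg_smul]
      congr 1
      ring
    have hq0 : 0 ≤ 1 - α / β := by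
      rw [sub_nonneg, div_le_one hβ]
      exact hαβ
    have hq1 : 1 - α / β < 1 := by
      have : 0 < α / β := by positivity
      linarith
    have hR : ‖1 + ∑ t, a t • (-(1 / β)) • G t‖ ≤ 1 - α / β := by
      rw [hRsum]
      refine Matrix.l2_opNorm_sum_smul_le hq0 (fun t => ?_) hGs hGp hG1
      have h1 : a t / β ≤ 1 := by rw [div_le_one hβ]; exact (hab t).2
      have h2 : α / β ≤ a t / β := by gcongr; exact (hab t).1
      rw [abs_of_nonneg (by linarith)]
      linarith
    have hcΓ : ‖∑ t, a t • c t‖ ≤ Γ := norm_sum_smul_le habs hcQ hβ.le hQ0 (by simpa using hmP)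
      (by simpa using hIP) (by simpa using hYP)
    have hbΓ : ‖∑ t, a t • b t‖ ≤ Γ := norm_sum_smul_le habs hbQ hβ.le hQ0 (by simpa using hmP)
      (by simpa using hYP) (by simpa using hJP)
    have hgΓ : ‖∑ t, a t • g t‖ ≤ Γ := norm_sum_smul_le habs hgQ hβ.le hQ0 (by simpa using hmP)
      (by simpa using hIP) (by simpa using hJP)
    have hpull : ∀ {m m' : ℕ} (z : ℝ)
        (X : Fin (((2 * ℓ + 1) * r) ^ d) → Matrix (Fin m) (Fin m') ℝ),
        ∑ t, a t • z • X t = z • ∑ t, a t • X t := by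
      intro m m' z X
      rw [Finset.smul_sum]
      exact Finset.sum_congr rfl fun t _ => smul_comm _ _ _
    have hc1 : ‖∑ t, a t • (-(η / β)) • c t‖ ≤ 1 - (1 - α / β) := by
      rw [hpull, norm_smul, norm_neg, Real.norm_of_nonneg (by positivity), sub_sub_cancel,
        le_div_iff₀ hβ]
      calc η / β * ‖∑ t, a t • c t‖ * β = η * ‖∑ t, a t • c t‖ := by field_simp
        _ ≤ η * Γ := by gcongr
        _ ≤ α := hΓα
    have hbg1 : ‖∑ t, a t • η • b t‖ + ‖∑ t, a t • η ^ 2 • g t‖ ≤ 1 := by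
      rw [hpull, hpull, norm_smul, norm_smul, Real.norm_of_nonneg hη0.le,
        Real.norm_of_nonneg (by positivity)]
      have h1 : η * ‖∑ t, a t • b t‖ ≤ η * Γ := by gcongr
      have h2 : η ^ 2 * ‖∑ t, a t • g t‖ ≤ η * Γ := by
        rw [sq, mul_assoc]
        calc η * (η * ‖∑ t, a t • g t‖) ≤ 1 * (η * Γ) := by gcongr
          _ = _ := one_mul _
      linarith
    obtain ⟨M, hM⟩ : ∃ M, M * (1 - (1 + ∑ t, a t • (-(1 / β)) • G t)) = 1 := by
      have hu := isUnit_one_sub_of_norm_lt_one (hR.trans_lt hq1)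
      exact hu.exists_left_inv
    have hδ' : (7 : ℝ) ^ L * (128 * N' ^ 2 / 4 ^ S) ≤ 7 ^ L * (128 * P ^ 2 / 4 ^ S) := by gcongr
    have herr := hΨ a (1 - α / β) M hq1 hR hc1 hbg1 hM (hδ'.trans hδ)
    have hMB : ((1 / β) • M) * ∑ t, a t • G t = 1 := by
      rw [← hM, hpull, Matrix.smul_mul, neg_smul, sub_add_cancel_left, neg_neg, Matrix.mul_smul]
    have hSeq := hS K' hK' α β A hA _ hMB
    have hval : D ^ 2 • (∑ t, a t • η ^ 2 • g t + (∑ t, a t • (-(η / β)) • c t) * M *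
        ∑ t, a t • η • b t) = T.localPGLOD ((T.refine r).refine s) A ℓ K' := by
      have hDη : D * η = 1 := by rw [hη]; field_simp
      rw [hSeq, hpull, hpull, hpull, smul_add, smul_smul, ← mul_pow, hDη, one_pow, one_smul,
        sub_eq_add_neg]
      congr 1
      simp only [Matrix.smul_mul, Matrix.mul_smul, smul_smul]
      rw [← neg_smul]
      congr 1
      have : D ^ 2 * (η * -(η / β)) = -((D * η) ^ 2 * (1 / β)) := by ring
      rw [this, hDη]
      ring
    refine Matrix.l2_opNorm_le_of_entries_of_card_le (by positivity) (fun i j => ?_)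
      (by simpa using hIP) (by simpa using hJP)
    have h1 := herr (Fin.cast (Nat.mul_comm _ _) (finProdFinEquiv (j, i)))
    rw [← smul_eq_mul (D ^ 2), ← Matrix.smul_apply, hval] at h1
    simp only [Fin.cast_cast, Fin.cast_eq_self, Equiv.symm_apply_apply, Prod.swap_prod_mk] at h1
    rw [Matrix.sub_apply, matOfVec, Matrix.of_apply, abs_sub_comm]
    refine h1.trans ?_
    have hq' : (1 - α / β) ^ (2 ^ L - 1) / (α / β) = (1 - α / β) ^ (2 ^ L - 1) * (β / α) := by
      rw [div_eq_mul_inv, inv_div]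
    rw [abs_of_nonneg (by positivity : 0 ≤ D ^ 2), sub_sub_cancel, hq']
    exact mul_le_mul_of_nonneg_left (add_le_add_left hδ' _) (by positivity)
  · have hout : (((2 * ℓ + 2) ^ d * 2 ^ d : ℕ) : ℝ) ≤ P ^ 3 := by
      push_cast
      push_cast at hIP hJP
      calc ((2 * (ℓ : ℝ) + 2) ^ d * 2 ^ d) ≤ P * P := by gcongr
        _ ≤ P ^ 3 := by nlinarith
    have hm1 : (N' : ℝ) ^ 2 * ((((2 * ℓ + 1) * r) ^ d : ℕ) + 1) ≤ P ^ 2 * (P + P) := by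
      gcongr
    calc (Ψ.numParams : ℝ) ≤ ((N' ^ 2 * (((2 * ℓ + 1) * r) ^ d + 1) +
          L * (24 * (S + 1) * N' ^ 3) + 2 * ((2 * ℓ + 2) ^ d * 2 ^ d) : ℕ) : ℝ) := by
          exact_mod_cast hpar
      _ = (N' : ℝ) ^ 2 * ((((2 * ℓ + 1) * r) ^ d : ℕ) + 1) + L * (24 * (S + 1) * N' ^ 3) +
          2 * (((2 * ℓ + 2) ^ d * 2 ^ d : ℕ) : ℝ) := by push_cast; ring
      _ ≤ P ^ 2 * (P + P) + L * (24 * (S + 2) * P ^ 3) + 2 * P ^ 3 := by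
          gcongr
          norm_num
      _ ≤ _ := by
          have h1 : 0 ≤ (L : ℝ) * (S + 2) := by positivity
          have h2 : P ^ 2 * (P + P) + L * (24 * (S + 2) * P ^ 3) + 2 * P ^ 3 =
              (4 + 24 * (L * (S + 2))) * P ^ 3 := by ring
          rw [h2]
          exact mul_le_mul_of_nonneg_right (by linarith) (by positivity)

end CartesianMesh

end
-- Constants and conclusion
noncomputable section

theorem scaling_factor_le {d : ℕ} {α β C₁ H P x : ℝ} (hα : 0 < α) (hβ : 0 ≤ β) (hH : 0 < H)
    (hx : 1 ≤ x) (hHx : 1 / H ≤ x) (hP0 : 0 ≤ P) (hP : P ≤ C₁ * x ^ d) :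
    1 + P ^ 2 * β * (d * (d / H * (d / H)) + 1) * (1 / α + 2) ≤
      (1 + C₁ ^ 2 * β * (d ^ 3 + 1) * (1 / α + 2)) * x ^ (2 * d + 2) := by
  have h1 : (d : ℝ) * (d / H * (d / H)) + 1 ≤ (d ^ 3 + 1) * x ^ 2 := by
    have h2 : (1 / H) ^ 2 ≤ x ^ 2 := pow_le_pow_left₀ (by positivity) hHx 2
    have h3 : (d : ℝ) * (d / H * (d / H)) = d ^ 3 * (1 / H) ^ 2 := by ring
    have h4 : (1 : ℝ) ≤ x ^ 2 := one_le_pow₀ hx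
    have h5 : (d : ℝ) ^ 3 * (1 / H) ^ 2 ≤ d ^ 3 * x ^ 2 :=
      mul_le_mul_of_nonneg_left h2 (by positivity)
    linarith
  have h2 : P ^ 2 ≤ (C₁ * x ^ d) ^ 2 := pow_le_pow_left₀ hP0 hP 2
  calc 1 + P ^ 2 * β * (d * (d / H * (d / H)) + 1) * (1 / α + 2)
      ≤ x ^ (2 * d + 2) + (C₁ * x ^ d) ^ 2 * β * ((d ^ 3 + 1) * x ^ 2) * (1 / α + 2) := by
        gcongr
        exact one_le_pow₀ hx
    _ = _ := by ring

/-- The exponent is `d + 2 (2 d + 2) + 2 d`, from `P`, `D ^ 2` and `P ^ 2`; the truncation term is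
padded to the same power. -/
theorem error_factor_le {d : ℕ} {C₁ C₃ P D x t v q : ℝ} (hP0 : 0 ≤ P) (hD0 : 0 ≤ D)
    (hP : P ≤ C₁ * x ^ d) (hD : D ≤ C₃ * x ^ (2 * d + 2)) (hx1 : 1 ≤ x) (ht : 0 ≤ t) (hv : 0 ≤ v)
    (hq : 0 ≤ q) (hC₁ : 0 ≤ C₁) :
    P * (D ^ 2 * (128 * P ^ 2 * t + v * q)) ≤
      C₁ * C₃ ^ 2 * (128 * C₁ ^ 2 + q) * x ^ (7 * d + 4) * (t + v) := by
  have h1 : (1 : ℝ) ≤ x ^ (2 * d) := one_le_pow₀ hx1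
  calc P * (D ^ 2 * (128 * P ^ 2 * t + v * q))
      ≤ C₁ * x ^ d * ((C₃ * x ^ (2 * d + 2)) ^ 2 *
          (128 * (C₁ * x ^ d) ^ 2 * t + v * q * x ^ (2 * d))) := by
        have h2 : v * q ≤ v * q * x ^ (2 * d) := le_mul_of_one_le_right (by positivity) h1
        gcongr
    _ = C₁ * C₃ ^ 2 * (128 * C₁ ^ 2 * t + v * q) * x ^ (7 * d + 4) := by ring
    _ ≤ C₁ * C₃ ^ 2 * ((128 * C₁ ^ 2 + q) * (t + v)) * x ^ (7 * d + 4) := by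
        gcongr
        have h2 : 0 ≤ 128 * C₁ ^ 2 * v := by positivity
        have h3 : 0 ≤ q * t := by positivity
        linarith
    _ = _ := by ring

/-- The count `W * P ^ 3` is smaller than required: `k` alone is replaced by `z ^ 2 * (k * y +
lam)`, and squares of logarithms by cubes. -/
theorem param_bound_le {d : ℕ} {N W P C₁ C₅ X k y lam l z : ℝ} (hN : N ≤ 28 * W * P ^ 3)
    (hW : W ≤ C₅ * k * (lam ^ 2 + l ^ 2)) (hP0 : 0 ≤ P) (hP : P ≤ C₁ * X ^ d)
    (hC₅ : 0 ≤ C₅) (hk : 1 ≤ k) (hlam : 1 ≤ lam) (hl : 0 ≤ l)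
    (hy : 1 ≤ y) (hz : 1 ≤ z) :
    N ≤ 56 * C₅ * C₁ ^ 3 * z ^ 2 * (k * y + lam) * (lam ^ 3 + l ^ 3) * X ^ (3 * d) := by
  have h1 : lam ^ 2 + l ^ 2 ≤ 2 * (lam ^ 3 + l ^ 3) := by
    have h2 : lam ^ 2 ≤ lam ^ 3 := pow_le_pow_right₀ hlam (by norm_num)
    have h3 : l ^ 2 ≤ 1 + l ^ 3 := by
      rcases le_total l 1 with h | h
      · have := pow_le_one₀ hl h (n := 2)
        have := pow_nonneg hl 3
        linarith
      · have := pow_le_pow_right₀ h (by norm_num : 2 ≤ 3)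
        linarith
    have h4 : (1 : ℝ) ≤ lam ^ 3 := one_le_pow₀ hlam
    have h5 := pow_nonneg hl 3
    linarith
  have h2 : k ≤ z ^ 2 * (k * y + lam) := by
    have h3 : k ≤ k * y := le_mul_of_one_le_right (by linarith) hy
    calc k ≤ 1 * (k * y + lam) := by linarith
      _ ≤ _ := mul_le_mul_of_nonneg_right (one_le_pow₀ hz) (by linarith)
  have hk0 : 0 ≤ k := by linarith
  have hlam0 : 0 ≤ lam := by linarith
  have hy0 : 0 ≤ y := by linarith
  have hz0 : 0 ≤ z := by linarith
  calc N ≤ 28 * W * P ^ 3 := hN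
    _ ≤ 28 * (C₅ * (z ^ 2 * (k * y + lam)) * (2 * (lam ^ 3 + l ^ 3))) * (C₁ * X ^ d) ^ 3 := by
        gcongr
        exact hW.trans (by gcongr)
    _ = _ := by ring

set_option maxHeartbeats 1000000 in
theorem mainTheorem2 (d : ℕ) (hd : d = 1 ∨ d = 2 ∨ d = 3) (α β : ℝ) (hα : 0 < α) (hαβ : α ≤ β)
    (c₁ c₂ : ℝ) (hc₁ : 0 < c₁) (hc₁₂ : c₁ ≤ c₂) :
    ∃ C : ℝ, 0 < C ∧
      ∀ (T : CartesianMesh d) (r s ℓ k : ℕ) (H h : ℝ),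
        H = T.size → 0 < H → H < 1 / 4 → 2 ≤ r → 2 ≤ s →
        h = H / (r * s) →
        c₁ * |Real.log H| ≤ ℓ → (ℓ : ℝ) ≤ c₂ * |Real.log H| → 1 ≤ k →
        ∃ Ψ : NeuralNetwork (((2 * ℓ + 1) * r) ^ d) ((2 * ℓ + 2) ^ d * 2 ^ d),
          (∀ K : Fin d → ℕ, T.IsInner ℓ K →
            ∀ A : (Fin d → ℝ) → ℝ, (T.refine r).IsAdmissible α β A →
              spectralNorm2 (T.localPGLOD ((T.refine r).refine s) A ℓ K -
                matOfVec (Ψ.realize (T.coeffVector r ℓ K A))) ≤ C * H ^ k) ∧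
          (Ψ.depth : ℝ) ≤ C * k * (|Real.log h| ^ 2 + |Real.log k| ^ 2) ∧
          (Ψ.numParams : ℝ) ≤ C * h⁻¹ ^ 2 * (k * |Real.log H| + |Real.log h|) *
            (|Real.log h| ^ 3 + |Real.log k| ^ 3) * (|Real.log H| * H / h) ^ (3 * d) := by
  have hd0 : 0 < d := by omega
  have hβ : 0 < β := hα.trans_le hαβ
  have hc₂ : 0 < c₂ := hc₁.trans_le hc₁₂
  obtain ⟨C₁, hC₁⟩ : ∃ C₁, C₁ = 3 * (8 * c₂) ^ d := ⟨_, rfl⟩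
  have hC₁0 : 0 < C₁ := by rw [hC₁]; positivity
  obtain ⟨C₃, hC₃⟩ : ∃ C₃, C₃ = 1 + C₁ ^ 2 * β * (d ^ 3 + 1) * (1 / α + 2) := ⟨_, rfl⟩
  have hC₃0 : 0 < C₃ := by rw [hC₃]; positivity
  obtain ⟨B, hB⟩ : ∃ B, B = C₁ * C₃ ^ 2 * (128 * C₁ ^ 2 + β / α) := ⟨_, rfl⟩
  have hB0 : 0 < B := by rw [hB]; positivity
  -- The constant `2 * B` is absorbed into the exponent, since `2 * B ≤ n ≤ exp (n * lam)` for `lam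
  -- ≥ 1`. The factor `2` accounts for the two error sources.
  obtain ⟨n, hn⟩ : ∃ n : ℕ, 2 * B ≤ n := exists_nat_ge _
  obtain ⟨C₅, hC₅, hcount⟩ := exists_iteration_counts (α / β) (by positivity)
    ((div_le_one hβ).2 hαβ) (n + (7 * d + 4))
  refine ⟨1 + C₅ + 56 * C₅ * C₁ ^ 3, by positivity, ?_⟩
  intro T r s ℓ k H h hHT hH hH4 hr hs hh hℓ₁ hℓ₂ hk
  have hr2 : (2 : ℝ) ≤ r := by exact_mod_cast hr
  have hs2 : (2 : ℝ) ≤ s := by exact_mod_cast hs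
  have hrs : (1 : ℝ) ≤ r * s := by nlinarith
  have hh0 : 0 < h := by rw [hh]; positivity
  have hhH : h ≤ H := by rw [hh]; exact div_le_self hH.le hrs
  have hk1 : (1 : ℝ) ≤ k := by exact_mod_cast hk
  have hlogk : 0 ≤ Real.log k := Real.log_nonneg hk1
  -- `H < 1 / 4 < exp (-1)`.
  have hlogH : 1 ≤ -Real.log H := by
    have h1 : H < Real.exp (-1) := by
      have h2 := Real.exp_one_lt_d9
      rw [Real.exp_neg]
      exact hH4.trans_le (by rw [← one_div]; gcongr; linarith)
    have := (Real.log_lt_iff_lt_exp hH).2 h1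
    linarith
  have hlogh : 1 ≤ -Real.log h := by
    have := Real.log_le_log hh0 hhH
    linarith
  have hlogH' : -Real.log H ≤ 1 / H := by
    have := Real.log_le_sub_one_of_pos (by positivity : 0 < 1 / H)
    rw [one_div, Real.log_inv] at this
    rw [one_div]
    linarith
  rw [abs_of_neg (by linarith : Real.log H < 0)] at *
  rw [abs_of_neg (by linarith : Real.log h < 0), abs_of_nonneg hlogk]
  set y := -Real.log H with hy
  obtain ⟨lam, hlam⟩ : ∃ lam, lam = -Real.log h := ⟨_, rfl⟩
  rw [← hlam] at hlogh ⊢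
  have hx : h⁻¹ = Real.exp lam := by rw [hlam, Real.exp_neg, Real.exp_log hh0]
  obtain ⟨X, hX⟩ : ∃ X, X = y * H / h := ⟨_, rfl⟩
  have hXeq : X = y * (r * s) := by
    rw [hX, hh]
    field_simp
  have hX0 : 0 ≤ X := by rw [hXeq]; positivity
  have hXx : X ≤ Real.exp lam := by
    rw [← hx, hX, div_eq_mul_inv]
    refine mul_le_of_le_one_left (by positivity) ?_
    rwa [← le_div_iff₀ hH]
  have hHx : 1 / H ≤ Real.exp lam := by
    rw [← hx, one_div]
    exact inv_anti₀ hh0 hhH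
  have hx1 : 1 ≤ Real.exp lam := Real.one_le_exp (by linarith)
  rw [← hX]
  have hℓ : 1 ≤ ℓ := by
    have : (0 : ℝ) < ℓ := lt_of_lt_of_le (by positivity) hℓ₁
    exact_mod_cast this
  -- With `lam = |log h|` the accuracy is `exp (-(k * lam)) = h ^ k`, which is at most `H ^ k`.
  obtain ⟨L, S, hL, hS, hLS⟩ := hcount lam k hlogh hk
  set W : ℝ := (L : ℝ) * (S + 2) + 2 with hW
  have hW0 : 0 ≤ W := by positivity
  have hWdep : W ≤ (1 + C₅ + 56 * C₅ * C₁ ^ 3) * k * (lam ^ 2 + Real.log k ^ 2) := by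
    refine hLS.trans ?_
    gcongr
    have : 0 ≤ C₅ * C₁ ^ 3 := by positivity
    linarith
  -- The network is built from one reference element. If there is none, the error bound is void and
  -- the zero network meets the size bounds.
  by_cases hK : ∃ K, T.IsInner ℓ K
  swap
  · refine ⟨NeuralNetwork.last 0 0, fun K hK' => absurd ⟨K, hK'⟩ hK, ?_, ?_⟩
    · refine le_trans ?_ hWdep
      have : 0 ≤ (L : ℝ) * (S + 2) := by positivity
      simp only [NeuralNetwork.depth, Nat.cast_one, hW]
      linarith
    · simp only [NeuralNetwork.numParams, NeuralNetwork.layerParams]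
      have : 0 ≤ lam := by linarith
      simp
      positivity
  obtain ⟨K, hK⟩ := hK
  obtain ⟨P, hP⟩ : ∃ P : ℝ, P = 3 * (8 * ℓ * (r * s)) ^ d := ⟨_, rfl⟩
  have hP1 : 1 ≤ P := by
    have h1 : (1 : ℝ) ≤ ℓ := by exact_mod_cast hℓ
    have h2 : (1 : ℝ) ≤ (8 * ℓ * (r * s)) ^ d := one_le_pow₀ (by nlinarith)
    rw [hP]
    linarith
  have hPX : P ≤ C₁ * X ^ d := by
    rw [hP, hC₁, hXeq, mul_assoc 3, ← mul_pow]
    have : 8 * (ℓ : ℝ) * (r * s) ≤ 8 * c₂ * (y * (r * s)) := by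
      calc 8 * (ℓ : ℝ) * (r * s) ≤ 8 * (c₂ * y) * (r * s) := by gcongr
        _ = _ := by ring
    gcongr
  have hPx : P ≤ C₁ * Real.exp lam ^ d := hPX.trans (by gcongr)
  obtain ⟨D, hD⟩ : ∃ D, D = 1 + P ^ 2 * β * (d * (d / T.size * (d / T.size)) + 1) *
    (1 / α + 2) := ⟨_, rfl⟩
  have hD1 : 1 ≤ D := by
    have hT : 0 < T.size := hHT ▸ hH
    rw [hD, le_add_iff_nonneg_right]
    positivity
  have hDx : D ≤ C₃ * Real.exp lam ^ (2 * d + 2) := by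
    rw [hD, hC₃, ← hHT]
    exact scaling_factor_le hα hβ.le hH hx1 hHx (by linarith) hPx
  set q := β / α with hq
  have hq0 : 0 ≤ q := by positivity
  set t : ℝ := 7 ^ L / 4 ^ S with ht
  have ht0 : 0 ≤ t := by positivity
  set v : ℝ := (1 - α / β) ^ (2 ^ L - 1) with hv
  have hv0 : 0 ≤ v := pow_nonneg (sub_nonneg.2 ((div_le_one hβ).2 hαβ)) _
  have hBexp : 2 * B * Real.exp lam ^ (7 * d + 4) ≤ Real.exp ((n + (7 * d + 4) : ℕ) * lam) := by
    rw [Real.exp_nat_mul, pow_add _ n]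
    refine mul_le_mul_of_nonneg_right (hn.trans ?_) (by positivity)
    have h1 : Real.exp n ≤ Real.exp lam ^ n := by
      rw [← Real.exp_nat_mul]
      exact Real.exp_le_exp.2 (le_mul_of_one_le_right (by positivity) hlogh)
    linarith [Real.add_one_le_exp (n : ℝ)]
  have herr : P * (D ^ 2 * (128 * P ^ 2 * t + v * q)) ≤ Real.exp (-(k * lam)) := by
    have h1 := error_factor_le (by linarith) (by linarith) hPx hDx hx1 ht0
      hv0 hq0 hC₁0.le
    rw [← hB] at h1
    have h2 := mul_le_mul_of_nonneg_right hBexp (add_nonneg ht0 hv0)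
    linarith
  have hexpk : Real.exp (-(k * lam)) ≤ H ^ k := by
    have h1 : Real.exp (-(k * lam)) = h ^ k := by
      rw [← mul_neg, Real.exp_nat_mul, Real.exp_neg, ← hx, inv_inv]
    rw [h1]
    exact pow_le_pow_left₀ hh0.le hhH k
  have h128 : (7 : ℝ) ^ L * (128 * P ^ 2 / 4 ^ S) = 128 * P ^ 2 * t := by rw [ht]; ring
  -- The smallness condition for the squarings is a by-product of the total error bound, because `P`
  -- and `D` are at least `1`.
  have hδ : (7 : ℝ) ^ L * (128 * P ^ 2 / 4 ^ S) ≤ 1 := by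
    have h1 : 0 ≤ 128 * P ^ 2 * t := by positivity
    have h2 : 0 ≤ v * q := by positivity
    have h3 : 128 * P ^ 2 * t + v * q ≤ P * (D ^ 2 * (128 * P ^ 2 * t + v * q)) := by
      rw [← mul_assoc]
      exact le_mul_of_one_le_left (by positivity) (one_le_mul_of_one_le_of_one_le hP1
        (one_le_pow₀ hD1))
    have h4 : H ^ k ≤ 1 := pow_le_one₀ hH.le (by linarith)
    linarith
  obtain ⟨Ψ, hΨ, hdep, hpar⟩ := hK.exists_network hd0 (hHT ▸ hH) (by rw [← hHT]; linarith)
    (by omega) (by omega) hℓ hα hαβ L S hP hD hδ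
  refine ⟨Ψ, fun K' hK' A hA => ?_, ?_, ?_⟩
  · refine (hΨ K' hK' A hA).trans ?_
    rw [h128]
    refine (herr.trans hexpk).trans (le_mul_of_one_le_left (by positivity) ?_)
    have : 0 ≤ 56 * C₅ * C₁ ^ 3 := by positivity
    linarith
  · rw [hdep]
    push_cast
    exact hWdep
  · refine (param_bound_le hpar hLS (by linarith) hPX hC₅.le hk1 hlogh hlogk hlogH
      (hx1.trans hx.ge)).trans ?_
    have : 0 ≤ lam := by linarith
    have : 0 ≤ y := by linarith
    gcongr
    linarith

end
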